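/- **Setting.** Let $M$ be a connected $n$-dimensional smooth manifold, $D\subset TM$ a smooth distribution of rank $m$ with a smooth inner product $g$ on it, and $d$ the Carnot–Carathéodory distance of $(D,g)$ (infimum of lengths of horizontal Lipschitz curves). For $U$ open let $\mathcal X^1(U)$ be the smooth horizontal fields on $U$, $\mathcal X^{j+1}=\mathcal X^j+[\mathcal X^1,\mathcal X^j]$, and $V^j(y)=\{X(y):X\in\mathcal X^j\}$, $V^0=0$. Fields $X_1,\dots,X_m$ satisfy (C) on $U$ if they span $D$ on $U$ and, with their iterated brackets of order at most some $k$, span $T_yM$ for all $y\in U$. Assume that $(M,D,g)$ is regular: near each point there is a $g$-orthonormal frame of $D$ satisfying (C) (with a common $k$), and the numbers $\nu_j=\dim V^j(y)$ do not depend on $y\in M$. A frame $X_1,\dots,X_n$ on an open set $U\subset M$ is *adapted* if $X_1,\dots,X_m$ satisfy (C), the other $X_i$ are multi-brackets $[X_{a_1},[\dots,X_{a_q}]\dots]$ of these, and $X_1(y),\dots,X_{\nu_j}(y)$ is a basis of $V^j(y)$ for all $j$ and $y\in U$; $\deg X_i$ is the $p\ge 1$ with $X_i(y)\in V^p(y)\setminus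 V^{p-1}(y)$ for all $y$. It is *normal* if moreover (a) for some compact neighbourhood $W$ of $0\in\mathbb R^n$ the limit $\lim_{\varepsilon\to0+}\frac1\varepsilon d\big(\exp(\sum\varepsilon^{\deg X_i}a_iX_i)(y),y\big)=A(y,a)\in[0,\infty)$ exists, uniformly for $y$ in compact subsets of $U$ and $a\in W$, and $A(y,a)>0$ for $a\ne0$; (b) for every sufficiently small compact $K\subset U$ there are a compact neighbourhood $U_K$ of $0\in\mathbb R^n$ and functions $P_i:U_K\times U_K\times K\to\mathbb R$ with $\exp(\sum a_iX_i)(x)=\exp(\sum P_i(a,b,x)X_i)\circ\exp(\sum b_iX_i)(x)$, such that $\lim_{\varepsilon\to0+}\varepsilon^{-\deg X_i}P_i\big((\varepsilon^{\deg X_j}a_j)_j,(\varepsilon^{\deg X_k}b_k)_k,x\big)\in\mathbb R$ exists uniformly in $x\in K$, $a,b\in U_K$. Let $X_1,\dots,X_n$ be a normal frame on $U$, let $\bar d$ be the distance of a smooth Riemannian metric on $M$ extending $g$, and put, for $u=\exp(\sum a_iX_i)(x)$, $$\delta^x_\varepsilon u=\exp\Big(\sum\varepsilon^{\deg X_i}a_iX_i\Big)(x),\quad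 \bar\delta^x_\varepsilon u=\exp\Big(\sum\varepsilon a_iX_i\Big)(x),\quad Q^x_\varepsilon u=\exp\Big(\sum\varepsilon^{\deg X_i-1}a_iX_i\Big)(x).$$ Here $\rho:U\to(0,\infty)$ is continuous, $a$ and the rescaled coordinate vector range over the ball $B_{\rho(x)}\subset\mathbb R^n$, on which $a\mapsto\exp(\sum a_iX_i)(x)$ is defined and injective, and $U(x)$ is the image of this ball. All compact sets $K$ below are subsets of $U$. **Theorem.** There is a continuous $\rho_0:U\to(0,\infty)$ such that for every continuous $\rho:U\to(0,\infty)$ with $\rho\le\rho_0$: 1. $(U,\bar d,\bar\delta)$ is a (local) strong dilation structure, that is (A0) the maps $\bar\delta^x_\varepsilon:U(x)\to V_\varepsilon(x)$ for $\varepsilon\le1$ and $\bar\delta^x_\varepsilon:W_\varepsilon(x)\to U(x)$ for $\varepsilon>1$ are homeomorphisms between open neighbourhoods of $x$; for each compact $K$ there are $r>0$ and $1<A<B$ such that for $x\in K$ the closed $3r$-ball at $x$ is compact and contained in $U$, $B(x,r\varepsilon)\subset\bar\delta^x_\varepsilon B(x,rA)\subset V_\varepsilon(x)\subset W_{1/\varepsilon}(x)\subset\bar\delta^x_\varepsilon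 B(x,rB)$ for $\varepsilon\in(0,1)$; and $\bar\delta^x_\varepsilon v\in W_{1/\varepsilon}(\bar\delta^x_\varepsilon u)$ for $x\in K$, $u,v$ close to $x$ and $\varepsilon$ small; (A1) $\bar\delta^x_\varepsilon x=x$, $\bar\delta^x_1=\mathrm{id}$, and $(\varepsilon,x,y)\mapsto\bar\delta^x_\varepsilon y$ extends continuously to the closure of its domain in $[0,\infty)\times U\times U$, with value $x$ at $\varepsilon=0$; (A2) $\bar\delta^x_\varepsilon\bar\delta^x_\mu=\bar\delta^x_{\varepsilon\mu}$ where defined; (A3) $\frac1\varepsilon\bar d(\bar\delta^x_\varepsilon u,\bar\delta^x_\varepsilon v)$ converges, uniformly for $x\in K$ and $u,v\in\bar B(x,rA)$, to a distance $\bar d^x(u,v)$; (A4) $\bar\Delta^x_\varepsilon(u,v)=\bar\delta_{1/\varepsilon}^{\bar\delta^x_\varepsilon u}\bar\delta^x_\varepsilon v$ converges as $\varepsilon\to0$, uniformly for $x\in K$ and $u,v$ sufficiently close to $x$. 2. $Q$ is a coherent projection of $(U,\bar d,\bar\delta)$: (I) $Q^x_\varepsilon$, $\varepsilon\in(0,1]$,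 is defined on $U(x)$ and invertible onto its image with inverse $Q^x_{1/\varepsilon}$, and $Q^x_\varepsilon\bar\delta^x_\mu=\bar\delta^x_\mu Q^x_\varepsilon$ where defined; (II) $Q^x_\varepsilon u\to Q^xu$ as $\varepsilon\to0$, uniformly on compact sets of pairs $(x,u)$, $u\in U(x)$; (III) $Q^x_\varepsilon Q^x_\mu=Q^x_{\varepsilon\mu}$ where defined, $Q^x_1=\mathrm{id}$, $Q^x_\varepsilon x=x$; (IV) $\Theta^x_\varepsilon(u,v)=\bar\delta^x_{1/\varepsilon}\,Q_{1/\varepsilon}^{\bar\delta^x_\varepsilon Q^x_\varepsilon u}\,\bar\delta^x_\varepsilon Q^x_\varepsilon v$ is defined for small $\varepsilon$ and converges as $\varepsilon\to0$, uniformly for $x\in K$ and $u,v$ sufficiently close to $x$. 3. (A) For each compact $K$ there is $L>0$ with $\frac1\varepsilon\bar d(\bar\delta^x_\varepsilon Q^x_\varepsilon u,\bar\delta^x_\varepsilon Q^x_\varepsilon v)\le L\,\bar d(u,v)$ for all $\varepsilon\in(0,1]$, $x\in K$ and $u,v$ sufficiently close to $x$. 4. (B) For $x\in K$ and $u=Q^xu$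 sufficiently close to $x$, the curve $t\in[0,1]\mapsto c(t)=Q^x\bar\delta^x_tQ^x_tu=\bar\delta^x_tu=\bar\delta^x_tQ^x_tu$ (with $c(0)=x$) is $Q$-everywhere horizontal: for each $t$ it has a derivative $\dot c(t)$ with respect to $\bar\delta$ and $Q^{c(t)}\dot c(t)=\dot c(t)$. Moreover $\bar l(c|_{[0,a]})/\bar d(x,\bar\delta^x_au)\to1$ as $a\to0$, uniformly in these $x$ and $u\neq x$. Here $v=\dot c(t)$ means: $v\in\bar D_{c(t)}$, $\frac1\varepsilon\bar d(c(t+\varepsilon),\bar\delta^{c(t)}_\varepsilon v)\to0$ and $\frac1\varepsilon\bar d(c(t-\varepsilon),\bar\delta^{c(t)}_\varepsilon v')\to0$ as $\varepsilon\to0+$, with $v'=\lim\bar\Delta^{c(t)}_\varepsilon(v,c(t))$ (one-sided at $t=0,1$), where $\bar D_x$ is defined from $\bar\delta$ as $D_x$ is from $\delta$ below. 5. The sums $\Sigma^x_\varepsilon(u,v)=\delta^x_{1/\varepsilon}\delta_\varepsilon^{\delta^x_\varepsilon u}v$ converge as $\varepsilon\to0$, uniformly for $x\in K$ and $u,v$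 sufficiently close to $x$, to the operation $\Sigma^x$ of the tangent space $T_x(U,d,\delta)$; and for every $x\in U$ the image $Q^x(U(x))$ is contained in $D_x=D(T_x(U,d,\delta))$, the set of all $u\in U(x)$ such that $\delta^x_{s+t}u=\lim_{\varepsilon\to0+}\Sigma^x_\varepsilon(\delta^x_su,\delta^x_tu)$ for all $s,t>0$ for which $\delta^x_su,\delta^x_tu,\delta^x_{s+t}u$ are defined. -/

import Mathlib

open Set Filter Topology MeasureTheory Bundle
open scoped Manifold ContDiff ENNReal NNReal Bundle

noncomputable section

namespace SubRiem

/-! ### Sub-Riemannian manifolds -/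

/-- Vector fields on an `n`-dimensional manifold (smoothness is required separately). -/
abbrev VField (n : ℕ) (M : Type*) [TopologicalSpace M]
    [ChartedSpace (EuclideanSpace ℝ (Fin n)) M] : Type _ :=
  ∀ x : M, TangentSpace (𝓡 n) x

/-- The vector field `X` is smooth on the set `U`. -/
def SmoothOn {n : ℕ} {M : Type*} [TopologicalSpace M]
    [ChartedSpace (EuclideanSpace ℝ (Fin n)) M] [IsManifold (𝓡 n) ∞ M]
    (X : VField n M) (U : Set M) : Prop :=
  ContMDiffOn (𝓡 n) (𝓡 n).tangent ∞ (fun y => (⟨y, X y⟩ : TangentBundle (𝓡 n) M)) U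

/-- A smooth distribution (subbundle of the tangent bundle) of constant rank `m` together with
a smooth Euclidean inner product on it. -/
structure SubRiemannianStructure (n m : ℕ) (M : Type*) [TopologicalSpace M]
    [ChartedSpace (EuclideanSpace ℝ (Fin n)) M] [IsManifold (𝓡 n) ∞ M] where
  /-- the distribution -/
  D : ∀ x : M, Submodule ℝ (TangentSpace (𝓡 n) x)
  /-- the distribution is a smooth subbundle of rank `m` -/
  local_frame : ∀ x : M, ∃ U : Set M, IsOpen U ∧ x ∈ U ∧ ∃ X : Fin m → VField n M,
    (∀ i, SmoothOn (X i) U) ∧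
    ∀ y ∈ U, LinearIndependent ℝ (fun i => X i y) ∧
      Submodule.span ℝ (range fun i => X i y) = D y
  /-- the metric on the distribution -/
  metric : ∀ x : M, D x →ₗ[ℝ] D x →ₗ[ℝ] ℝ
  metric_symm : ∀ x v w, metric x v w = metric x w v
  metric_pos : ∀ x v, v ≠ 0 → 0 < metric x v v
  metric_smooth : ∀ (U : Set M), IsOpen U → ∀ X Y : ∀ x : M, D x,
    SmoothOn (fun x => (X x : TangentSpace (𝓡 n) x)) U →
    SmoothOn (fun x => (Y x : TangentSpace (𝓡 n) x)) U →
    ContMDiffOn (𝓡 n) 𝓘(ℝ, ℝ) ∞ (fun x => metric x (X x) (Y x)) U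

/-- The filtration `𝒳¹ ⊆ 𝒳² ⊆ …` of vector fields over an open set `U`: `𝒳¹` consists of the
smooth horizontal fields, and `𝒳^{j+1} = 𝒳^j + [𝒳¹, 𝒳^j]`.  By convention `𝒳⁰ = 0`. -/
def filtration {n m : ℕ} {M : Type*} [TopologicalSpace M]
    [ChartedSpace (EuclideanSpace ℝ (Fin n)) M] [IsManifold (𝓡 n) ∞ M]
    (S : SubRiemannianStructure n m M) (U : Set M) : ℕ → Submodule ℝ (VField n M)
  | 0 => ⊥
  | 1 => Submodule.span ℝ {X | SmoothOn X U ∧ ∀ y ∈ U, X y ∈ S.D y}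
  | j + 2 => filtration S U (j + 1) ⊔
      Submodule.span ℝ {Z | ∃ X ∈ filtration S U 1, ∃ Y ∈ filtration S U (j + 1),
        Z = VectorField.mlieBracket (𝓡 n) X Y}

/-- `V^j(y)`, the values at `y` of the fields in `𝒳^j`. -/
def flag {n m : ℕ} {M : Type*} [TopologicalSpace M]
    [ChartedSpace (EuclideanSpace ℝ (Fin n)) M] [IsManifold (𝓡 n) ∞ M]
    (S : SubRiemannianStructure n m M) (U : Set M) (j : ℕ) (y : M) :
    Submodule ℝ (TangentSpace (𝓡 n) y) :=
  (filtration S U j).map (LinearMap.proj y)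

/-- The multi-bracket `[X_{a₁}, [X_{a₂}, …, X_{a_q}]…]` of a word `a₁ a₂ … a_q`. -/
def bracketWord {n m : ℕ} {M : Type*} [TopologicalSpace M]
    [ChartedSpace (EuclideanSpace ℝ (Fin n)) M]
    (X : Fin m → VField n M) : List (Fin m) → VField n M
  | [] => 0
  | [a] => X a
  | a :: b :: w => VectorField.mlieBracket (𝓡 n) (X a) (bracketWord X (b :: w))

/-- Chow's condition (C) on `U`, with brackets of order at most `k`. -/
structure ChowCondition {n m : ℕ} {M : Type*} [TopologicalSpace M]
    [ChartedSpace (EuclideanSpace ℝ (Fin n)) M] [IsManifold (𝓡 n) ∞ M]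
    (S : SubRiemannianStructure n m M) (U : Set M) (k : ℕ) (X : Fin m → VField n M) : Prop where
  smooth : ∀ i, SmoothOn (X i) U
  span_distribution : ∀ y ∈ U, Submodule.span ℝ (range fun i => X i y) = S.D y
  span_tangent : ∀ y ∈ U,
    Submodule.span ℝ {v | ∃ w : List (Fin m), w ≠ [] ∧ w.length ≤ k ∧ v = bracketWord X w y} = ⊤

/-- Regularity: near every point there is an orthonormal frame of the distribution that satisfies
(C), and the numbers `ν_j = dim V^j(y)` do not depend on the point `y` of the manifold. -/
def IsRegular {n m : ℕ} {M : Type*} [TopologicalSpace M]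
    [ChartedSpace (EuclideanSpace ℝ (Fin n)) M] [IsManifold (𝓡 n) ∞ M]
    (S : SubRiemannianStructure n m M) : Prop :=
  ∃ (k : ℕ) (ν : ℕ → ℕ), ∀ x : M, ∃ U : Set M, IsOpen U ∧ x ∈ U ∧
    (∃ e : Fin m → ∀ y : M, S.D y,
      ChowCondition S U k (fun i y => (e i y : TangentSpace (𝓡 n) y)) ∧
      ∀ y ∈ U, ∀ i j, S.metric y (e i y) (e j y) = if i = j then 1 else 0) ∧
    ∀ y ∈ U, ∀ j, Module.finrank ℝ (flag S U j y) = ν j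

/-! ### The Carnot–Carathéodory distance -/

/-- Horizontal curves parametrized by `[0,1]`: (locally) Lipschitz curves which have, at almost
every time, a derivative that lies in the distribution. -/
structure IsHorizontalCurve {n m : ℕ} {M : Type*} [TopologicalSpace M]
    [ChartedSpace (EuclideanSpace ℝ (Fin n)) M] [IsManifold (𝓡 n) ∞ M]
    (S : SubRiemannianStructure n m M) (c : ℝ → M) : Prop where
  continuousOn : ContinuousOn c (Icc 0 1)
  lipschitz : ∀ t ∈ Icc (0 : ℝ) 1, ∃ (C : ℝ≥0), ∃ N ∈ 𝓝[Icc (0 : ℝ) 1] t,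
    LipschitzOnWith C (fun s => extChartAt (𝓡 n) (c t) (c s)) N
  horizontal : ∀ᵐ t ∂(volume.restrict (Icc (0 : ℝ) 1)),
    MDifferentiableAt 𝓘(ℝ, ℝ) (𝓡 n) c t ∧ mfderiv 𝓘(ℝ, ℝ) (𝓡 n) c t (1 : ℝ) ∈ S.D (c t)

open Classical in
/-- The speed `g(ċ(t), ċ(t))^{1/2}` of a curve at a time when `ċ(t)` is horizontal. -/
def speed {n m : ℕ} {M : Type*} [TopologicalSpace M]
    [ChartedSpace (EuclideanSpace ℝ (Fin n)) M] [IsManifold (𝓡 n) ∞ M]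
    (S : SubRiemannianStructure n m M) (c : ℝ → M) (t : ℝ) : ℝ :=
  if h : mfderiv 𝓘(ℝ, ℝ) (𝓡 n) c t (1 : ℝ) ∈ S.D (c t)
  then Real.sqrt (S.metric (c t) ⟨_, h⟩ ⟨_, h⟩) else 0

/-- The Carnot–Carathéodory distance (infinite if there is no horizontal curve). -/
def ccEDist {n m : ℕ} {M : Type*} [TopologicalSpace M]
    [ChartedSpace (EuclideanSpace ℝ (Fin n)) M] [IsManifold (𝓡 n) ∞ M]
    (S : SubRiemannianStructure n m M) (x y : M) : ℝ≥0∞ :=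
  ⨅ (c : ℝ → M) (_ : IsHorizontalCurve S c ∧ c 0 = x ∧ c 1 = y),
    ∫⁻ t in Icc (0 : ℝ) 1, ENNReal.ofReal (speed S c t)

/-! ### Adapted and normal frames -/

/-- `X` is an adapted frame on `U` for which `deg i` is the degree of `X i`. -/
structure IsAdaptedFrame {n m : ℕ} {M : Type*} [TopologicalSpace M]
    [ChartedSpace (EuclideanSpace ℝ (Fin n)) M] [IsManifold (𝓡 n) ∞ M]
    (S : SubRiemannianStructure n m M) (U : Set M) (X : Fin n → VField n M)
    (deg : Fin n → ℕ) : Prop where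
  smooth : ∀ i, SmoothOn (X i) U
  /-- the first `m` fields satisfy (C), the other ones are multi-brackets of them -/
  chow : ∃ (h : m ≤ n) (k : ℕ), ChowCondition S U k (fun i => X (Fin.castLE h i)) ∧
    ∀ i : Fin n, m ≤ i.val → ∃ w : List (Fin m), w ≠ [] ∧
      ∀ y ∈ U, X i y = bracketWord (fun i => X (Fin.castLE h i)) w y
  /-- the first `ν_j` fields are a basis of `V^j` at every point -/
  basis : ∀ j, ∀ y ∈ U,
    LinearIndependent ℝ
      (fun i : {i : Fin n // i.val < Module.finrank ℝ (flag S U j y)} => X i.1 y) ∧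
    Submodule.span ℝ
      ((fun i => X i y) '' {i : Fin n | i.val < Module.finrank ℝ (flag S U j y)}) = flag S U j y
  deg_pos : ∀ i, 1 ≤ deg i
  deg_spec : ∀ i, ∀ y ∈ U, X i y ∈ flag S U (deg i) y ∧ X i y ∉ flag S U (deg i - 1) y

/-- `IsExp U V x y` says that `y = exp(V)(x)`: some integral curve of `V` in `U` goes from `x`
to `y` in unit time. -/
def IsExp {n : ℕ} {M : Type*} [TopologicalSpace M]
    [ChartedSpace (EuclideanSpace ℝ (Fin n)) M]
    (U : Set M) (V : VField n M) (x y : M) : Prop :=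
  ∃ γ : ℝ → M, γ 0 = x ∧ γ 1 = y ∧ (∀ t ∈ Icc (0 : ℝ) 1, γ t ∈ U) ∧
    IsMIntegralCurveOn (I := 𝓡 n) γ V (Icc 0 1)

/-- The field `∑ aᵢ Xᵢ`. -/
def combination {n : ℕ} {M : Type*} [TopologicalSpace M]
    [ChartedSpace (EuclideanSpace ℝ (Fin n)) M]
    (X : Fin n → VField n M) (a : Fin n → ℝ) : VField n M :=
  fun x => ∑ i, a i • X i x

/-- The coordinate scaling `(ε ^ (w i) * a i)_i`. -/
def scale {n : ℕ} (w : Fin n → ℕ) (ε : ℝ) (a : Fin n → ℝ) : Fin n → ℝ :=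
  fun i => ε ^ (w i) * a i

/-- Normal frames on the open set `U`. -/
structure IsNormalFrame {n m : ℕ} {M : Type*} [TopologicalSpace M]
    [ChartedSpace (EuclideanSpace ℝ (Fin n)) M] [IsManifold (𝓡 n) ∞ M]
    (S : SubRiemannianStructure n m M) (U : Set M) (X : Fin n → VField n M)
    (deg : Fin n → ℕ) : Prop where
  adapted : IsAdaptedFrame S U X deg
  /-- `ε⁻¹ d(exp(∑ ε^{deg Xᵢ} aᵢ Xᵢ)(y), y)` converges to `A y a`, uniformly -/
  dist_limit : ∃ (W : Set (Fin n → ℝ)) (A : M → (Fin n → ℝ) → ℝ), IsCompact W ∧ W ∈ 𝓝 0 ∧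
    (∀ y ∈ U, ∀ a ∈ W, 0 ≤ A y a ∧ (a ≠ 0 → 0 < A y a)) ∧
    ∀ K ⊆ U, IsCompact K → ∀ η > 0, ∃ ε₀ > 0, ∀ ε, 0 < ε → ε < ε₀ → ∀ y ∈ K, ∀ a ∈ W, ∀ z,
      IsExp U (combination X (scale deg ε a)) y z →
        ccEDist S z y ≠ ⊤ ∧ |(ccEDist S z y).toReal / ε - A y a| < η
  /-- the functions `P`, for all sufficiently small compact sets `K` -/
  composition : ∀ x₀ ∈ U, ∃ N ∈ 𝓝 x₀, ∀ K ⊆ U ∩ N, IsCompact K →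
    ∃ (UK : Set (Fin n → ℝ)) (P P₀ : (Fin n → ℝ) → (Fin n → ℝ) → M → (Fin n → ℝ)),
      IsCompact UK ∧ UK ∈ 𝓝 0 ∧
      (∀ x ∈ K, ∀ a ∈ UK, ∀ b ∈ UK, ∃ y z,
        IsExp U (combination X b) x y ∧ IsExp U (combination X (P a b x)) y z ∧
        IsExp U (combination X a) x z) ∧
      ∀ η > 0, ∃ ε₀ > 0, ∀ ε, 0 < ε → ε < ε₀ → ∀ x ∈ K, ∀ a ∈ UK, ∀ b ∈ UK,
        scale deg ε a ∈ UK → scale deg ε b ∈ UK →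
        ∀ i, |(ε ^ deg i)⁻¹ * P (scale deg ε a) (scale deg ε b) x i - P₀ a b x i| < η

/-! ### Families of local maps, dilation structures -/

/-- A family of partially defined maps `f_ε^x`, indexed by a base point `x` and a coefficient
`ε > 0`; the map `f_ε^x` is meaningful on the set `dom ε x` only. -/
structure MapField (M : Type*) where
  /-- the domain of the map with coefficient `ε` based at `x` -/
  dom : ℝ → M → Set M
  /-- the map with coefficient `ε` based at `x` -/
  map : ℝ → M → M → M

/-- The domain `U(x)` of the maps with coefficient `ε ≤ 1`. -/
def MapField.U {M : Type*} (f : MapField M) (x : M) : Set M := f.dom 1 x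

/-- `Δ_ε^x(u,v) = δ_{1/ε}^{δ_ε^x u} δ_ε^x v`. -/
def approxDiff {M : Type*} (δ : MapField M) (ε : ℝ) (x u v : M) : M :=
  δ.map ε⁻¹ (δ.map ε x u) (δ.map ε x v)

/-- `Σ_ε^x(u,v) = δ_{1/ε}^x δ_ε^{δ_ε^x u} v`. -/
def approxSum {M : Type*} (δ : MapField M) (ε : ℝ) (x u v : M) : M :=
  δ.map ε⁻¹ x (δ.map ε (δ.map ε x u) v)

/-- `F_ε^x(u,v)` converges in `X` to `L^x(u,v)` as `ε → 0`, uniformly for `x` in a compact set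
and `u, v` sufficiently close to `x`. -/
def UniformLimitNear {M : Type*} [MetricSpace M] (X : Set M)
    (F : ℝ → M → M → M → M) (L : M → M → M → M) : Prop :=
  ∀ K ⊆ X, IsCompact K → ∃ R > 0, (∀ x ∈ K, Metric.closedBall x R ⊆ X) ∧
    (∀ x ∈ K, ∀ u ∈ Metric.closedBall x R, ∀ v ∈ Metric.closedBall x R, L x u v ∈ X) ∧
    ∀ η > 0, ∃ ε₀ > 0, ∀ ε, 0 < ε → ε < ε₀ → ∀ x ∈ K,
      ∀ u ∈ Metric.closedBall x R, ∀ v ∈ Metric.closedBall x R, dist (F ε x u v) (L x u v) < η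

/-- Strong dilation structures on an open subset `X` of a metric space.  The sets of the
definition are `U(x) = δ.dom 1 x`, `V_ε(x) = δ_ε^x (U(x))` for `ε ≤ 1`, and `W_ε(x) = δ.dom ε x`
for `ε > 1`.  As `X` is only an open piece of a space, the axioms which refer to balls of a fixed
size are required locally: for each compact set `K ⊆ X`, base points in `K`, and the distance
`d / r` for some `r > 0` which depends on `K`.  (The global notion is the case where `r = 1`,
`A` and `B` do not depend on `K`.) -/
structure IsStrongDilationStructure {M : Type*} [MetricSpace M] (X : Set M)
    (δ : MapField M) : Prop where
  dom_le_one : ∀ x ∈ X, ∀ ε, 0 < ε → ε ≤ 1 → δ.dom ε x = δ.U x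
  U_subset : ∀ x ∈ X, δ.U x ⊆ X
  mem_dom : ∀ x ∈ X, ∀ ε > 0, x ∈ δ.dom ε x
  mapsTo : ∀ x ∈ X, ∀ ε > 0, MapsTo (δ.map ε x) (δ.dom ε x) X
  /-- the maps are homeomorphisms between open sets, onto `U(x)` if `ε > 1` -/
  homeo : ∀ x ∈ X, ∀ ε > 0, ∃ e : OpenPartialHomeomorph M M,
    e.source = δ.dom ε x ∧ EqOn e (δ.map ε x) (δ.dom ε x) ∧ (1 < ε → e.target = δ.U x)
  /-- axioms A0 and A3 -/
  a0_a3 : ∃ dx : M → M → M → ℝ, ∀ K ⊆ X, IsCompact K → ∃ r A B : ℝ, 0 < r ∧ 1 < A ∧ A < B ∧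
    (∀ x ∈ K, IsCompact (Metric.closedBall x (r * 3)) ∧ Metric.closedBall x (r * 3) ⊆ X) ∧
    (∀ x ∈ K, Metric.closedBall x (r * A) ⊆ δ.U x) ∧
    (∀ x ∈ K, ∀ ε, 0 < ε → ε < 1 →
      Metric.ball x (r * ε) ⊆ δ.map ε x '' Metric.ball x (r * A) ∧
      δ.map ε x '' Metric.ball x (r * A) ⊆ δ.map ε x '' δ.U x ∧
      δ.map ε x '' δ.U x ⊆ δ.dom ε⁻¹ x ∧
      δ.dom ε⁻¹ x ⊆ δ.map ε x '' (Metric.ball x (r * B) ∩ δ.U x)) ∧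
    (∃ R > 0, ∃ ε₀ ∈ Ioo (0 : ℝ) 1, ∀ x ∈ K, Metric.closedBall x R ⊆ δ.U x ∧
      ∀ u ∈ Metric.closedBall x R, ∀ v ∈ Metric.closedBall x R, ∀ ε ∈ Ioo 0 ε₀,
        δ.map ε x v ∈ δ.dom ε⁻¹ (δ.map ε x u)) ∧
    (∀ x ∈ K, ∀ u ∈ Metric.closedBall x (r * A), ∀ v ∈ Metric.closedBall x (r * A),
      (dx x u v = 0 ↔ u = v) ∧ dx x u v = dx x v u ∧
      ∀ w ∈ Metric.closedBall x (r * A), dx x u w ≤ dx x u v + dx x v w) ∧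
    ∀ η > 0, ∃ ε₀ > 0, ∀ ε, 0 < ε → ε < ε₀ → ∀ x ∈ K,
      ∀ u ∈ Metric.closedBall x (r * A), ∀ v ∈ Metric.closedBall x (r * A),
        |dist (δ.map ε x u) (δ.map ε x v) / ε - dx x u v| < η
  /-- axiom A1 -/
  a1_base : ∀ x ∈ X, ∀ ε > 0, δ.map ε x x = x
  a1_one : ∀ x ∈ X, ∀ u ∈ δ.U x, δ.map 1 x u = u
  a1_extension : ∃ F : ℝ × M × M → M,
    (∀ ε > 0, ∀ x ∈ X, ∀ y ∈ δ.dom ε x, F (ε, x, y) = δ.map ε x y) ∧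
    ContinuousOn F (closure {p : ℝ × M × M | 0 < p.1 ∧ p.2.1 ∈ X ∧ p.2.2 ∈ δ.dom p.1 p.2.1} ∩
      {p | p.2.1 ∈ X ∧ p.2.2 ∈ X}) ∧
    MapsTo F (closure {p : ℝ × M × M | 0 < p.1 ∧ p.2.1 ∈ X ∧ p.2.2 ∈ δ.dom p.1 p.2.1} ∩
      {p | p.2.1 ∈ X ∧ p.2.2 ∈ X}) X ∧
    ∀ x ∈ X, ∀ y ∈ δ.U x, F (0, x, y) = x
  /-- axiom A2 -/
  a2_dom : ∀ x ∈ X, ∀ ε > 0, ∀ μ > 0, ∀ u ∈ δ.dom μ x,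
    (δ.map μ x u ∈ δ.dom ε x ↔ u ∈ δ.dom (ε * μ) x)
  a2_eq : ∀ x ∈ X, ∀ ε > 0, ∀ μ > 0, ∀ u ∈ δ.dom μ x, δ.map μ x u ∈ δ.dom ε x →
    δ.map ε x (δ.map μ x u) = δ.map (ε * μ) x u
  /-- axiom A4 -/
  a4 : ∃ Δ : M → M → M → M, UniformLimitNear X (approxDiff δ) Δ

/-- The distribution `D(T_x(X, d, δ))` of the tangent space of a dilation structure at `x`: the
points `u` for which `s ↦ δ_s^x u` is a (local) morphism from `((0,∞), +)` to the (local) group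
with the operation `Σ^x = lim Σ_ε^x`. -/
def tangentDistribution {M : Type*} [TopologicalSpace M] (δ : MapField M) (x : M) : Set M :=
  {u | u ∈ δ.U x ∧ ∀ s > 0, ∀ t > 0, u ∈ δ.dom s x → u ∈ δ.dom t x → u ∈ δ.dom (s + t) x →
    Tendsto (fun ε => approxSum δ ε x (δ.map s x u) (δ.map t x u)) (𝓝[>] 0)
      (𝓝 (δ.map (s + t) x u))}

/-! ### Coherent projections -/

/-- The dilations `δ_ε^x = δ̄_ε^x Q_ε^x` induced by `Q`. -/
def induced {M : Type*} (δ Q : MapField M) : MapField M where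
  dom ε x := {u | u ∈ Q.dom ε x ∧ Q.map ε x u ∈ δ.dom ε x}
  map ε x u := δ.map ε x (Q.map ε x u)

/-- `Θ_ε^x(u,v) = δ̄_{1/ε}^x Q_{1/ε}^{δ̄_ε^x Q_ε^x u} δ̄_ε^x Q_ε^x v`. -/
def approxTheta {M : Type*} (δ Q : MapField M) (ε : ℝ) (x u v : M) : M :=
  δ.map ε⁻¹ x (Q.map ε⁻¹ (δ.map ε x (Q.map ε x u)) (δ.map ε x (Q.map ε x v)))

/-- `Q` is a coherent projection of the strong dilation structure `δ` on `X`, and `Q₀` is its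
limit `Q^x = lim Q_ε^x`. -/
structure IsCoherentProjection {M : Type*} [MetricSpace M] (X : Set M) (δ Q : MapField M)
    (Q₀ : M → M → M) : Prop where
  strong : IsStrongDilationStructure X δ
  /-- for `ε ≤ 1` the map `Q_ε^x` is defined on `U(x)`, with values in `X` -/
  dom_le_one : ∀ x ∈ X, ∀ ε, 0 < ε → ε ≤ 1 → Q.dom ε x = δ.U x
  mapsTo : ∀ x ∈ X, ∀ ε > 0, MapsTo (Q.map ε x) (Q.dom ε x) X
  induced_defined : ∀ x ∈ X, ∀ ε, 0 < ε → ε ≤ 1 → MapsTo (Q.map ε x) (δ.U x) (δ.dom ε x)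
  /-- (I): the inverse of `Q_ε^x` is `Q_{1/ε}^x`, defined on the image of `Q_ε^x` -/
  dom_inv : ∀ x ∈ X, ∀ ε, 0 < ε → ε ≤ 1 → Q.dom ε⁻¹ x = Q.map ε x '' δ.U x
  leftInv : ∀ x ∈ X, ∀ ε, 0 < ε → ε ≤ 1 → LeftInvOn (Q.map ε⁻¹ x) (Q.map ε x) (δ.U x)
  /-- (I): commutation with the dilations, both sides having the same domain -/
  comm_dom : ∀ x ∈ X, ∀ ε > 0, ∀ μ > 0, ∀ u ∈ Q.dom ε x ∩ δ.dom μ x,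
    (δ.map μ x u ∈ Q.dom ε x ↔ Q.map ε x u ∈ δ.dom μ x)
  comm : ∀ x ∈ X, ∀ ε > 0, ∀ μ > 0, ∀ u ∈ Q.dom ε x ∩ δ.dom μ x,
    δ.map μ x u ∈ Q.dom ε x → Q.map ε x (δ.map μ x u) = δ.map μ x (Q.map ε x u)
  /-- (II): the limit, uniform on compact sets of pairs `(x, u)` with `u ∈ U(x)` -/
  limit_mem : ∀ x ∈ X, ∀ u ∈ δ.U x, Q₀ x u ∈ X
  limit : ∀ C : Set (M × M), IsCompact C → (∀ p ∈ C, p.1 ∈ X ∧ p.2 ∈ δ.U p.1) →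
    ∀ η > 0, ∃ ε₀ > 0, ∀ ε, 0 < ε → ε < ε₀ → ∀ p ∈ C,
      dist (Q.map ε p.1 p.2) (Q₀ p.1 p.2) < η
  /-- (III) -/
  semigroup_dom : ∀ x ∈ X, ∀ ε > 0, ∀ μ > 0, ∀ u ∈ Q.dom μ x,
    (Q.map μ x u ∈ Q.dom ε x ↔ u ∈ Q.dom (ε * μ) x)
  semigroup : ∀ x ∈ X, ∀ ε > 0, ∀ μ > 0, ∀ u ∈ Q.dom μ x, Q.map μ x u ∈ Q.dom ε x →
    Q.map ε x (Q.map μ x u) = Q.map (ε * μ) x u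
  one : ∀ x ∈ X, ∀ u ∈ δ.U x, Q.map 1 x u = u
  base : ∀ x ∈ X, ∀ ε > 0, x ∈ Q.dom ε x ∧ Q.map ε x x = x
  /-- (IV): `Θ_ε^x(u,v)` is defined for `ε` small and `u, v` close to `x`, and converges -/
  theta_defined : ∀ K ⊆ X, IsCompact K → ∃ R > 0, ∃ ε₀ > 0, ε₀ ≤ 1 ∧
    ∀ x ∈ K, Metric.closedBall x R ⊆ δ.U x ∧ ∀ ε, 0 < ε → ε < ε₀ →
      ∀ u ∈ Metric.closedBall x R, ∀ v ∈ Metric.closedBall x R,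
        δ.map ε x (Q.map ε x v) ∈ Q.dom ε⁻¹ (δ.map ε x (Q.map ε x u)) ∧
        Q.map ε⁻¹ (δ.map ε x (Q.map ε x u)) (δ.map ε x (Q.map ε x v)) ∈ δ.dom ε⁻¹ x
  theta_limit : ∃ Θ : M → M → M → M, UniformLimitNear X (approxTheta δ Q) Θ

/-- Condition (A). -/
def ConditionA {M : Type*} [MetricSpace M] (X : Set M) (δ Q : MapField M) : Prop :=
  ∀ K ⊆ X, IsCompact K → ∃ L > 0, ∃ R > 0, ∀ x ∈ K, Metric.closedBall x R ⊆ δ.U x ∧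
    ∀ ε, 0 < ε → ε ≤ 1 → ∀ u ∈ Metric.closedBall x R, ∀ v ∈ Metric.closedBall x R,
      1 / ε * dist ((induced δ Q).map ε x u) ((induced δ Q).map ε x v) ≤ L * dist u v

/-- `v` is the derivative at `t ∈ [a,b]` of the curve `c : [a,b] → X` with respect to `δ`
(one-sided at the end points): `v` is in `D(T_{c(t)})`, `ε⁻¹ d(c(t+ε), δ_ε^{c(t)} v) → 0` and
`ε⁻¹ d(c(t-ε), δ_ε^{c(t)} v') → 0`, where `v'` is the inverse `lim Δ_ε^{c(t)}(v, c(t))` of `v`. -/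
def IsDilationDeriv {M : Type*} [MetricSpace M] (δ : MapField M) (c : ℝ → M) (a b t : ℝ)
    (v : M) : Prop :=
  v ∈ tangentDistribution δ (c t) ∧
  Tendsto (fun ε => dist (c (t + ε)) (δ.map ε (c t) v) / ε)
    (𝓝[{ε | 0 < ε ∧ t + ε ∈ Icc a b}] 0) (𝓝 0) ∧
  ∃ v' ∈ δ.U (c t), Tendsto (fun ε => approxDiff δ ε (c t) v (c t)) (𝓝[>] 0) (𝓝 v') ∧
    Tendsto (fun ε => dist (c (t - ε)) (δ.map ε (c t) v') / ε)
      (𝓝[{ε | 0 < ε ∧ t - ε ∈ Icc a b}] 0) (𝓝 0)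

/-- The curve `c : [a,b] → X` is `Q`-everywhere horizontal. -/
def IsEverywhereHorizontal {M : Type*} [MetricSpace M] (X : Set M) (δ : MapField M)
    (Q₀ : M → M → M) (c : ℝ → M) (a b : ℝ) : Prop :=
  ContinuousOn c (Icc a b) ∧ MapsTo c (Icc a b) X ∧
  ∀ t ∈ Icc a b, ∃ v, IsDilationDeriv δ c a b t v ∧ Q₀ (c t) v = v

open Classical in
/-- The curve `t ∈ [0,1] ↦ δ_t^x u`, equal to `x` at `t = 0`. -/
def dilationCurve {M : Type*} (δ : MapField M) (x u : M) : ℝ → M :=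
  fun t => if t = 0 then x else δ.map t x u

/-- Condition (B). -/
def ConditionB {M : Type*} [MetricSpace M] (X : Set M) (δ Q : MapField M)
    (Q₀ : M → M → M) : Prop :=
  ∀ K ⊆ X, IsCompact K → ∃ R > 0, (∀ x ∈ K, Metric.closedBall x R ⊆ δ.U x) ∧
    (∀ x ∈ K, ∀ u ∈ Metric.closedBall x R, Q₀ x u = u →
      (∀ t ∈ Icc (0 : ℝ) 1,
        dilationCurve δ x u t = dilationCurve (induced δ Q) x u t ∧
        Q₀ x (dilationCurve (induced δ Q) x u t) = dilationCurve δ x u t) ∧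
      IsEverywhereHorizontal X δ Q₀ (dilationCurve δ x u) 0 1) ∧
    ∀ η > 0, ∃ a₀ > 0, ∀ a, 0 < a → a < a₀ → a ≤ 1 →
      ∀ x ∈ K, ∀ u ∈ Metric.closedBall x R, Q₀ x u = u → u ≠ x →
        eVariationOn (dilationCurve δ x u) (Icc 0 a) ≠ ⊤ ∧
        |(eVariationOn (dilationCurve δ x u) (Icc 0 a)).toReal / dist x (δ.map a x u) - 1| < η

/-! ### The maps defined by a frame -/

open Classical in
/-- `exp(∑ aᵢ Xᵢ)(x)`, when it is defined (and `x` otherwise). -/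
def frameExp {n : ℕ} {M : Type*} [TopologicalSpace M]
    [ChartedSpace (EuclideanSpace ℝ (Fin n)) M]
    (U : Set M) (X : Fin n → VField n M) (x : M) (a : Fin n → ℝ) : M :=
  if h : ∃ y, IsExp U (combination X a) x y then h.choose else x

/-- `ρ` is an admissible choice of radii on `U`: for every `x ∈ U` the map
`a ↦ exp(∑ aᵢ Xᵢ)(x)` is defined and injective on the ball of radius `ρ x`. -/
def IsAdmissibleRadius {n : ℕ} {M : Type*} [TopologicalSpace M]
    [ChartedSpace (EuclideanSpace ℝ (Fin n)) M]
    (U : Set M) (X : Fin n → VField n M) (ρ : M → ℝ) : Prop :=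
  ContinuousOn ρ U ∧ ∀ x ∈ U, 0 < ρ x ∧
    (∀ a ∈ Metric.ball (0 : Fin n → ℝ) (ρ x), ∃ y, IsExp U (combination X a) x y) ∧
    InjOn (frameExp U X x) (Metric.ball 0 (ρ x))

/-- The coordinates of the first kind, with values in the ball of radius `ρ x`: the inverse of
`a ↦ exp(∑ aᵢ Xᵢ)(x)`. -/
def frameLog {n : ℕ} {M : Type*} [TopologicalSpace M]
    [ChartedSpace (EuclideanSpace ℝ (Fin n)) M]
    (U : Set M) (X : Fin n → VField n M) (ρ : M → ℝ) (x : M) : M → (Fin n → ℝ) :=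
  Function.invFunOn (frameExp U X x) (Metric.ball 0 (ρ x))

/-- The maps `exp(∑ aᵢ Xᵢ)(x) ↦ exp(∑ ε^{wᵢ} aᵢ Xᵢ)(x)`, where both coordinate vectors range over
the ball of radius `ρ x`. -/
def frameMaps {n : ℕ} {M : Type*} [TopologicalSpace M]
    [ChartedSpace (EuclideanSpace ℝ (Fin n)) M]
    (U : Set M) (X : Fin n → VField n M) (ρ : M → ℝ) (w : Fin n → ℕ) : MapField M where
  dom ε x := frameExp U X x ''
    {a | a ∈ Metric.ball 0 (ρ x) ∧ scale w ε a ∈ Metric.ball 0 (ρ x)}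
  map ε x u := frameExp U X x (scale w ε (frameLog U X ρ x u))

/-- The dilations `exp(∑ aᵢ Xᵢ)(x) ↦ exp(∑ aᵢ ε^{deg Xᵢ} Xᵢ)(x)`. -/
def srDilation {n : ℕ} {M : Type*} [TopologicalSpace M]
    [ChartedSpace (EuclideanSpace ℝ (Fin n)) M]
    (U : Set M) (X : Fin n → VField n M) (ρ : M → ℝ) (deg : Fin n → ℕ) : MapField M :=
  frameMaps U X ρ deg

/-- The dilations `exp(∑ aᵢ Xᵢ)(x) ↦ exp(∑ aᵢ ε Xᵢ)(x)`. -/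
def riemDilation {n : ℕ} {M : Type*} [TopologicalSpace M]
    [ChartedSpace (EuclideanSpace ℝ (Fin n)) M]
    (U : Set M) (X : Fin n → VField n M) (ρ : M → ℝ) : MapField M :=
  frameMaps U X ρ (fun _ => 1)

/-- The maps `Q_ε^x : exp(∑ aᵢ Xᵢ)(x) ↦ exp(∑ aᵢ ε^{deg Xᵢ - 1} Xᵢ)(x)` (where `deg Xᵢ ≥ 1`). -/
def frameProjection {n : ℕ} {M : Type*} [TopologicalSpace M]
    [ChartedSpace (EuclideanSpace ℝ (Fin n)) M]
    (U : Set M) (X : Fin n → VField n M) (ρ : M → ℝ) (deg : Fin n → ℕ) : MapField M :=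
  frameMaps U X ρ (fun i => deg i - 1)

end SubRiem

end

/-! In the coordinates of the first kind `frameLog`, each of the families `δ̄`, `Q` and `δ`
multiplies the coordinates by powers of `ε`, with weights `1`, `deg - 1` and `deg`. Such scalings
compose and commute, so the algebraic axioms and the identity `δ = δ̄ Q` are immediate. What needs
proof is the existence of the limits, uniformly in the base point.

For `δ̄` the limits are first order calculus. In a chart which turns the frame at `p` into the
standard basis, the map `(x, a) ↦ exp(∑ aᵢ Xᵢ)(x)` is strictly differentiable at `(p, 0)` with
derivative `(x, a) ↦ x + a` (`frameSolution_strict_estimate`), and the distance is, to first order,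
the norm `‖∑ vᵢ Xᵢ(p)‖` (`exists_isFrameChart`). The strict estimate yields radii on which the
exponential map is injective, and on which it and its inverse are jointly continuous in the base
point (`IsFrameChart.exists_isGoodRadiusAt`, `IsGoodRadius.tendsto_frameLog`). If displacements `A`,
`B` satisfy `A / ε → a` and `B / ε → b`, then after division by `ε` the logarithm from `exp A` to
`exp B` tends to `b - a`, composition of displacements becomes addition, and the distance tends to
the norm of `a - b`. Hence (A3) and (A4) hold, and the tangent spaces of `δ̄` are additive groups of
vectors.

The noncommutative information enters only through property (b) of normal frames: the coordinates of
`exp(δ_ε a)(x)` seen from `exp(δ_ε b)(x)`, rescaled by `ε⁻¹` with weights `deg`, converge to some `P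
x a b` (`IsGoodRadius.exists_tendsto_scaledLog`). The functions in (b) are not required to take
values in the ball of injectivity, so they are first identified with the logarithm, by a continuity
argument in `ε`. Then `Σ^x` is given by `P x b (-a)`, because `x` is `exp(-a)` seen from
`exp(a)(x)`. The limit of `Θ` is the exponential of the degree one part of `a` plus `P x b a`, as a
sum of two displacements of order `ε`.

The limit projection keeps exactly the coordinates of degree one, and there `δ` and `δ̄` coincide.
So if `u = Q^x u`, the curve in (B) is a piece of a one-parameter group: its difference quotients
vanish identically, and its length is compared with a chord by the first order formula for the
distance. The same group property puts `Q^x u` in the distribution of the tangent space of `δ`.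
Condition (A) holds because `ε ^ deg ≤ ε`.

Uniformity is obtained in one way throughout: convergence is proved along `𝓝[>] 0 ×ˢ 𝓝 q` for each
`q`, and compactness makes it uniform (`IsCompact.eventually_dist_lt_of_tendsto_prod`). -/

namespace SubRiem

/-! ### Differential equations with small coefficients in a normed space -/

section ODE

variable {F : Type*} [NormedAddCommGroup F] [NormedSpace ℝ F] {n : ℕ}

/-- `c` solves `c' = ∑ aᵢ Yᵢ(c)` on `[0,1]` and stays in `O`. -/
structure IsFrameSolution (Y : Fin n → F → F) (O : Set F) (a : Fin n → ℝ) (c : ℝ → F) : Prop where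
  mem : ∀ t ∈ Icc (0 : ℝ) 1, c t ∈ O
  deriv : ∀ t ∈ Icc (0 : ℝ) 1, HasDerivWithinAt c (∑ i, a i • Y i (c t)) (Icc 0 1) t

theorem norm_sum_smul_le (a : Fin n → ℝ) (v : Fin n → F) {C : ℝ} (hv : ∀ i, ‖v i‖ ≤ C) :
    ‖∑ i, a i • v i‖ ≤ n * (‖a‖ * C) := by
  refine (norm_sum_le _ _).trans ?_
  calc ∑ i, ‖a i • v i‖ ≤ ∑ _i : Fin n, ‖a‖ * C := by
        refine Finset.sum_le_sum fun i _ => ?_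
        rw [norm_smul]
        exact mul_le_mul (norm_le_pi_norm a i) (hv i) (norm_nonneg _) (norm_nonneg _)
    _ = n * (‖a‖ * C) := by simp

/-- Common Lipschitz constant, bound and modulus for finitely many `C¹` fields. -/
theorem exists_lipschitz_bound {Y : Fin n → F → F} {ξ₀ : F}
    (hY : ∀ i, ContDiffAt ℝ 1 (Y i) ξ₀) :
    ∃ (Λ : ℝ≥0) (C : ℝ), 0 ≤ C ∧ (∀ i, ‖Y i ξ₀‖ ≤ C) ∧ ∃ O ∈ 𝓝 ξ₀, ∀ i, LipschitzOnWith Λ (Y i) O := by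
  choose K t ht hK using fun i => (hY i).exists_lipschitzOnWith
  refine ⟨∑ i, K i, ∑ i, ‖Y i ξ₀‖, by positivity, fun i => ?_, ⋂ i, t i, ?_, fun i => ?_⟩
  · exact Finset.single_le_sum (f := fun i => ‖Y i ξ₀‖) (fun _ _ => norm_nonneg _) (Finset.mem_univ i)
  · exact Filter.iInter_mem.2 ht
  · refine ((hK i).weaken ?_).mono (iInter_subset _ i)
    exact Finset.single_le_sum (f := K) (fun _ _ => zero_le) (Finset.mem_univ i)

/-- Small coefficients replace short times: the speed is at most `R / 2`, so a solution starting in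
the ball of radius `R / 2` survives until time one inside the ball of radius `R`. -/
theorem exists_frameSolution [CompleteSpace F] {Y : Fin n → F → F} {ξ₀ : F}
    (hY : ∀ i, ContDiffAt ℝ 1 (Y i) ξ₀) {O : Set F} (hO : O ∈ 𝓝 ξ₀) :
    ∀ᶠ q : F × (Fin n → ℝ) in 𝓝 (ξ₀, 0), ∃ c : ℝ → F, c 0 = q.1 ∧ IsFrameSolution Y O q.2 c := by
  obtain ⟨Λ, C, hC, hYC, O', hO', hΛ⟩ := exists_lipschitz_bound hY
  obtain ⟨R, hR, hRO⟩ := Metric.nhds_basis_closedBall.mem_iff.1 (inter_mem hO hO')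
  have hRO1 : Metric.closedBall ξ₀ R ⊆ O := fun x hx => (hRO hx).1
  have hRO2 : Metric.closedBall ξ₀ R ⊆ O' := fun x hx => (hRO hx).2
  have hbd : ∀ i, ∀ ξ ∈ Metric.closedBall ξ₀ R, ‖Y i ξ‖ ≤ C + Λ * R := by
    intro i ξ hξ
    have h1 := (hΛ i).norm_sub_le (hRO2 hξ) (hRO2 (Metric.mem_closedBall_self hR.le))
    have h2 : ‖ξ - ξ₀‖ ≤ R := by simpa [dist_eq_norm] using hξ
    have h3 := norm_le_norm_add_norm_sub (Y i ξ₀) (Y i ξ)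
    have h4 : (Λ : ℝ) * ‖ξ - ξ₀‖ ≤ Λ * R := by gcongr
    rw [norm_sub_rev] at h3
    linarith [hYC i]
  -- The summand `1` keeps `B` positive also for `n = 0`.
  set B : ℝ := n * (C + Λ * R) + 1 with hB
  have hB0 : 0 < B := by positivity
  have h1 : ∀ᶠ q : F × (Fin n → ℝ) in 𝓝 (ξ₀, 0), q.1 ∈ Metric.closedBall ξ₀ (R / 2) :=
    continuousAt_fst.eventually (Metric.closedBall_mem_nhds _ (by positivity))
  have h2 : ∀ᶠ q : F × (Fin n → ℝ) in 𝓝 (ξ₀, 0), q.2 ∈ Metric.closedBall 0 (R / (2 * B)) :=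
    continuousAt_snd.eventually (Metric.closedBall_mem_nhds _ (by positivity))
  filter_upwards [h1, h2] with q hq1 hq2
  have hq2' : ‖q.2‖ ≤ R / (2 * B) := by simpa using hq2
  have hspeed : ∀ ξ ∈ Metric.closedBall ξ₀ R, ‖∑ i, q.2 i • Y i ξ‖ ≤ R / 2 := by
    intro ξ hξ
    refine (norm_sum_smul_le q.2 _ fun i => hbd i ξ hξ).trans ?_
    calc (n : ℝ) * (‖q.2‖ * (C + Λ * R)) = ‖q.2‖ * (n * (C + Λ * R)) := by ring
      _ ≤ R / (2 * B) * B := by gcongr; linarith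
      _ = R / 2 := by field_simp
  lift R to ℝ≥0 using hR.le
  have hpl : IsPicardLindelof (fun (_ : ℝ) ξ => ∑ i, q.2 i • Y i ξ)
      (⟨0, by simp⟩ : Icc (0 : ℝ) 1) ξ₀ R (R / 2) (R / 2) (∑ i, ‖q.2 i‖₊ * Λ) := by
    refine ⟨fun t _ => ?_, fun x _ => continuousOn_const, fun t _ x hx => by simpa using hspeed x hx, ?_⟩
    · refine LipschitzOnWith.of_dist_le_mul fun x hx y hy => ?_
      rw [dist_eq_norm, ← Finset.sum_sub_distrib]
      refine (norm_sum_le _ _).trans ?_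
      push_cast
      rw [Finset.sum_mul]
      refine Finset.sum_le_sum fun i _ => ?_
      rw [← smul_sub, norm_smul, mul_assoc]
      refine mul_le_mul_of_nonneg_left ?_ (norm_nonneg _)
      rw [dist_eq_norm]
      exact (hΛ i).norm_sub_le (hRO2 hx) (hRO2 hy)
    · push_cast
      simp only [sub_zero, sub_self, max_eq_left zero_le_one, mul_one]
      linarith
  -- The fixed point of the Picard operator is used directly, because its membership in the function
  -- space also shows that the solution stays in the ball, hence in `O`.
  obtain ⟨α, hα⟩ := ODE.FunSpace.exists_isFixedPt_next hpl (x := q.1) (by simpa using hq1)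
  have hball : ∀ t, α.compProj t ∈ Metric.closedBall ξ₀ R :=
    fun t => α.compProj_mem_closedBall hpl.mul_max_le
  refine ⟨α.compProj, ?_, fun t _ => hRO1 (hball t), fun t ht => ?_⟩
  · have h0 : α.compProj ((⟨0, by simp⟩ : Icc (0 : ℝ) 1) : ℝ) = q.1 := by
      rw [ODE.FunSpace.compProj_val, ← hα, ODE.FunSpace.next_apply₀]
    exact h0
  · apply (ODE.hasDerivWithinAt_picard_Icc (t₀ := 0) (left_mem_Icc.2 zero_le_one) hpl.continuousOn_uncurry
      α.continuous_compProj.continuousOn (fun _ _ => hball _) q.1 ht).congr_of_mem _ ht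
    intro t' ht'
    nth_rw 1 [← hα]
    rw [ODE.FunSpace.compProj_of_mem ht', ODE.FunSpace.next_apply]

/-- The time-one map of `c' = ∑ aᵢ Yᵢ(c)` is strictly differentiable at `(ξ₀, 0)` as a function of
the initial value and of the coefficients. -/
theorem frameSolution_strict_estimate {Y : Fin n → F → F} {ξ₀ : F}
    (hY : ∀ i, ContDiffAt ℝ 1 (Y i) ξ₀) {η : ℝ} (hη : 0 < η) :
    ∃ O ∈ 𝓝 ξ₀, ∃ r > 0, ∀ (a a' : Fin n → ℝ) (c c' : ℝ → F), ‖a'‖ < r →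
      IsFrameSolution Y O a c → IsFrameSolution Y O a' c' →
      ‖c 1 - c' 1 - (c 0 - c' 0) - ∑ i, (a i - a' i) • Y i ξ₀‖ ≤
        η * (‖c 0 - c' 0‖ + ‖a - a'‖) := by
  obtain ⟨Λ, C, hC, hYC, O, hO, hΛ⟩ := exists_lipschitz_bound hY
  obtain ⟨δ, hδ, hδη⟩ : ∃ δ > 0, n * (Λ * δ) ≤ min (η / 2) 1 := by
    refine ⟨min (η / 2) 1 / (n * Λ + 1), by positivity, ?_⟩
    have h0 : 0 ≤ min (η / 2) 1 := by positivity
    rw [← mul_assoc, mul_div_assoc', div_le_iff₀ (by positivity)]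
    nlinarith
  set D : ℝ := n * C + 2 with hD
  have hD0 : 0 < D := by positivity
  -- The factor `2 * D` anticipates the bound `hS'` of the supremum `S`. The bound by `η / 2` serves
  -- the final estimate, the bound by `1` the absorption of `S`.
  obtain ⟨r, hr, hrη⟩ : ∃ r > 0, n * (r * Λ) * (2 * D) ≤ min (η / 2) 1 := by
    refine ⟨min (η / 2) 1 / (n * Λ * (2 * D) + 1), by positivity, ?_⟩
    have h0 : 0 ≤ min (η / 2) 1 := by positivity
    rw [show ∀ x : ℝ, n * (x * Λ) * (2 * D) = (n * Λ * (2 * D)) * x by intro x; ring,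
      mul_div_assoc', div_le_iff₀ (by positivity)]
    nlinarith
  have hr1 : n * (r * Λ) ≤ 1 / 2 := by
    have h1 : n * (r * Λ) * (2 * D) ≤ 1 := hrη.trans (min_le_right _ _)
    have h2 : (0 : ℝ) ≤ n * (r * Λ) := by positivity
    have h3 : (2 : ℝ) ≤ D := by rw [hD]; linarith [mul_nonneg (Nat.cast_nonneg (α := ℝ) n) hC]
    nlinarith
  refine ⟨O ∩ Metric.ball ξ₀ δ, inter_mem hO (Metric.ball_mem_nhds _ hδ), r, hr, ?_⟩
  intro a a' c c' ha' hc hc'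
  set v : F := ∑ i, (a i - a' i) • Y i ξ₀ with hv
  have hcont : ContinuousOn (fun t => ‖c t - c' t‖) (Icc 0 1) := fun t ht =>
    ((hc.deriv t ht).continuousWithinAt.sub (hc'.deriv t ht).continuousWithinAt).norm
  obtain ⟨τ, hτ, hmax⟩ := isCompact_Icc.exists_isMaxOn (nonempty_Icc.2 zero_le_one) hcont
  set S := ‖c τ - c' τ‖ with hS
  have hmax' : ∀ t ∈ Icc (0 : ℝ) 1, ‖c t - c' t‖ ≤ S := fun t ht => hmax ht
  -- Once the expected drift `t • v` is removed, the derivative is small for two reasons: the fields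
  -- differ by at most `Λ * δ` from their values at `ξ₀`, and the coefficients `a'` are smaller than
  -- `r`.
  set w : ℝ → F := fun t => c t - c' t - t • v with hw
  have hd : ∀ t ∈ Icc (0 : ℝ) 1, HasDerivWithinAt w
      (∑ i, (a i - a' i) • (Y i (c t) - Y i ξ₀) + ∑ i, a' i • (Y i (c t) - Y i (c' t)))
      (Icc 0 1) t := by
    intro t ht
    have h1 := ((hc.deriv t ht).sub (hc'.deriv t ht)).sub
      ((hasDerivWithinAt_id t (Icc (0 : ℝ) 1)).smul_const v)
    refine h1.congr_deriv ?_
    rw [hv, one_smul, ← Finset.sum_sub_distrib, ← Finset.sum_sub_distrib, ← Finset.sum_add_distrib]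
    refine Finset.sum_congr rfl fun i _ => ?_
    module
  have hbound : ∀ t ∈ Icc (0 : ℝ) 1,
      ‖∑ i, (a i - a' i) • (Y i (c t) - Y i ξ₀) + ∑ i, a' i • (Y i (c t) - Y i (c' t))‖ ≤
        n * (Λ * δ) * ‖a - a'‖ + n * (r * Λ) * S := by
    intro t ht
    refine (norm_add_le _ _).trans (add_le_add ?_ ?_)
    · refine (norm_sum_smul_le (a - a') _ (C := Λ * δ) fun i => ?_).trans (le_of_eq (by ring))
      refine ((hΛ i).norm_sub_le (hc.mem t ht).1 (mem_of_mem_nhds hO)).trans ?_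
      gcongr
      exact (mem_ball_iff_norm.1 (hc.mem t ht).2).le
    · refine (norm_sum_smul_le a' _ (C := Λ * S) fun i => ?_).trans ?_
      · refine ((hΛ i).norm_sub_le (hc.mem t ht).1 (hc'.mem t ht).1).trans ?_
        gcongr
        exact hmax' t ht
      · have hS0 : 0 ≤ S := norm_nonneg _
        calc (n : ℝ) * (‖a'‖ * (Λ * S)) ≤ n * (r * (Λ * S)) := by gcongr
          _ = n * (r * Λ) * S := by ring
  set G := n * (Λ * δ) * ‖a - a'‖ + n * (r * Λ) * S with hG
  have hG0 : 0 ≤ G := by positivity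
  have hw0 : w 0 = c 0 - c' 0 := by simp [hw]
  have hmv : ∀ t ∈ Icc (0 : ℝ) 1, ‖w t - w 0‖ ≤ G := by
    intro t ht
    refine (Convex.norm_image_sub_le_of_norm_hasDerivWithin_le hd hbound (convex_Icc 0 1)
      (by simp) ht).trans ?_
    rw [sub_zero, Real.norm_of_nonneg ht.1]
    nlinarith [ht.2]
  have hv' : ‖v‖ ≤ n * C * ‖a - a'‖ :=
    (norm_sum_smul_le (a - a') _ hYC).trans (le_of_eq (by ring))
  have hna : 0 ≤ ‖a - a'‖ := norm_nonneg _
  have hn0 : 0 ≤ ‖c 0 - c' 0‖ := norm_nonneg _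
  -- `S` occurs on both sides, but on the right with a factor at most `1 / 2`, so it can be
  -- absorbed.
  have hS' : S ≤ 2 * D * (‖c 0 - c' 0‖ + ‖a - a'‖) := by
    have h1 : c τ - c' τ = (w τ - w 0) + (c 0 - c' 0) + τ • v := by rw [hw0]; simp [hw]
    have h2 : S ≤ G + ‖c 0 - c' 0‖ + ‖v‖ := by
      rw [hS, h1]
      refine (norm_add₃_le).trans (add_le_add (add_le_add (hmv τ hτ) le_rfl) ?_)
      rw [norm_smul, Real.norm_of_nonneg hτ.1]
      nlinarith [hτ.2, norm_nonneg v]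
    have hS0 : 0 ≤ S := norm_nonneg _
    have h3 : n * (r * Λ) * S ≤ 1 / 2 * S := by gcongr
    have h4 : n * (Λ * δ) * ‖a - a'‖ ≤ 1 * ‖a - a'‖ := by
      gcongr; exact hδη.trans (min_le_right _ _)
    have h5 : 0 ≤ n * C * ‖c 0 - c' 0‖ := by positivity
    rw [hD]
    nlinarith
  have hfin : c 1 - c' 1 - (c 0 - c' 0) - v = w 1 - w 0 := by
    rw [hw0]; simp only [hw, one_smul]; abel
  rw [hfin]
  refine (hmv 1 (by simp)).trans ?_
  have h6 : n * (Λ * δ) * ‖a - a'‖ ≤ η / 2 * ‖a - a'‖ := by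
    gcongr; exact hδη.trans (min_le_left _ _)
  have h7 : n * (r * Λ) * S ≤ η / 2 * (‖c 0 - c' 0‖ + ‖a - a'‖) := by
    calc n * (r * Λ) * S ≤ n * (r * Λ) * (2 * D * (‖c 0 - c' 0‖ + ‖a - a'‖)) := by gcongr
      _ = n * (r * Λ) * (2 * D) * (‖c 0 - c' 0‖ + ‖a - a'‖) := by ring
      _ ≤ _ := by gcongr; exact hrη.trans (min_le_left _ _)
  nlinarith

end ODE

/-! ### Vector fields and integral curves read in a chart -/

section Chart

variable {n : ℕ} {M : Type*} [TopologicalSpace M]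
    [ChartedSpace (EuclideanSpace ℝ (Fin n)) M]

/-- The vector field `V` read in the chart at `p`. -/
noncomputable def chartField (V : VField n M) (p : M) (ξ : EuclideanSpace ℝ (Fin n)) :
    EuclideanSpace ℝ (Fin n) :=
  mfderiv (𝓡 n) 𝓘(ℝ, EuclideanSpace ℝ (Fin n)) (extChartAt (𝓡 n) p) ((extChartAt (𝓡 n) p).symm ξ)
    (V ((extChartAt (𝓡 n) p).symm ξ))

theorem chartField_extChartAt (V : VField n M) {p y : M} (hy : y ∈ (extChartAt (𝓡 n) p).source) :
    chartField V p (extChartAt (𝓡 n) p y) =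
      mfderiv (𝓡 n) 𝓘(ℝ, EuclideanSpace ℝ (Fin n)) (extChartAt (𝓡 n) p) y (V y) := by
  unfold chartField
  rw [(extChartAt (𝓡 n) p).left_inv hy]

theorem chartField_combination (X : Fin n → VField n M) (a : Fin n → ℝ) (p : M)
    (ξ : EuclideanSpace ℝ (Fin n)) :
    chartField (combination X a) p ξ = ∑ i, a i • chartField (X i) p ξ := by
  unfold chartField combination
  rw [map_sum]
  exact Finset.sum_congr rfl fun i _ => map_smul _ _ _

variable [IsManifold (𝓡 n) ∞ M]

/-- Smoothness of a section is smoothness of its fibre coordinate in the trivialization at `p`, and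
on the chart domain this coordinate is the derivative of the chart applied to the field. -/
theorem contDiffAt_chartField {V : VField n M} {U : Set M} (hU : IsOpen U) (hV : SmoothOn V U)
    {p : M} (hp : p ∈ U) : ContDiffAt ℝ 1 (chartField V p) (extChartAt (𝓡 n) p p) := by
  have : IsManifold (𝓡 n) 1 M := IsManifold.of_le (n := ∞) (by simp)
  have h1 : ContMDiffAt (𝓡 n) (𝓡 n).tangent ∞ (fun y => (⟨y, V y⟩ : TangentBundle (𝓡 n) M)) p :=
    (hV p hp).contMDiffAt (hU.mem_nhds hp)
  rw [contMDiffAt_section] at h1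
  have h2 : ContMDiffAt 𝓘(ℝ, EuclideanSpace ℝ (Fin n)) (𝓡 n) ∞ (extChartAt (𝓡 n) p).symm
      (extChartAt (𝓡 n) p p) :=
    (contMDiffOn_extChartAt_symm p).contMDiffAt (extChartAt_target_mem_nhds p)
  have h3 := ContMDiffAt.comp_of_eq (h1) h2 (by simp)
  rw [contMDiffAt_iff_contDiffAt] at h3
  refine (h3.of_le (by simp)).congr_of_eventuallyEq ?_
  filter_upwards [extChartAt_target_mem_nhds (I := 𝓡 n) p] with ξ hξ
  have hs : (extChartAt (𝓡 n) p).symm ξ ∈ (chartAt (EuclideanSpace ℝ (Fin n)) p).source := by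
    rw [← extChartAt_source (𝓡 n)]
    exact (extChartAt (𝓡 n) p).map_target hξ
  have e1 := congr($(TangentBundle.continuousLinearMapAt_trivializationAt (I := 𝓡 n) hs)
    (V ((extChartAt (𝓡 n) p).symm ξ)))
  refine e1.symm.trans ?_
  refine congrFun (Trivialization.coe_linearMapAt_of_mem (R := ℝ)
    (trivializationAt (EuclideanSpace ℝ (Fin n)) (TangentSpace (𝓡 n)) p) ?_) _
  simpa using hs

/-- An integral curve, read in a chart, solves the corresponding differential equation. -/
theorem hasDerivWithinAt_extChartAt_comp {V : VField n M} {γ : ℝ → M} {s : Set ℝ}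
    (hγ : IsMIntegralCurveOn (I := 𝓡 n) γ V s) {p : M} {t : ℝ} (ht : t ∈ s)
    (hs : γ t ∈ (extChartAt (𝓡 n) p).source) :
    HasDerivWithinAt (extChartAt (𝓡 n) p ∘ γ) (chartField V p (extChartAt (𝓡 n) p (γ t))) s t := by
  have : IsManifold (𝓡 n) 1 M := IsManifold.of_le (n := ∞) (by simp)
  have h1 : HasMFDerivAt (𝓡 n) 𝓘(ℝ, EuclideanSpace ℝ (Fin n)) (extChartAt (𝓡 n) p) (γ t) _ :=
    (mdifferentiableAt_extChartAt (by rwa [extChartAt_source] at hs)).hasMFDerivAt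
  have h2 := h1.comp_hasMFDerivWithinAt t (hγ t ht)
  rw [hasMFDerivWithinAt_iff_hasFDerivWithinAt] at h2
  rw [chartField_extChartAt V hs]
  refine HasDerivWithinAt.congr_deriv (HasFDerivWithinAt.hasDerivWithinAt h2) ?_
  exact congrArg (mfderiv (𝓡 n) 𝓘(ℝ, EuclideanSpace ℝ (Fin n)) (extChartAt (𝓡 n) p) (γ t))
    (one_smul ℝ (V (γ t)))

/-- A solution of the differential equation in a chart is an integral curve. -/
theorem isMIntegralCurveOn_extChartAt_symm_comp {V : VField n M} {p : M} {s : Set ℝ}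
    {c : ℝ → EuclideanSpace ℝ (Fin n)} (hc : ∀ t ∈ s, c t ∈ (extChartAt (𝓡 n) p).target)
    (hd : ∀ t ∈ s, HasDerivWithinAt c (chartField V p (c t)) s t) :
    IsMIntegralCurveOn (I := 𝓡 n) ((extChartAt (𝓡 n) p).symm ∘ c) V s := by
  have : IsManifold (𝓡 n) 1 M := IsManifold.of_le (n := ∞) (by simp)
  intro t ht
  have h1 : HasMFDerivWithinAt 𝓘(ℝ, ℝ) 𝓘(ℝ, EuclideanSpace ℝ (Fin n)) c s t _ :=
    (hd t ht).hasFDerivWithinAt.hasMFDerivWithinAt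
  have h2 := (mdifferentiableWithinAt_extChartAt_symm (hc t ht)).hasMFDerivWithinAt
  have h3 := h2.comp t h1 (fun _ _ => by simp)
  refine h3.congr_mfderiv ?_
  have h4 := mfderivWithin_extChartAt_symm_comp_mfderiv_extChartAt (I := 𝓡 n) (hc t ht)
  have h5 := congr($h4 (V ((extChartAt (𝓡 n) p).symm (c t))))
  refine ContinuousLinearMap.ext_ring ?_
  refine (congrArg (mfderivWithin 𝓘(ℝ, EuclideanSpace ℝ (Fin n)) (𝓡 n) (extChartAt (𝓡 n) p).symm
    (range (𝓡 n)) (c t)) (one_smul ℝ (chartField V p (c t)))).trans ?_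
  exact h5.trans (one_smul ℝ (V ((extChartAt (𝓡 n) p).symm (c t)))).symm

end Chart

/-! ### Uniqueness and the one-parameter group property of the exponential map -/

section Exp

variable {n : ℕ} {M : Type*} [TopologicalSpace M]
    [ChartedSpace (EuclideanSpace ℝ (Fin n)) M]

theorem combination_smul (X : Fin n → VField n M) (s : ℝ) (a : Fin n → ℝ) :
    combination X (s • a) = s • combination X a := by
  funext x
  refine Eq.trans ?_ (Finset.smul_sum (r := s) (f := fun i => a i • X i x) (s := Finset.univ)).symm
  exact Finset.sum_congr rfl fun i _ => mul_smul s (a i) (X i x)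

theorem combination_zero (X : Fin n → VField n M) : combination X 0 = 0 := by
  have h := combination_smul X 0 0
  rwa [zero_smul, zero_smul] at h

/-- Pieces of integral curves are integral curves, up to an affine change of time. -/
theorem isMIntegralCurveOn_affine_reparam {X : Fin n → VField n M} {a : Fin n → ℝ} {γ : ℝ → M}
    (hγ : IsMIntegralCurveOn (I := 𝓡 n) γ (combination X a) (Icc 0 1)) {s t : ℝ}
    (hs : s ∈ Icc (0 : ℝ) 1) (ht : t ∈ Icc (0 : ℝ) 1) :
    IsMIntegralCurveOn (I := 𝓡 n) (fun τ => γ (τ * (t - s) + s)) (combination X ((t - s) • a))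
      (Icc 0 1) := by
  rw [combination_smul]
  refine ((hγ.comp_add s).comp_mul (t - s)).mono fun τ hτ => ?_
  simp only [mem_ofPred_eq, mem_Icc] at *
  constructor <;> nlinarith

theorem affine_mem_Icc {s t τ : ℝ} (hs : s ∈ Icc (0 : ℝ) 1) (ht : t ∈ Icc (0 : ℝ) 1)
    (hτ : τ ∈ Icc (0 : ℝ) 1) : τ * (t - s) + s ∈ Icc (0 : ℝ) 1 := by
  simp only [mem_Icc] at *
  constructor <;> nlinarith

theorem IsExp.mem_right {U : Set M} {V : VField n M} {x y : M} (h : IsExp U V x y) : y ∈ U := by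
  obtain ⟨γ, -, h1, hU, -⟩ := h
  exact h1 ▸ hU 1 (by simp)

theorem IsExp.exists_path {U : Set M} {X : Fin n → VField n M} {a : Fin n → ℝ} {x y : M}
    (h : IsExp U (combination X a) x y) :
    ∃ γ : ℝ → M, γ 0 = x ∧ γ 1 = y ∧ ∀ s ∈ Icc (0 : ℝ) 1, ∀ t ∈ Icc (0 : ℝ) 1,
      IsExp U (combination X ((t - s) • a)) (γ s) (γ t) := by
  obtain ⟨γ, h0, h1, hU, hγ⟩ := h
  exact ⟨γ, h0, h1, fun s hs t ht => ⟨fun τ => γ (τ * (t - s) + s), by simp, by simp,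
    fun τ hτ => hU _ (affine_mem_Icc hs ht hτ), isMIntegralCurveOn_affine_reparam hγ hs ht⟩⟩

theorem isExp_zero {U : Set M} (X : Fin n → VField n M) {x : M} (hx : x ∈ U) :
    IsExp U (combination X 0) x x := by
  refine ⟨fun _ => x, rfl, rfl, fun _ _ => hx, ?_⟩
  exact (isMIntegralCurve_const (by rw [combination_zero]; rfl)).isMIntegralCurveOn _

theorem frameExp_mem {U : Set M} {X : Fin n → VField n M} {x : M} (hx : x ∈ U) (a : Fin n → ℝ) : frameExp U X x a ∈ U := by
  unfold frameExp
  split_ifs with h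
  · exact h.choose_spec.mem_right
  · exact hx

variable [IsManifold (𝓡 n) ∞ M] {U : Set M} {X : Fin n → VField n M}

theorem contDiffAt_chartField_combination (hU : IsOpen U) (hX : ∀ i, SmoothOn (X i) U)
    (a : Fin n → ℝ) {p : M} (hp : p ∈ U) :
    ContDiffAt ℝ 1 (chartField (combination X a) p) (extChartAt (𝓡 n) p p) := by
  have h : chartField (combination X a) p = fun ξ => ∑ i, a i • chartField (X i) p ξ :=
    funext fun ξ => chartField_combination X a p ξ
  rw [h]
  exact ContDiffAt.sum fun i _ => (contDiffAt_chartField hU (hX i) hp).const_smul (a i)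

/-- Continuous induction on `[0, 1]`: the set of agreement is closed, and from a point of agreement
it extends to the right, because in the chart there the field is Lipschitz. One-sided derivatives
suffice, so the closed interval needs no enlargement, and only one of the curves has to be known to
stay in `U`. -/
theorem eqOn_of_isMIntegralCurveOn_Icc [T2Space M] (hU : IsOpen U) (hX : ∀ i, SmoothOn (X i) U)
    {a : Fin n → ℝ} {γ γ' : ℝ → M} (hγU : ∀ t ∈ Icc (0 : ℝ) 1, γ t ∈ U)
    (hγ : IsMIntegralCurveOn (I := 𝓡 n) γ (combination X a) (Icc 0 1))
    (hγ' : IsMIntegralCurveOn (I := 𝓡 n) γ' (combination X a) (Icc 0 1)) (h0 : γ 0 = γ' 0) :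
    EqOn γ γ' (Icc 0 1) := by
  have hsub : Icc (0 : ℝ) 1 ⊆ {t | γ t = γ' t} := by
    refine IsClosed.Icc_subset_of_forall_mem_nhdsWithin (a := (0 : ℝ)) (b := 1)
      (s := {t | γ t = γ' t}) ?_ h0 ?_
    swap
    · rintro t ⟨hteq, ht⟩
      have hteq : γ t = γ' t := hteq
      have htI : t ∈ Icc (0 : ℝ) 1 := ⟨ht.1, ht.2.le⟩
      obtain ⟨K, S, hS, hK⟩ :=
        (contDiffAt_chartField_combination hU hX a (hγU t htI)).exists_lipschitzOnWith
      have hN : (extChartAt (𝓡 n) (γ t)) ⁻¹' S ∩ (extChartAt (𝓡 n) (γ t)).source ∈ 𝓝 (γ t) :=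
        inter_mem ((continuousAt_extChartAt (γ t)).preimage_mem_nhds hS)
          (extChartAt_source_mem_nhds (γ t))
      have hge : Icc (0 : ℝ) 1 ∈ 𝓝[≥] t := Icc_mem_nhdsGE_of_mem ht
      have hN' : (extChartAt (𝓡 n) (γ t)) ⁻¹' S ∩ (extChartAt (𝓡 n) (γ t)).source ∈ 𝓝 (γ' t) := by
        rw [← hteq]; exact hN
      have e1 := nhdsWithin_le_of_mem hge ((hγ.continuousOn t htI).preimage_mem_nhdsWithin hN)
      have e2 := nhdsWithin_le_of_mem hge
        ((hγ'.continuousOn t htI).preimage_mem_nhdsWithin hN')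
      obtain ⟨δ, hδ, hsub⟩ := mem_nhdsGE_iff_exists_Icc_subset.1
        (inter_mem (inter_mem e1 e2) hge)
      have hder : ∀ g : ℝ → M, IsMIntegralCurveOn (I := 𝓡 n) g (combination X a) (Icc 0 1) →
          (∀ τ ∈ Icc t δ, g τ ∈ (extChartAt (𝓡 n) (γ t)).source) →
          ContinuousOn (extChartAt (𝓡 n) (γ t) ∘ g) (Icc t δ) ∧
          ∀ τ ∈ Ico t δ, HasDerivWithinAt (extChartAt (𝓡 n) (γ t) ∘ g)
            (chartField (combination X a) (γ t) ((extChartAt (𝓡 n) (γ t) ∘ g) τ)) (Ici τ) τ := by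
        intro g hg hgs
        have h1 : ∀ τ ∈ Icc t δ, HasDerivWithinAt (extChartAt (𝓡 n) (γ t) ∘ g)
            (chartField (combination X a) (γ t) (extChartAt (𝓡 n) (γ t) (g τ))) (Icc 0 1) τ :=
          fun τ hτ => hasDerivWithinAt_extChartAt_comp hg (hsub hτ).2 (hgs τ hτ)
        refine ⟨fun τ hτ => ((h1 τ hτ).continuousWithinAt).mono fun σ hσ => (hsub hσ).2,
          fun τ hτ => ?_⟩
        refine (h1 τ ⟨hτ.1, hτ.2.le⟩).mono_of_mem_nhdsWithin (Icc_mem_nhdsGE_of_mem ?_)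
        exact ⟨(hsub ⟨hτ.1, hτ.2.le⟩).2.1, hτ.2.trans_le (hsub ⟨hδ.le, le_rfl⟩).2.2⟩
      obtain ⟨c1, d1⟩ := hder γ hγ fun τ hτ => (hsub hτ).1.1.2
      obtain ⟨c2, d2⟩ := hder γ' hγ' fun τ hτ => (hsub hτ).1.2.2
      have heq := ODE_solution_unique_of_mem_Icc_right
        (v := fun _ => chartField (combination X a) (γ t)) (s := fun _ => S) (fun _ _ => hK) c1 d1
        (fun τ hτ => (hsub ⟨hτ.1, hτ.2.le⟩).1.1.1) c2 d2
        (fun τ hτ => (hsub ⟨hτ.1, hτ.2.le⟩).1.2.1) (by simp [hteq])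
      refine mem_of_superset (Ioo_mem_nhdsGT hδ) fun τ hτ => ?_
      have hτ' : τ ∈ Icc t δ := ⟨hτ.1.le, hτ.2.le⟩
      exact (extChartAt (𝓡 n) (γ t)).injOn (hsub hτ').1.1.2 (hsub hτ').1.2.2 (heq hτ')
    · have := (hγ.continuousOn.prodMk hγ'.continuousOn).preimage_isClosed_of_isClosed
        isClosed_Icc isClosed_diagonal
      rw [inter_comm] at this
      exact this
  exact fun t ht => hsub ht

theorem IsExp.unique [T2Space M] (hU : IsOpen U) (hX : ∀ i, SmoothOn (X i) U)
    {a : Fin n → ℝ} {x y y' : M} (h : IsExp U (combination X a) x y)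
    (h' : IsExp U (combination X a) x y') : y = y' := by
  obtain ⟨γ, h0, h1, hγU, hγ⟩ := h
  obtain ⟨γ', h0', h1', -, hγ'⟩ := h'
  rw [← h1, ← h1']
  exact eqOn_of_isMIntegralCurveOn_Icc hU hX hγU hγ hγ' (h0.trans h0'.symm) (by simp)

theorem IsExp.frameExp_eq [T2Space M] (hU : IsOpen U) (hX : ∀ i, SmoothOn (X i) U)
    {a : Fin n → ℝ} {x y : M} (h : IsExp U (combination X a) x y) : frameExp U X x a = y := by
  have hex : ∃ y, IsExp U (combination X a) x y := ⟨y, h⟩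
  rw [frameExp, dif_pos hex]
  exact hex.choose_spec.unique hU hX h

theorem frameExp_zero [T2Space M] (hU : IsOpen U) (hX : ∀ i, SmoothOn (X i) U) {x : M}
    (hx : x ∈ U) : frameExp U X x 0 = x :=
  (isExp_zero X hx).frameExp_eq hU hX

/-- The one-parameter group property of the exponential map. -/
theorem IsExp.frameExp_flow [T2Space M] (hU : IsOpen U) (hX : ∀ i, SmoothOn (X i) U)
    {a : Fin n → ℝ} {x y : M} (h : IsExp U (combination X a) x y) {s t : ℝ}
    (hs : s ∈ Icc (0 : ℝ) 1) (ht : t ∈ Icc (0 : ℝ) 1) :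
    IsExp U (combination X ((t - s) • a)) (frameExp U X x (s • a)) (frameExp U X x (t • a)) := by
  obtain ⟨γ, h0, -, hγ⟩ := h.exists_path
  have key : ∀ τ ∈ Icc (0 : ℝ) 1, frameExp U X x (τ • a) = γ τ := by
    intro τ hτ
    have := hγ 0 (by simp) τ hτ
    rw [sub_zero, h0] at this
    exact this.frameExp_eq hU hX
  rw [key s hs, key t ht]
  exact hγ s hs t ht

end Exp

/-- Used with the identification of the model space with a tangent space as `L`, so that a
Riemannian norm, not the norm of the model space, measures the curve. -/
theorem enorm_map_sub_le_lintegral {F G : Type*} [NormedAddCommGroup F] [NormedSpace ℝ F]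
    [NormedAddCommGroup G] [NormedSpace ℝ G] (L : F →L[ℝ] G) {c : ℝ → F} {a b : ℝ}
    (hc : ContDiffOn ℝ 1 c (Icc a b)) (hab : a ≤ b) :
    ‖L (c b - c a)‖ₑ ≤ ∫⁻ t in Icc a b, ‖L (derivWithin c (Icc a b) t)‖ₑ := by
  rcases hab.eq_or_lt with rfl | hlt
  · simp
  have h1 := enorm_sub_le_lintegral_derivWithin_Icc_of_contDiffOn_Icc
    (L.contDiff.comp_contDiffOn hc) hab
  rw [map_sub]
  refine h1.trans (le_of_eq ?_)
  refine setLIntegral_congr_fun measurableSet_Icc fun t ht => ?_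
  have h2 := (hc.differentiableOn (by simp) t ht).hasDerivWithinAt
  have h3 := L.hasFDerivAt.comp_hasDerivWithinAt t h2
  change ‖derivWithin (L ∘ c) (Icc a b) t‖ₑ = _
  rw [h3.derivWithin (uniqueDiffOn_Icc hlt t ht)]

/-! ### First order comparison of the Riemannian distance with a norm in a chart -/

section Metric

variable {n : ℕ} {M : Type*} [MetricSpace M]
    [ChartedSpace (EuclideanSpace ℝ (Fin n)) M] [IsManifold (𝓡 n) ∞ M]
    [RiemannianBundle (fun x : M => TangentSpace (𝓡 n) x)]

/-- The identification of the model space with the tangent space at `p` given by the chart. -/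
noncomputable def chartFrame (p : M) : EuclideanSpace ℝ (Fin n) →L[ℝ] TangentSpace (𝓡 n) p :=
  (trivializationAt (EuclideanSpace ℝ (Fin n)) (TangentSpace (𝓡 n)) p).symmL ℝ p

/-- The Riemannian norm at `p` in the chart at `p`. -/
noncomputable def chartNorm (p : M) (v : EuclideanSpace ℝ (Fin n)) : ℝ := ‖chartFrame p v‖

theorem chartNorm_sub_comm (p : M) (v w : EuclideanSpace ℝ (Fin n)) :
    chartNorm p (v - w) = chartNorm p (w - v) := by
  unfold chartNorm
  rw [← neg_sub, map_neg]
  exact norm_neg _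

variable [IsContMDiffRiemannianBundle (𝓡 n) ∞ (EuclideanSpace ℝ (Fin n))
      (fun x : M => TangentSpace (𝓡 n) x)]

theorem isContinuousRiemannianBundle_tangentSpace :
    IsContinuousRiemannianBundle (EuclideanSpace ℝ (Fin n))
      (fun x : M => TangentSpace (𝓡 n) x) := by
  obtain ⟨g, hg, hg'⟩ := IsContMDiffRiemannianBundle.exists_contMDiff (IB := 𝓡 n) (n := ∞)
    (F := EuclideanSpace ℝ (Fin n)) (E := fun x : M => TangentSpace (𝓡 n) x)
  exact ⟨g, hg.continuous, hg'⟩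

/-- Continuity of the Riemannian metric: in the trivialization at `p`, norms at nearby points differ
from the norm at `p` by a factor close to one. The companion estimate below is the same fact for the
inverse of the chart. -/
theorem eventually_chartNorm_mfderiv_le (p : M) {r : ℝ} (hr : 1 < r) :
    ∀ᶠ y in 𝓝 p, ∀ w : TangentSpace (𝓡 n) y,
      chartNorm p (mfderiv (𝓡 n) 𝓘(ℝ, EuclideanSpace ℝ (Fin n)) (extChartAt (𝓡 n) p) y w) ≤
        r * ‖w‖ := by
  have : IsManifold (𝓡 n) 1 M := IsManifold.of_le (n := ∞) (by simp)
  have := isContinuousRiemannianBundle_tangentSpace (n := n) (M := M)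
  filter_upwards [eventually_norm_symmL_trivializationAt_self_comp_lt (EuclideanSpace ℝ (Fin n))
    (fun x : M => TangentSpace (𝓡 n) x) p hr, chart_source_mem_nhds (EuclideanSpace ℝ (Fin n)) p]
    with y hy hys w
  have e1 := congr($(TangentBundle.continuousLinearMapAt_trivializationAt (I := 𝓡 n) hys) w)
  have h2 := ContinuousLinearMap.le_of_opNorm_le _ hy.le w
  refine le_trans (le_of_eq ?_) h2
  exact congrArg (chartNorm p) e1.symm

theorem eventually_norm_mfderivWithin_symm_le (p : M) {r : ℝ} (hr : 1 < r) :
    ∀ᶠ y in 𝓝 p, ∀ v : EuclideanSpace ℝ (Fin n),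
      ‖(mfderivWithin 𝓘(ℝ, EuclideanSpace ℝ (Fin n)) (𝓡 n) (extChartAt (𝓡 n) p).symm
        (range (𝓡 n)) (extChartAt (𝓡 n) p y) v :
          TangentSpace (𝓡 n) ((extChartAt (𝓡 n) p).symm (extChartAt (𝓡 n) p y)))‖ ≤
        r * chartNorm p v := by
  have : IsManifold (𝓡 n) 1 M := IsManifold.of_le (n := ∞) (by simp)
  have := isContinuousRiemannianBundle_tangentSpace (n := n) (M := M)
  filter_upwards [eventually_norm_symmL_trivializationAt_comp_self_lt (EuclideanSpace ℝ (Fin n))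
    (fun x : M => TangentSpace (𝓡 n) x) p hr, chart_source_mem_nhds (EuclideanSpace ℝ (Fin n)) p]
    with y hy hys v
  have e1 := congr($(TangentBundle.symmL_trivializationAt (I := 𝓡 n) hys) v)
  have h2 := ContinuousLinearMap.le_of_opNorm_le _ hy.le (chartFrame p v)
  have h3 : (trivializationAt (EuclideanSpace ℝ (Fin n)) (TangentSpace (𝓡 n)) p).continuousLinearMapAt
      ℝ p (chartFrame p v) = v :=
    Trivialization.continuousLinearMapAt_symmL _ (by simp) v
  have A : (extChartAt (𝓡 n) p).symm (extChartAt (𝓡 n) p y) = y :=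
    (extChartAt (𝓡 n) p).left_inv (by rwa [extChartAt_source])
  have h4 : ‖(trivializationAt (EuclideanSpace ℝ (Fin n)) (TangentSpace (𝓡 n)) p).symmL ℝ y v‖ ≤
      r * chartNorm p v := by
    refine le_trans (le_of_eq ?_) h2
    refine congrArg norm ?_
    exact congrArg ((trivializationAt (EuclideanSpace ℝ (Fin n)) (TangentSpace (𝓡 n)) p).symmL ℝ y) h3.symm
  refine le_trans (le_of_eq ?_) h4
  -- The base point is `φ.symm (φ y)`, only propositionally equal to `y`, so the norm has to be
  -- transported between two tangent spaces.
  have key : ∀ q : M, q = y → ∀ w : EuclideanSpace ℝ (Fin n),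
      ‖(show TangentSpace (𝓡 n) q from w)‖ = ‖(show TangentSpace (𝓡 n) y from w)‖ := by
    rintro _ rfl _
    rfl
  exact (key _ A _).trans
    (congrArg (fun w : TangentSpace (𝓡 n) y => ‖w‖) e1.symm)

variable [IsRiemannianManifold (𝓡 n) M]

/-- The distance is at most the length of the preimage of a straight segment in the chart, whose
speed is at most `r` times the norm at `p`. -/
theorem eventually_dist_le_chartNorm (p : M) {r : ℝ} (hr : 1 < r) :
    ∀ᶠ q : M × M in 𝓝 (p, p), dist q.1 q.2 ≤
      r * chartNorm p (extChartAt (𝓡 n) p q.1 - extChartAt (𝓡 n) p q.2) := by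
  have : IsManifold (𝓡 n) 1 M := IsManifold.of_le (n := ∞) (by simp)
  set φ := extChartAt (𝓡 n) p with hφ
  have hC : ∀ᶠ ξ in 𝓝 (φ p), ξ ∈ φ.target ∧ ∀ v : EuclideanSpace ℝ (Fin n),
      ‖(mfderivWithin 𝓘(ℝ, EuclideanSpace ℝ (Fin n)) (𝓡 n) φ.symm (range (𝓡 n)) ξ v :
          TangentSpace (𝓡 n) (φ.symm ξ))‖ ≤ r * chartNorm p v := by
    have h1 : Tendsto φ.symm (𝓝 (φ p)) (𝓝 p) := by
      have := continuousAt_extChartAt_symm (I := 𝓡 n) p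
      rwa [ContinuousAt, extChartAt_to_inv] at this
    filter_upwards [h1.eventually (eventually_norm_mfderivWithin_symm_le (n := n) p hr),
      extChartAt_target_mem_nhds (I := 𝓡 n) p] with ξ hξ hξt
    refine ⟨hξt, fun v => ?_⟩
    have := hξ v
    rwa [← hφ, φ.right_inv hξt] at this
  obtain ⟨R, hR, hRs⟩ := Metric.eventually_nhds_iff_ball.1 hC
  have hN : φ ⁻¹' Metric.ball (φ p) R ∩ φ.source ∈ 𝓝 p :=
    inter_mem ((continuousAt_extChartAt p).preimage_mem_nhds (Metric.ball_mem_nhds _ hR))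
      (extChartAt_source_mem_nhds p)
  rw [nhds_prod_eq]
  filter_upwards [prod_mem_prod hN hN]
  rintro ⟨y, z⟩ ⟨⟨hy, hys⟩, ⟨hz, hzs⟩⟩
  simp only at hy hys hz hzs ⊢
  let c := ContinuousAffineMap.lineMap (R := ℝ) (φ y) (φ z)
  have hcball : ∀ t ∈ Icc (0 : ℝ) 1, c t ∈ Metric.ball (φ p) R := by
    intro t ht
    have h1 : c t ∈ segment ℝ (φ y) (φ z) := by
      rw [segment_eq_image_lineMap]
      exact ⟨t, ht, by simp [c, ContinuousAffineMap.coe_lineMap_eq]⟩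
    exact (convex_ball (φ p) R).segment_subset hy hz h1
  have hct : Icc (0 : ℝ) 1 ⊆ c ⁻¹' φ.target := fun t ht => (hRs _ (hcball t ht)).1
  have hc : ContMDiffOn 𝓘(ℝ, ℝ) 𝓘(ℝ, EuclideanSpace ℝ (Fin n)) 1 c (Icc 0 1) := by
    apply ContMDiff.contMDiffOn
    rw [contMDiff_iff_contDiff]
    exact ContinuousAffineMap.contDiff _
  have hlen : Manifold.riemannianEDist (𝓡 n) y z ≤ Manifold.pathELength (𝓡 n) (φ.symm ∘ c) 0 1 := by
    apply Manifold.riemannianEDist_le_pathELength _ _ _ zero_le_one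
    · exact (contMDiffOn_extChartAt_symm p).comp hc hct
    · simp only [Function.comp_apply, c, ContinuousAffineMap.coe_lineMap_eq, AffineMap.lineMap_apply_zero]
      exact φ.left_inv hys
    · simp only [Function.comp_apply, c, ContinuousAffineMap.coe_lineMap_eq, AffineMap.lineMap_apply_one]
      exact φ.left_inv hzs
  have hb : Manifold.pathELength (𝓡 n) (φ.symm ∘ c) 0 1 ≤
      ENNReal.ofReal (r * chartNorm p (φ z - φ y)) := by
    rw [Manifold.pathELength_eq_lintegral_mfderivWithin_Icc]
    calc _ ≤ ∫⁻ _t in Icc (0 : ℝ) 1, ENNReal.ofReal (r * chartNorm p (φ z - φ y)) := ?_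
      _ = _ := by simp
    refine setLIntegral_mono' measurableSet_Icc fun t ht => ?_
    have h1 : HasDerivWithinAt c (φ z - φ y) (Icc 0 1) t := by
      have := (AffineMap.hasDerivWithinAt_lineMap (a := φ y) (b := φ z) (s := Icc (0 : ℝ) 1) (x := t))
      simpa [c, ContinuousAffineMap.coe_lineMap_eq] using this
    have h2 : HasMFDerivWithinAt 𝓘(ℝ, ℝ) 𝓘(ℝ, EuclideanSpace ℝ (Fin n)) c (Icc 0 1) t _ :=
      h1.hasFDerivWithinAt.hasMFDerivWithinAt
    have h3 := (mdifferentiableWithinAt_extChartAt_symm (I := 𝓡 n) (hct ht)).hasMFDerivWithinAt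
    have h4 := h3.comp t h2 (fun _ _ => by simp)
    have h5 := h4.mfderivWithin ((uniqueDiffOn_Icc zero_lt_one).uniqueMDiffOn t ht)
    have h6 := (hRs _ (hcball t ht)).2 (φ z - φ y)
    have h7 := congr($h5 (1 : ℝ))
    rw [← ofReal_norm]
    refine ENNReal.ofReal_le_ofReal (le_trans (le_of_eq ?_) h6)
    refine congrArg (fun w : TangentSpace (𝓡 n) (φ.symm (c t)) => ‖w‖) (h7.trans ?_)
    exact congrArg (mfderivWithin 𝓘(ℝ, EuclideanSpace ℝ (Fin n)) (𝓡 n) φ.symm (range (𝓡 n)) (c t))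
      (one_smul ℝ (φ z - φ y))
  rw [← IsRiemannianManifold.out (I := 𝓡 n)] at hlen
  have h0 : 0 ≤ r * chartNorm p (φ z - φ y) := mul_nonneg (by linarith) (norm_nonneg _)
  have := hlen.trans hb
  rw [edist_dist, ENNReal.ofReal_le_ofReal_iff h0] at this
  rwa [chartNorm_sub_comm]

/-- An almost minimizing curve stays near `p`, where its chart speed is at most `r` times its
Riemannian speed. Integration bounds the difference of the chart coordinates of its ends. -/
theorem eventually_chartNorm_le_dist (p : M) {r : ℝ} (hr : 1 < r) :
    ∀ᶠ q : M × M in 𝓝 (p, p),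
      chartNorm p (extChartAt (𝓡 n) p q.1 - extChartAt (𝓡 n) p q.2) ≤ r * dist q.1 q.2 := by
  have : IsManifold (𝓡 n) 1 M := IsManifold.of_le (n := ∞) (by simp)
  set φ := extChartAt (𝓡 n) p with hφ
  obtain ⟨R, hR, hRs⟩ := Metric.eventually_nhds_iff_ball.1
    ((eventually_chartNorm_mfderiv_le (n := n) p hr).and
      (chart_source_mem_nhds (EuclideanSpace ℝ (Fin n)) p))
  have hN : Metric.ball p (R / 4) ∈ 𝓝 p := Metric.ball_mem_nhds _ (by positivity)
  rw [nhds_prod_eq]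
  filter_upwards [prod_mem_prod hN hN]
  rintro ⟨y, z⟩ ⟨hy, hz⟩
  simp only at hy hz ⊢
  refine le_of_forall_gt_imp_ge_of_dense fun b hb => ?_
  have hr0 : 0 < r := by linarith
  -- The bound `R / 2` keeps a curve of length less than `ℓ` that starts within `R / 4` of `p`
  -- inside the ball of radius `R`. The bound `b / r` gives the required inequality at the end.
  obtain ⟨ℓ, hℓ1, hℓ2⟩ : ∃ ℓ, dist y z < ℓ ∧ ℓ < min (b / r) (R / 2) := by
    apply exists_between
    rw [lt_min_iff, lt_div_iff₀ hr0]
    refine ⟨by linarith [mul_comm r (dist y z)], ?_⟩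
    have := dist_triangle_right y z p
    rw [Metric.mem_ball] at hy hz
    linarith
  have hℓ0 : 0 < ℓ := dist_nonneg.trans_lt hℓ1
  have hlt : Manifold.riemannianEDist (𝓡 n) y z < ENNReal.ofReal ℓ := by
    rw [← IsRiemannianManifold.out (I := 𝓡 n), edist_dist]
    exact (ENNReal.ofReal_lt_ofReal_iff hℓ0).2 hℓ1
  obtain ⟨γ, hγ0, hγ1, hγs, hγl, -⟩ :=
    Manifold.exists_lt_locally_constant_of_riemannianEDist_lt hlt zero_lt_one
  have hin : ∀ t ∈ Icc (0 : ℝ) 1, γ t ∈ Metric.ball p R := by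
    intro t ht
    have h1 : edist y (γ t) ≤ ENNReal.ofReal ℓ := by
      rw [IsRiemannianManifold.out (I := 𝓡 n)]
      refine (Manifold.riemannianEDist_le_pathELength (γ := γ) (a := 0) (b := t) hγs.contMDiffOn
        hγ0 rfl ht.1).trans ?_
      exact (Manifold.pathELength_mono le_rfl ht.2).trans hγl.le
    rw [edist_dist, ENNReal.ofReal_le_ofReal_iff hℓ0.le] at h1
    rw [Metric.mem_ball] at hy ⊢
    have := dist_triangle (γ t) y p
    rw [dist_comm (γ t) y] at this
    linarith [hℓ2.trans_le (min_le_right _ _)]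
  have hcd : ContDiffOn ℝ 1 (φ ∘ γ) (Icc 0 1) := by
    rw [← contMDiffOn_iff_contDiffOn]
    exact contMDiffOn_extChartAt.comp (I' := 𝓡 n) hγs.contMDiffOn
      (fun t ht => (hRs _ (hin t ht)).2)
  have h1 := enorm_map_sub_le_lintegral (chartFrame p) hcd zero_le_one
  have h2 : ∫⁻ t in Icc (0 : ℝ) 1, ‖chartFrame p (derivWithin (φ ∘ γ) (Icc 0 1) t)‖ₑ ≤
      ENNReal.ofReal r * Manifold.pathELength (𝓡 n) γ 0 1 := by
    rw [Manifold.pathELength_eq_lintegral_mfderivWithin_Icc,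
      ← lintegral_const_mul' _ _ ENNReal.ofReal_ne_top]
    refine setLIntegral_mono' measurableSet_Icc fun t ht => ?_
    have hs := hRs _ (hin t ht)
    have g1 : HasMFDerivAt (𝓡 n) 𝓘(ℝ, EuclideanSpace ℝ (Fin n)) φ (γ t) _ :=
      (mdifferentiableAt_extChartAt hs.2).hasMFDerivAt
    have g2 := ((hγs.mdifferentiable one_ne_zero) t).mdifferentiableWithinAt (s := Icc (0 : ℝ) 1)
      |>.hasMFDerivWithinAt
    have g3 := g1.comp_hasMFDerivWithinAt t g2
    rw [hasMFDerivWithinAt_iff_hasFDerivWithinAt] at g3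
    have g4 : HasDerivWithinAt (φ ∘ γ)
        (mfderiv (𝓡 n) 𝓘(ℝ, EuclideanSpace ℝ (Fin n)) φ (γ t)
          (mfderivWithin 𝓘(ℝ, ℝ) (𝓡 n) γ (Icc 0 1) t (1 : ℝ))) (Icc 0 1) t :=
      HasDerivWithinAt.congr_deriv (HasFDerivWithinAt.hasDerivWithinAt g3) rfl
    rw [g4.derivWithin (uniqueDiffOn_Icc zero_lt_one t ht), ← ofReal_norm, ← ofReal_norm, ← ENNReal.ofReal_mul hr0.le]
    exact ENNReal.ofReal_le_ofReal (hs.1 _)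
  have h3 : chartNorm p (φ y - φ z) ≤ r * ℓ := by
    have h4 := h1.trans (h2.trans (mul_le_mul_right hγl.le _))
    rw [← ofReal_norm, ← ENNReal.ofReal_mul hr0.le,
      ENNReal.ofReal_le_ofReal_iff (by positivity)] at h4
    rw [chartNorm_sub_comm]
    simpa [chartNorm, hγ0, hγ1] using h4
  have h5 := hℓ2.trans_le (min_le_left _ _)
  rw [lt_div_iff₀ hr0] at h5
  linarith [mul_comm ℓ r]

end Metric

/-! ### Frame coordinates adapted to a point -/

section Local

set_option linter.unusedSectionVars false

variable {n : ℕ} {M : Type*} [MetricSpace M]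
    [ChartedSpace (EuclideanSpace ℝ (Fin n)) M] [IsManifold (𝓡 n) ∞ M]
    {U : Set M} {X : Fin n → VField n M}

/-- Near `(p, 0)` the exponential map is given by solutions of a differential equation in the
chart at `p`. -/
theorem eventually_frameExp_eq_frameSolution (hU : IsOpen U) (hX : ∀ i, SmoothOn (X i) U) {p : M}
    (hp : p ∈ U) {O : Set (EuclideanSpace ℝ (Fin n))} (hO : O ∈ 𝓝 (extChartAt (𝓡 n) p p)) :
    ∀ᶠ q : M × (Fin n → ℝ) in 𝓝 (p, 0), ∃ c : ℝ → EuclideanSpace ℝ (Fin n),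
      c 0 = extChartAt (𝓡 n) p q.1 ∧ IsFrameSolution (fun i => chartField (X i) p) O q.2 c ∧
      IsExp U (combination X q.2) q.1 (frameExp U X q.1 q.2) ∧
      frameExp U X q.1 q.2 = (extChartAt (𝓡 n) p).symm (c 1) ∧
      extChartAt (𝓡 n) p (frameExp U X q.1 q.2) = c 1 := by
  set φ := extChartAt (𝓡 n) p with hφ
  have hO' : O ∩ (φ.target ∩ φ.symm ⁻¹' U) ∈ 𝓝 (φ p) := by
    refine inter_mem hO (inter_mem (extChartAt_target_mem_nhds p) ?_)
    refine (continuousAt_extChartAt_symm p).preimage_mem_nhds ?_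
    rw [extChartAt_to_inv]
    exact hU.mem_nhds hp
  have hsol := exists_frameSolution (fun i => contDiffAt_chartField hU (hX i) hp) hO'
  have hcont : Tendsto (fun q : M × (Fin n → ℝ) => (φ q.1, q.2)) (𝓝 (p, 0)) (𝓝 (φ p, 0)) :=
    ((continuousAt_extChartAt (I := 𝓡 n) p).tendsto.comp
      (continuousAt_fst (p := (p, (0 : Fin n → ℝ)))).tendsto).prodMk_nhds
      (continuousAt_snd (p := (p, (0 : Fin n → ℝ)))).tendsto
  have hsrc : ∀ᶠ q : M × (Fin n → ℝ) in 𝓝 (p, 0), q.1 ∈ φ.source :=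
    continuousAt_fst.eventually (extChartAt_source_mem_nhds p)
  filter_upwards [hcont.eventually hsol, hsrc] with q ⟨c, hc0, hc⟩ hq
  have hint : IsMIntegralCurveOn (I := 𝓡 n) (φ.symm ∘ c) (combination X q.2) (Icc 0 1) :=
    isMIntegralCurveOn_extChartAt_symm_comp (fun t ht => (hc.mem t ht).2.1) fun t ht => by
      rw [chartField_combination]
      exact hc.deriv t ht
  have hexp : IsExp U (combination X q.2) q.1 (φ.symm (c 1)) := by
    refine ⟨φ.symm ∘ c, ?_, rfl, fun t ht => (hc.mem t ht).2.2, hint⟩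
    simp only [Function.comp_apply, hc0]
    exact φ.left_inv hq
  have heq := hexp.frameExp_eq hU hX
  refine ⟨c, hc0, ⟨fun t ht => (hc.mem t ht).1, hc.deriv⟩, by rwa [heq], heq, ?_⟩
  rw [heq]
  exact φ.right_inv (hc.mem 1 (by simp)).2.1

/-- Frame coordinates at `p`, in which `(x, a) ↦ exp(∑ aᵢ Xᵢ)(x)` is `(x, a) ↦ x + a` to first
order, and in which the distance is given by the norm `g` to first order. -/
structure IsFrameChart (U : Set M) (X : Fin n → VField n M) (g : (Fin n → ℝ) → ℝ) (p : M)
    (κ : OpenPartialHomeomorph M (Fin n → ℝ)) : Prop where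
  mem_source : p ∈ κ.source
  eventually_isExp : ∀ᶠ q : M × (Fin n → ℝ) in 𝓝 (p, 0),
    IsExp U (combination X q.2) q.1 (frameExp U X q.1 q.2)
  tendsto : Tendsto (fun q : M × (Fin n → ℝ) => frameExp U X q.1 q.2) (𝓝 (p, 0)) (𝓝 p)
  strict : ∀ η > 0, ∀ᶠ q : (M × (Fin n → ℝ)) × (M × (Fin n → ℝ)) in 𝓝 ((p, 0), (p, 0)),
    ‖κ (frameExp U X q.1.1 q.1.2) - κ (frameExp U X q.2.1 q.2.2) - (κ q.1.1 - κ q.2.1) -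
      (q.1.2 - q.2.2)‖ ≤ η * (‖κ q.1.1 - κ q.2.1‖ + ‖q.1.2 - q.2.2‖)
  metric : ∀ η > 0, ∀ᶠ q : M × M in 𝓝 (p, p),
    |dist q.1 q.2 - g (κ q.1 - κ q.2)| ≤ η * ‖κ q.1 - κ q.2‖

variable [RiemannianBundle (fun x : M => TangentSpace (𝓡 n) x)]

/-- The Riemannian norm of `∑ vᵢ Xᵢ(x)`. -/
noncomputable def frameNorm (X : Fin n → VField n M) (x : M) (v : Fin n → ℝ) : ℝ :=
  ‖combination X v x‖

theorem frameNorm_add_le (x : M) (v w : Fin n → ℝ) :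
    frameNorm X x (v + w) ≤ frameNorm X x v + frameNorm X x w := by
  have h : combination X (v + w) x = combination X v x + combination X w x := by
    unfold combination
    refine Eq.trans ?_ Finset.sum_add_distrib
    exact Finset.sum_congr rfl fun i _ => add_smul (v i) (w i) (X i x)
  unfold frameNorm
  rw [h]
  exact norm_add_le _ _

theorem frameNorm_smul (x : M) (s : ℝ) (v : Fin n → ℝ) :
    frameNorm X x (s • v) = |s| * frameNorm X x v := by
  unfold frameNorm
  rw [combination_smul]
  exact norm_smul s (combination X v x)

theorem frameNorm_pos {x : M} (h : LinearIndependent ℝ (fun i => X i x)) {v : Fin n → ℝ}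
    (hv : v ≠ 0) : 0 < frameNorm X x v := by
  refine norm_pos_iff.2 fun h0 => hv ?_
  exact funext (Fintype.linearIndependent_iff.1 h v h0)

theorem chartFrame_chartField (V : VField n M) (p : M) :
    chartFrame p (chartField V p (extChartAt (𝓡 n) p p)) = V p := by
  have : IsManifold (𝓡 n) 1 M := IsManifold.of_le (n := ∞) (by simp)
  rw [chartField_extChartAt V (mem_extChartAt_source p)]
  have e1 := congr($(TangentBundle.continuousLinearMapAt_trivializationAt (I := 𝓡 n)
    (mem_chart_source (EuclideanSpace ℝ (Fin n)) p)) (V p))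
  refine (congrArg (chartFrame p) e1.symm).trans ?_
  exact Trivialization.symmL_continuousLinearMapAt _ (by simp) (V p)

variable [IsContMDiffRiemannianBundle (𝓡 n) ∞ (EuclideanSpace ℝ (Fin n))
      (fun x : M => TangentSpace (𝓡 n) x)] [IsRiemannianManifold (𝓡 n) M]

/-- `κ` is the chart at `p` followed by the inverse of the linear isomorphism `B` that sends the
standard basis to the frame at `p` read in the chart. This makes the drift in the strict estimate
equal to `a - a'`, and turns the chart norm into `frameNorm X p`. -/
theorem exists_isFrameChart (hU : IsOpen U) (hX : ∀ i, SmoothOn (X i) U) {p : M} (hp : p ∈ U)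
    (hli : LinearIndependent ℝ (fun i => X i p)) :
    ∃ κ : OpenPartialHomeomorph M (Fin n → ℝ), IsFrameChart U X (frameNorm X p) p κ := by
  set φ := extChartAt (𝓡 n) p with hφ
  set Y : Fin n → EuclideanSpace ℝ (Fin n) → EuclideanSpace ℝ (Fin n) :=
    fun i => chartField (X i) p with hY
  have hYs : ∀ i, ContDiffAt ℝ 1 (Y i) (φ p) := fun i => contDiffAt_chartField hU (hX i) hp
  have hYX : ∀ i, chartFrame p (Y i (φ p)) = X i p := fun i => chartFrame_chartField (X i) p
  have hYli : LinearIndependent ℝ (fun i => Y i (φ p)) := by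
    refine LinearIndependent.of_comp (chartFrame p).toLinearMap ?_
    convert hli using 1
    exact funext hYX
  let b := basisOfLinearIndependentOfCardEqFinrank' (fun i => Y i (φ p)) hYli (by simp)
  let B : (Fin n → ℝ) ≃L[ℝ] EuclideanSpace ℝ (Fin n) := b.equivFun.symm.toContinuousLinearEquiv
  have hB : ∀ v, B v = ∑ i, v i • Y i (φ p) := by
    intro v
    change b.equivFun.symm v = _
    rw [Module.Basis.equivFun_symm_apply]
    simp [b]
  have hgB : ∀ ξ, frameNorm X p (B.symm ξ) = chartNorm p ξ := by
    intro ξ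
    obtain ⟨v, rfl⟩ := B.surjective ξ
    rw [B.symm_apply_apply]
    unfold frameNorm chartNorm
    refine congrArg norm ?_
    rw [hB, map_sum]
    exact Finset.sum_congr rfl fun i _ =>
      (congrArg (fun w => v i • w) (hYX i).symm).trans (map_smul (chartFrame p) (v i) (Y i (φ p))).symm
  let κ : OpenPartialHomeomorph M (Fin n → ℝ) :=
    (chartAt (EuclideanSpace ℝ (Fin n)) p).transHomeomorph B.symm.toHomeomorph
  have hκ : ∀ y, κ y = B.symm (φ y) := fun y => rfl
  have hφs : φ.source ∈ 𝓝 p := extChartAt_source_mem_nhds p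
  refine ⟨κ, ⟨mem_chart_source _ p, ?_, ?_, ?_, ?_⟩⟩
  · filter_upwards [eventually_frameExp_eq_frameSolution hU hX hp univ_mem] with q hq
    obtain ⟨c, -, -, h, -⟩ := hq
    exact h
  · intro N hN
    have hO : φ.symm ⁻¹' N ∈ 𝓝 (φ p) := by
      refine (continuousAt_extChartAt_symm p).preimage_mem_nhds ?_
      rwa [extChartAt_to_inv]
    rw [Filter.mem_map]
    filter_upwards [eventually_frameExp_eq_frameSolution hU hX hp hO] with q hq
    obtain ⟨c, -, hc, -, h, -⟩ := hq
    rw [mem_preimage, h]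
    exact hc.mem 1 (by simp)
  · intro η hη
    set A : ℝ := ‖(B.symm : EuclideanSpace ℝ (Fin n) →L[ℝ] (Fin n → ℝ))‖ with hA
    set A' : ℝ := ‖(B : (Fin n → ℝ) →L[ℝ] EuclideanSpace ℝ (Fin n))‖ with hA'
    have hA0 : 0 ≤ A := norm_nonneg _
    have hA0' : 0 ≤ A' := norm_nonneg _
    -- The denominator compensates for the operator norms of `B` and of its inverse, met when the
    -- estimate is moved from the chart to `κ`.
    obtain ⟨O, hO, r, hr, hest⟩ := frameSolution_strict_estimate hYs
      (η := η / ((A + 1) * (A' + 1))) (by positivity)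
    have h1 := eventually_frameExp_eq_frameSolution hU hX hp hO
    have h2 : ∀ᶠ q : M × (Fin n → ℝ) in 𝓝 (p, 0), ‖q.2‖ < r := by
      have : Tendsto (fun q : M × (Fin n → ℝ) => ‖q.2‖) (𝓝 (p, 0)) (𝓝 ‖(0 : Fin n → ℝ)‖) :=
        continuousAt_snd.norm
      rw [norm_zero] at this
      exact this.eventually_lt_const hr
    rw [nhds_prod_eq]
    filter_upwards [prod_mem_prod h1 (inter_mem h1 h2)]
    rintro ⟨⟨x, a⟩, ⟨y, a'⟩⟩ ⟨⟨c, hc0, hc, -, -, hc1⟩, ⟨⟨c', hc0', hc', -, -, hc1'⟩, ha'⟩⟩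
    simp only [← hφ] at hc0 hc hc1 hc0' hc' hc1' ha' ⊢
    have h3 := hest a a' c c' ha' hc hc'
    rw [hc0, hc0'] at h3
    have h4 : κ (frameExp U X x a) - κ (frameExp U X y a') - (κ x - κ y) - (a - a') =
        B.symm (c 1 - c' 1 - (φ x - φ y) - ∑ i, (a i - a' i) • Y i (φ p)) := by
      have : a - a' = B.symm (∑ i, (a i - a' i) • Y i (φ p)) := by
        rw [← B.symm_apply_apply (a - a'), hB]; rfl
      simp only [hκ, hc1, hc1', map_sub]
      rw [this]
    have h5 : ‖φ x - φ y‖ ≤ A' * ‖κ x - κ y‖ := by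
      have := (B : (Fin n → ℝ) →L[ℝ] EuclideanSpace ℝ (Fin n)).le_opNorm (κ x - κ y)
      simpa [hκ] using this
    rw [h4]
    refine ((B.symm : EuclideanSpace ℝ (Fin n) →L[ℝ] (Fin n → ℝ)).le_opNorm _).trans ?_
    have h6 : ‖φ x - φ y‖ + ‖a - a'‖ ≤ (A' + 1) * (‖κ x - κ y‖ + ‖a - a'‖) := by
      nlinarith [norm_nonneg (κ x - κ y), norm_nonneg (a - a')]
    calc A * ‖c 1 - c' 1 - (φ x - φ y) - ∑ i, (a i - a' i) • Y i (φ p)‖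
        ≤ (A + 1) * (η / ((A + 1) * (A' + 1)) * ((A' + 1) * (‖κ x - κ y‖ + ‖a - a'‖))) := by
          refine mul_le_mul (by linarith) (h3.trans ?_) (norm_nonneg _) (by positivity)
          gcongr
      _ = η * (‖κ x - κ y‖ + ‖a - a'‖) := by field_simp
  · intro η hη
    obtain ⟨C, hC, hCb⟩ : ∃ C > 0, ∀ v, frameNorm X p v ≤ C * ‖v‖ := by
      refine ⟨(∑ i, ‖X i p‖) + 1, by positivity, fun v => ?_⟩
      have : frameNorm X p v ≤ ∑ i, ‖v i • X i p‖ := norm_sum_le _ _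
      refine this.trans ?_
      calc ∑ i, ‖v i • X i p‖ ≤ ∑ i, ‖v‖ * ‖X i p‖ := by
            refine Finset.sum_le_sum fun i _ => ?_
            refine (norm_smul (v i) (X i p)).le.trans ?_
            exact mul_le_mul_of_nonneg_right (norm_le_pi_norm v i) (norm_nonneg _)
        _ = ‖v‖ * ∑ i, ‖X i p‖ := by rw [Finset.mul_sum]
        _ ≤ ((∑ i, ‖X i p‖) + 1) * ‖v‖ := by nlinarith [norm_nonneg v]
    -- A relative error `1 + δ` becomes an additive one: `δ * C ≤ η / 2` handles one direction. In
    -- the other, `δ ≤ 1` bounds the distance by twice the norm, which costs a further factor two.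
    set δ : ℝ := min (η / C / 2) 1 with hδ
    have hδ0 : 0 < δ := by positivity
    have hδC : δ * C ≤ η / 2 := by
      calc δ * C ≤ η / C / 2 * C := by gcongr; exact min_le_left _ _
        _ = η / 2 := by field_simp
    have hδ1 : δ ≤ 1 := min_le_right _ _
    filter_upwards [eventually_dist_le_chartNorm (n := n) p (r := 1 + δ) (by linarith),
      eventually_chartNorm_le_dist (n := n) p (r := 1 + δ) (by linarith)] with q h1 h2
    rw [← hgB, map_sub, ← hκ, ← hκ] at h1 h2
    have h3 := hCb (κ q.1 - κ q.2)
    have h4 : 0 ≤ dist q.1 q.2 := dist_nonneg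
    have h5 : δ * frameNorm X p (κ q.1 - κ q.2) ≤ η / 2 * ‖κ q.1 - κ q.2‖ := by
      calc δ * frameNorm X p (κ q.1 - κ q.2) ≤ δ * (C * ‖κ q.1 - κ q.2‖) := by gcongr
        _ = δ * C * ‖κ q.1 - κ q.2‖ := by ring
        _ ≤ _ := by gcongr
    have h6 : 0 ≤ ‖κ q.1 - κ q.2‖ := norm_nonneg _
    have h7 : 0 ≤ frameNorm X p (κ q.1 - κ q.2) := norm_nonneg _
    rw [abs_le]
    constructor <;> nlinarith

end Local

/-! ### Radii on which the exponential map is well behaved -/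

section Radius

set_option linter.unusedSectionVars false

variable {n : ℕ} {M : Type*} [MetricSpace M]
    [ChartedSpace (EuclideanSpace ℝ (Fin n)) M] [IsManifold (𝓡 n) ∞ M]

/-- The standing properties of a smooth frame and of the norms `g x v = ‖∑ vᵢ Xᵢ(x)‖`. -/
structure IsFrameSystem (U : Set M) (X : Fin n → VField n M) (g : M → (Fin n → ℝ) → ℝ) : Prop where
  isOpen : IsOpen U
  smooth : ∀ i, SmoothOn (X i) U
  chart : ∀ p ∈ U, ∃ κ, IsFrameChart U X (g p) p κ
  norm_add_le : ∀ x ∈ U, ∀ v w, g x (v + w) ≤ g x v + g x w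
  norm_smul : ∀ x ∈ U, ∀ (s : ℝ) v, g x (s • v) = |s| * g x v
  norm_pos : ∀ x ∈ U, ∀ v, v ≠ 0 → 0 < g x v

/-- The map `a ↦ exp(∑ aᵢ Xᵢ)(x)` is well behaved on the ball of radius `s`, jointly in `x`. -/
structure IsGoodRadiusAt (U : Set M) (X : Fin n → VField n M) (x : M) (s : ℝ) : Prop where
  isExp : ∀ a, ‖a‖ < s → IsExp U (combination X a) x (frameExp U X x a)
  injOn : InjOn (frameExp U X x) (Metric.ball 0 s)
  continuousAt : ∀ a, ‖a‖ < s →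
    ContinuousAt (fun q : M × (Fin n → ℝ) => frameExp U X q.1 q.2) (x, a)
  nhds_le : ∀ a, ‖a‖ < s → 𝓝 (x, frameExp U X x a) ≤
    map (fun q : M × (Fin n → ℝ) => (q.1, frameExp U X q.1 q.2)) (𝓝 (x, a))
  dist_le : ∀ a, ‖a‖ < s → dist (frameExp U X x a) x ≤ 1

theorem IsGoodRadiusAt.mono {U : Set M} {X : Fin n → VField n M} {x : M} {s t : ℝ}
    (h : IsGoodRadiusAt U X x t) (hst : s ≤ t) : IsGoodRadiusAt U X x s where
  isExp a ha := h.isExp a (ha.trans_le hst)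
  injOn := h.injOn.mono (Metric.ball_subset_ball hst)
  continuousAt a ha := h.continuousAt a (ha.trans_le hst)
  nhds_le a ha := h.nhds_le a (ha.trans_le hst)
  dist_le a ha := h.dist_le a (ha.trans_le hst)

/-- A continuous choice of radii on which the exponential map is well behaved. -/
structure IsGoodRadius (U : Set M) (X : Fin n → VField n M) (ρ : M → ℝ) : Prop where
  continuousOn : ContinuousOn ρ U
  pos : ∀ x ∈ U, 0 < ρ x
  good : ∀ x ∈ U, IsGoodRadiusAt U X x (ρ x)

variable {U : Set M} {X : Fin n → VField n M}

/-- All the regularity follows from the strict estimate with constant `1 / 4`, valid for varying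
base points. For equal base points it gives injectivity; in general it gives joint continuity, and
it makes `(x, a) ↦ (x, exp(a)(x))`, after a shear, a small Lipschitz perturbation of the identity,
hence open. -/
theorem IsFrameChart.exists_isGoodRadiusAt {g : (Fin n → ℝ) → ℝ} {p : M}
    {κ : OpenPartialHomeomorph M (Fin n → ℝ)} (h : IsFrameChart U X g p κ) :
    ∃ N ∈ 𝓝 p, ∃ s > 0, ∀ x ∈ N, IsGoodRadiusAt U X x s := by
  have hs : κ.source ∈ 𝓝 p := κ.open_source.mem_nhds h.mem_source
  have e1 := h.eventually_isExp
  have e2 : ∀ᶠ q : M × (Fin n → ℝ) in 𝓝 (p, 0), frameExp U X q.1 q.2 ∈ κ.source :=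
    h.tendsto.eventually hs
  have e3 : ∀ᶠ q : M × (Fin n → ℝ) in 𝓝 (p, 0), dist (frameExp U X q.1 q.2) q.1 ≤ 1 := by
    have : Tendsto (fun q : M × (Fin n → ℝ) => dist (frameExp U X q.1 q.2) q.1) (𝓝 (p, 0))
        (𝓝 (dist p p)) :=
      h.tendsto.dist (continuousAt_fst (p := (p, (0 : Fin n → ℝ)))).tendsto
    rw [dist_self] at this
    exact this.eventually_le_const zero_lt_one
  -- On the product, the sum of the two norms is at most twice the maximum norm, so `1 / 4` leads to
  -- the constant `1 / 2 < 1` required by the inverse function theorem.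
  have e4 := h.strict (1 / 4) (by norm_num)
  rw [nhds_prod_eq (x := (p, (0 : Fin n → ℝ)))] at e4
  obtain ⟨S, hS, hS4⟩ : ∃ S : M × (Fin n → ℝ) → Prop, (∀ᶠ q in 𝓝 (p, (0 : Fin n → ℝ)), S q) ∧
      ∀ q r, S q → S r →
      ‖κ (frameExp U X q.1 q.2) - κ (frameExp U X r.1 r.2) - (κ q.1 - κ r.1) - (q.2 - r.2)‖ ≤
        1 / 4 * (‖κ q.1 - κ r.1‖ + ‖q.2 - r.2‖) := by
    obtain ⟨pa, ha, pb, hb, hab⟩ := eventually_prod_iff.1 e4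
    exact ⟨fun q => pa q ∧ pb q, ha.and hb, fun q r hq hr => hab hq.1 hr.2⟩
  obtain ⟨N, hN, T, hT, hNT⟩ : ∃ N ∈ 𝓝 p, ∃ T ∈ 𝓝 (0 : Fin n → ℝ), ∀ x ∈ N, ∀ a ∈ T,
      S (x, a) ∧ IsExp U (combination X a) x (frameExp U X x a) ∧
      frameExp U X x a ∈ κ.source ∧ dist (frameExp U X x a) x ≤ 1 := by
    have e6 := hS.and (e1.and (e2.and e3))
    rw [nhds_prod_eq, eventually_prod_iff] at e6
    obtain ⟨pa, ha, pb, hb, hab⟩ := e6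
    exact ⟨_, ha, _, hb, fun x hx a ha => hab hx ha⟩
  obtain ⟨s, hs0, hsT⟩ := Metric.mem_nhds_iff.1 hT
  set N' := interior (N ∩ κ.source) with hN'
  have hN'N : N' ⊆ N ∩ κ.source := interior_subset
  have hN'o : IsOpen N' := isOpen_interior
  have hin : ∀ x ∈ N', ∀ a, ‖a‖ < s → S (x, a) ∧
      IsExp U (combination X a) x (frameExp U X x a) ∧
      frameExp U X x a ∈ κ.source ∧ dist (frameExp U X x a) x ≤ 1 := fun x hx a ha =>
    hNT x (hN'N hx).1 a (hsT (by simpa using ha))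
  have hest : ∀ x ∈ N', ∀ y ∈ N', ∀ a b : Fin n → ℝ, ‖a‖ < s → ‖b‖ < s →
      ‖κ (frameExp U X x a) - κ (frameExp U X y b) - (κ x - κ y) - (a - b)‖ ≤
        1 / 4 * (‖κ x - κ y‖ + ‖a - b‖) := fun x hx y hy a b ha hb =>
    hS4 (x, a) (y, b) (hin x hx a ha).1 (hin y hy b hb).1
  have hsrc : ∀ x ∈ N', ∀ a, ‖a‖ < s → frameExp U X x a ∈ κ.source := fun x hx a ha =>
    (hin x hx a ha).2.2.1
  have hnear : ∀ x ∈ N', ∀ a : Fin n → ℝ, ‖a‖ < s →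
      ∀ᶠ q : M × (Fin n → ℝ) in 𝓝 (x, a), q.1 ∈ N' ∧ ‖q.2‖ < s := by
    intro x hx a ha
    rw [nhds_prod_eq]
    have : {b : Fin n → ℝ | ‖b‖ < s} ∈ 𝓝 a :=
      (isOpen_lt continuous_norm continuous_const).mem_nhds ha
    exact prod_mem_prod (hN'o.mem_nhds hx) this
  refine ⟨N', interior_mem_nhds.2 (inter_mem hN hs), s, hs0, fun x hx => ⟨?_, ?_, ?_, ?_, ?_⟩⟩
  · exact fun a ha => (hin x hx a ha).2.1
  · intro a ha b hb hab
    have h1 := hest x hx x hx a b (by simpa using ha) (by simpa using hb)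
    rw [hab] at h1
    simp only [sub_self, zero_sub, norm_neg, norm_zero, zero_add] at h1
    have h2 : ‖a - b‖ = 0 := by linarith [norm_nonneg (a - b)]
    exact sub_eq_zero.1 (norm_eq_zero.1 h2)
  · intro a ha
    have hκc : Tendsto (fun q : M × (Fin n → ℝ) => κ (frameExp U X q.1 q.2)) (𝓝 (x, a))
        (𝓝 (κ (frameExp U X x a))) := by
      rw [tendsto_iff_norm_sub_tendsto_zero]
      have c1 : Tendsto (fun q : M × (Fin n → ℝ) => 5 / 4 * (‖κ q.1 - κ x‖ + ‖q.2 - a‖))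
          (𝓝 (x, a)) (𝓝 (5 / 4 * (‖κ x - κ x‖ + ‖a - a‖))) := by
        have k1 : Tendsto (fun q : M × (Fin n → ℝ) => κ q.1) (𝓝 (x, a)) (𝓝 (κ x)) :=
          Tendsto.comp (κ.continuousAt (hN'N hx).2) (continuousAt_fst (p := (x, a)))
        have k2 : Tendsto (fun q : M × (Fin n → ℝ) => q.2) (𝓝 (x, a)) (𝓝 a) :=
          (continuousAt_snd (p := (x, a))).tendsto
        exact (((k1.sub_const _).norm).add ((k2.sub_const _).norm)).const_mul _
      simp only [sub_self, norm_zero, add_zero, mul_zero] at c1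
      refine squeeze_zero' (Eventually.of_forall fun _ => norm_nonneg _) ?_ c1
      filter_upwards [hnear x hx a ha] with q hq
      have h1 := hest q.1 hq.1 x hx q.2 a hq.2 ha
      have h2 : κ (frameExp U X q.1 q.2) - κ (frameExp U X x a) =
        (κ (frameExp U X q.1 q.2) - κ (frameExp U X x a) - (κ q.1 - κ x) - (q.2 - a)) +
          (κ q.1 - κ x) + (q.2 - a) := by abel
      rw [h2]
      refine norm_add₃_le.trans ?_
      linarith
    have h1 := Tendsto.comp (κ.continuousAt_symm (κ.map_source (hsrc x hx a ha))) hκc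
    rw [κ.left_inv (hsrc x hx a ha)] at h1
    refine h1.congr' ?_
    filter_upwards [hnear x hx a ha] with q hq
    exact κ.left_inv (hsrc q.1 hq.1 q.2 hq.2)
  · intro a ha
    -- in coordinates the map is a perturbation of the identity, up to a shear
    set G : (Fin n → ℝ) × (Fin n → ℝ) → (Fin n → ℝ) × (Fin n → ℝ) :=
      fun q => (q.1, κ (frameExp U X (κ.symm q.1) q.2) - q.1) with hG
    set S' : Set ((Fin n → ℝ) × (Fin n → ℝ)) :=
      (κ.target ∩ κ.symm ⁻¹' N') ×ˢ Metric.ball 0 s with hS'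
    have hS'm : S' ∈ 𝓝 (κ x, a) := by
      refine prod_mem_nhds (inter_mem ?_ ?_) (Metric.isOpen_ball.mem_nhds (by simpa using ha))
      · exact κ.open_target.mem_nhds (κ.map_source (hN'N hx).2)
      · refine (κ.continuousAt_symm (κ.map_source (hN'N hx).2)).preimage_mem_nhds ?_
        rw [κ.left_inv (hN'N hx).2]
        exact hN'o.mem_nhds hx
    have happ : ApproximatesLinearOn G
        (ContinuousLinearMap.id ℝ ((Fin n → ℝ) × (Fin n → ℝ))) S' (1 / 2) := by
      rintro ⟨ξ, b⟩ ⟨⟨hξ, hξN⟩, hb⟩ ⟨ζ, c⟩ ⟨⟨hζ, hζN⟩, hc⟩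
      have h1 := hest _ hξN _ hζN b c (by simpa using hb) (by simpa using hc)
      rw [κ.right_inv hξ, κ.right_inv hζ] at h1
      have h2 : G (ξ, b) - G (ζ, c) - ((ξ, b) - (ζ, c)) = (0,
          κ (frameExp U X (κ.symm ξ) b) - κ (frameExp U X (κ.symm ζ) c) - (ξ - ζ) - (b - c)) := by
        simp only [hG, Prod.mk_sub_mk, Prod.mk.injEq]
        constructor <;> abel
      change ‖G (ξ, b) - G (ζ, c) - ((ξ, b) - (ζ, c))‖ ≤ _
      rw [h2, Prod.norm_mk, norm_zero, max_eq_right (norm_nonneg _)]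
      refine h1.trans ?_
      have h3 : ‖ξ - ζ‖ ≤ ‖(ξ, b) - (ζ, c)‖ := norm_fst_le ((ξ, b) - (ζ, c))
      have h4 : ‖b - c‖ ≤ ‖(ξ, b) - (ζ, c)‖ := norm_snd_le ((ξ, b) - (ζ, c))
      push_cast
      linarith
    have hGmap : map G (𝓝 (κ x, a)) = 𝓝 (G (κ x, a)) := by
      refine happ.map_nhds_eq ⟨id, 1, fun y => by simp, fun y => rfl⟩ hS'm (Or.inr ?_)
      rw [inv_one]
      exact NNReal.half_lt_self one_ne_zero
    have hκmap : map (fun q : M × (Fin n → ℝ) => (κ q.1, q.2)) (𝓝 (x, a)) = 𝓝 (κ x, a) :=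
      (κ.prod (OpenPartialHomeomorph.refl (Fin n → ℝ))).map_nhds_eq (x := (x, a))
        ⟨(hN'N hx).2, mem_univ _⟩
    have hshear := (Homeomorph.shearAddRight (Fin n → ℝ)).map_nhds_eq (G (κ x, a))
    have hval : (Homeomorph.shearAddRight (Fin n → ℝ)) (G (κ x, a)) =
        (κ x, κ (frameExp U X x a)) := by
      simp [hG, κ.left_inv (hN'N hx).2]
    have hsymm : map (fun q : (Fin n → ℝ) × (Fin n → ℝ) => (κ.symm q.1, κ.symm q.2))
        (𝓝 (κ x, κ (frameExp U X x a))) = 𝓝 (x, frameExp U X x a) := by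
      have := (κ.symm.prod κ.symm).map_nhds_eq (x := (κ x, κ (frameExp U X x a)))
        ⟨κ.map_source (hN'N hx).2, κ.map_source (hsrc x hx a ha)⟩
      refine this.trans ?_
      change 𝓝 (κ.symm (κ x), κ.symm (κ (frameExp U X x a))) = _
      rw [κ.left_inv (hN'N hx).2, κ.left_inv (hsrc x hx a ha)]
    rw [hval] at hshear
    rw [← hsymm, ← hshear, ← hGmap, ← hκmap, map_map, map_map, map_map]
    refine (Filter.map_congr ?_).le
    filter_upwards [hnear x hx a ha] with q hq
    simp [hG, κ.left_inv (hN'N hq.1).2, κ.left_inv (hsrc q.1 hq.1 q.2 hq.2)]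
  · exact fun a ha => (hin x hx a ha).2.2.2

/-- There is a continuous choice of radii. -/
theorem IsFrameSystem.exists_isGoodRadius {g : M → (Fin n → ℝ) → ℝ} (h : IsFrameSystem U X g) :
    ∃ σ : M → ℝ, IsGoodRadius U X σ := by
  -- Every smaller positive radius is good as well, so the good radii at a point form a convex set,
  -- and locally constant choices can be glued by a partition of unity.
  obtain ⟨f, hf⟩ := exists_continuous_forall_mem_convex_of_local_const (X := U) (E := ℝ)
    (t := fun x => {s | 0 < s ∧ IsGoodRadiusAt U X x.1 s}) (fun x => by
      refine OrdConnected.convex ⟨fun s hs t ht r hr => ⟨lt_of_lt_of_le hs.1 hr.1, IsGoodRadiusAt.mono ht.2 hr.2⟩⟩)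
    (fun x => by
      obtain ⟨κ, hκ⟩ := h.chart x.1 x.2
      obtain ⟨N, hN, s, hs, hgood⟩ := hκ.exists_isGoodRadiusAt
      exact ⟨s, mem_of_superset (continuous_subtype_val.continuousAt.preimage_mem_nhds hN)
        fun y hy => ⟨hs, hgood _ hy⟩⟩)
  classical
  refine ⟨fun x => if hx : x ∈ U then f ⟨x, hx⟩ else 1, ?_, fun x hx => ?_, fun x hx => ?_⟩
  · rw [continuousOn_iff_continuous_domRestrict]
    convert f.continuous using 1
    ext x
    simp
  · simp only [hx, dif_pos]
    exact (hf ⟨x, hx⟩).1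
  · simp only [hx, dif_pos]
    exact (hf ⟨x, hx⟩).2

theorem IsGoodRadius.mono {ρ σ : M → ℝ} (h : IsGoodRadius U X σ) (hρ : ContinuousOn ρ U)
    (hρσ : ∀ x ∈ U, 0 < ρ x ∧ ρ x ≤ σ x) : IsGoodRadius U X ρ where
  continuousOn := hρ
  pos x hx := (hρσ x hx).1
  good x hx := (h.good x hx).mono (hρσ x hx).2

end Radius

/-! ### Joint continuity of the exponential map and of its inverse -/

section Log

variable {n : ℕ} {M : Type*} [MetricSpace M]
    [ChartedSpace (EuclideanSpace ℝ (Fin n)) M]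
    {U : Set M} {X : Fin n → VField n M} {ρ : M → ℝ}

theorem IsGoodRadius.frameLog_frameExp (hρ : IsGoodRadius U X ρ) {x : M} (hx : x ∈ U)
    {a : Fin n → ℝ} (ha : ‖a‖ < ρ x) : frameLog U X ρ x (frameExp U X x a) = a :=
  (hρ.good x hx).injOn.leftInvOn_invFunOn (by simpa using ha)

theorem IsGoodRadius.frameExp_inj (hρ : IsGoodRadius U X ρ) {x : M} (hx : x ∈ U)
    {a b : Fin n → ℝ} (ha : ‖a‖ < ρ x) (hb : ‖b‖ < ρ x)
    (h : frameExp U X x a = frameExp U X x b) : a = b :=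
  (hρ.good x hx).injOn (by simpa using ha) (by simpa using hb) h

variable {ι : Type*} {l : Filter ι}

theorem IsGoodRadius.tendsto_frameExp (hρ : IsGoodRadius U X ρ) {x₀ : M} (hx₀ : x₀ ∈ U)
    {a₀ : Fin n → ℝ} (ha₀ : ‖a₀‖ < ρ x₀) {x : ι → M} {a : ι → Fin n → ℝ}
    (hx : Tendsto x l (𝓝 x₀)) (ha : Tendsto a l (𝓝 a₀)) :
    Tendsto (fun i => frameExp U X (x i) (a i)) l (𝓝 (frameExp U X x₀ a₀)) := by
  have h := Tendsto.comp ((hρ.good x₀ hx₀).continuousAt a₀ ha₀) (hx.prodMk_nhds ha)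
  exact h

theorem IsGoodRadius.eventually_lt (hρ : IsGoodRadius U X ρ) (hU : IsOpen U) {x₀ : M}
    (hx₀ : x₀ ∈ U) {a₀ : Fin n → ℝ} (ha₀ : ‖a₀‖ < ρ x₀) {x : ι → M} {a : ι → Fin n → ℝ}
    (hx : Tendsto x l (𝓝 x₀)) (ha : Tendsto a l (𝓝 a₀)) : ∀ᶠ i in l, ‖a i‖ < ρ (x i) :=
  Tendsto.eventually_lt ha.norm
    ((hρ.continuousOn.continuousAt (hU.mem_nhds hx₀)).tendsto.comp hx) ha₀

theorem IsGoodRadius.tendsto_frameLog (hρ : IsGoodRadius U X ρ) (hU : IsOpen U) {x₀ : M}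
    (hx₀ : x₀ ∈ U) {a₀ : Fin n → ℝ} (ha₀ : ‖a₀‖ < ρ x₀) {x u : ι → M}
    (hx : Tendsto x l (𝓝 x₀)) (hu : Tendsto u l (𝓝 (frameExp U X x₀ a₀))) :
    Tendsto (fun i => frameLog U X ρ (x i) (u i)) l (𝓝 a₀) ∧
    ∀ᶠ i in l, x i ∈ U ∧ ‖frameLog U X ρ (x i) (u i)‖ < ρ (x i) ∧
      frameExp U X (x i) (frameLog U X ρ (x i) (u i)) = u i := by
  have key : ∀ W ∈ 𝓝 a₀, ∀ᶠ i in l, ∃ a ∈ W, x i ∈ U ∧ ‖a‖ < ρ (x i) ∧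
      frameExp U X (x i) a = u i := by
    intro W hW
    have h1 : ∀ᶠ q : M × (Fin n → ℝ) in 𝓝 (x₀, a₀), q.2 ∈ W ∧ q.1 ∈ U ∧ ‖q.2‖ < ρ q.1 := by
      have c1 : Tendsto (fun q : M × (Fin n → ℝ) => q.1) (𝓝 (x₀, a₀)) (𝓝 x₀) := continuousAt_fst
      have c2 : Tendsto (fun q : M × (Fin n → ℝ) => q.2) (𝓝 (x₀, a₀)) (𝓝 a₀) := continuousAt_snd
      filter_upwards [c2.eventually hW, c1.eventually (hU.mem_nhds hx₀),
        hρ.eventually_lt hU hx₀ ha₀ c1 c2] with q h1 h2 h3 using ⟨h1, h2, h3⟩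
    have h2 : ∀ᶠ z : M × M in 𝓝 (x₀, frameExp U X x₀ a₀), ∃ q : M × (Fin n → ℝ),
        (q.2 ∈ W ∧ q.1 ∈ U ∧ ‖q.2‖ < ρ q.1) ∧ q.1 = z.1 ∧ frameExp U X q.1 q.2 = z.2 := by
      refine Filter.Eventually.filter_mono ((hρ.good x₀ hx₀).nhds_le a₀ ha₀)
        (Filter.eventually_map.2 (h1.mono fun q hq => ?_))
      exact ⟨q, hq, rfl, rfl⟩
    filter_upwards [(hx.prodMk_nhds hu).eventually h2] with i hi
    obtain ⟨q, ⟨haW, hyU, haρ⟩, hq, heq⟩ := hi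
    rw [hq] at hyU haρ heq
    exact ⟨q.2, haW, hyU, haρ, heq⟩
  constructor
  · intro W hW
    rw [Filter.mem_map]
    filter_upwards [key W hW] with i hi
    obtain ⟨a, haW, hxU, ha, heq⟩ := hi
    rw [mem_preimage, ← heq, hρ.frameLog_frameExp hxU ha]
    exact haW
  · filter_upwards [key univ univ_mem] with i hi
    obtain ⟨a, -, hxU, ha, heq⟩ := hi
    rw [← heq, hρ.frameLog_frameExp hxU ha]
    exact ⟨hxU, ha, rfl⟩

end Log

/-! ### Continuous convergence and uniform convergence on compact sets -/

section ContinuousConvergence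

variable {ι Q Y : Type*} [TopologicalSpace Q] [PseudoMetricSpace Y] {l : Filter ι}

theorem tendsto_left_of_tendsto_prod {β : Type*} {m : Filter β} {F : ι × Q → β} {q : Q}
    (h : Tendsto F (l ×ˢ 𝓝 q) m) : Tendsto (fun i => F (i, q)) l m :=
  h.comp (tendsto_id.prodMk (tendsto_const_nhds (x := q)))

/-- The limit of a continuously convergent family of functions is continuous. -/
theorem continuousWithinAt_of_tendsto_prod [l.NeBot] {F : ι × Q → Y} {f : Q → Y} {C : Set Q}
    {q : Q} (hq : Tendsto F (l ×ˢ 𝓝 q) (𝓝 (f q)))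
    (h : ∀ᶠ q' in 𝓝[C] q, Tendsto F (l ×ˢ 𝓝 q') (𝓝 (f q'))) : ContinuousWithinAt f C q := by
  refine Metric.tendsto_nhds.2 fun η hη => ?_
  obtain ⟨pa, ha, pb, hb, hab⟩ :=
    eventually_prod_iff.1 (Metric.tendsto_nhds.1 hq (η / 2) (half_pos hη))
  filter_upwards [h, nhdsWithin_le_nhds hb] with q' hq' hb'
  have h1 := Metric.tendsto_nhds.1 (tendsto_left_of_tendsto_prod hq') (η / 2) (half_pos hη)
  obtain ⟨i, hi, hi'⟩ := (h1.and ha).exists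
  have h2 := hab hi' hb'
  have h3 := dist_triangle_left (f q') (f q) (F (i, q'))
  linarith

/-- The form of the compactness argument needed for statements without a limit, such as that an
expression is defined for all small `ε`. -/
theorem IsCompact.eventually_forall_of_eventually_prod {C : Set Q} (hC : IsCompact C)
    {p : ι × Q → Prop} (h : ∀ q ∈ C, ∀ᶠ z in l ×ˢ 𝓝 q, p z) : ∀ᶠ i in l, ∀ q ∈ C, p (i, q) := by
  refine hC.induction_on (p := fun D => ∀ᶠ i in l, ∀ q ∈ D, p (i, q)) (by simp) ?_ ?_ ?_
  · exact fun s t hst ht => ht.mono fun i hi q hq => hi q (hst hq)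
  · intro s t hs ht
    filter_upwards [hs, ht] with i h1 h2 q hq
    exact hq.elim (h1 q) (h2 q)
  · intro q hq
    obtain ⟨pa, ha, pb, hb, hab⟩ := eventually_prod_iff.1 (h q hq)
    exact ⟨{q' | pb q'}, nhdsWithin_le_nhds hb, ha.mono fun i hi q' hq' => hab hi hq'⟩

/-- Continuous convergence on a compact set is uniform. -/
theorem IsCompact.eventually_dist_lt_of_tendsto_prod [l.NeBot] {F : ι × Q → Y} {f : Q → Y}
    {C : Set Q} (hC : IsCompact C) (h : ∀ q ∈ C, Tendsto F (l ×ˢ 𝓝 q) (𝓝 (f q))) {η : ℝ}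
    (hη : 0 < η) : ∀ᶠ i in l, ∀ q ∈ C, dist (F (i, q)) (f q) < η := by
  have h1 : ∀ q ∈ C, ∀ᶠ z in l ×ˢ 𝓝 q, z.2 ∈ C → dist (F z) (f z.2) < η := by
    intro q hq
    have hc : ContinuousWithinAt f C q := continuousWithinAt_of_tendsto_prod (h q hq)
      (eventually_mem_nhdsWithin.mono h)
    have h2 := Metric.tendsto_nhds.1 (h q hq) (η / 2) (half_pos hη)
    have h3 := eventually_nhdsWithin_iff.1 (Metric.tendsto_nhds.1 hc (η / 2) (half_pos hη))
    filter_upwards [h2, tendsto_snd.eventually h3] with z hz hz' hzC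
    have h4 := hz' hzC
    have h5 := dist_triangle_right (F z) (f z.2) (f q)
    linarith
  exact (IsCompact.eventually_forall_of_eventually_prod hC h1).mono fun i hi q hq => hi q hq hq

theorem eventually_nhdsGT_zero_iff {p : ℝ → Prop} :
    (∀ᶠ ε in 𝓝[>] (0 : ℝ), p ε) ↔ ∃ ε₀ > 0, ∀ ε, 0 < ε → ε < ε₀ → p ε := by
  constructor
  · intro h
    obtain ⟨ε₀, h0, h1⟩ := mem_nhdsGT_iff_exists_Ioo_subset.1 h
    exact ⟨ε₀, h0, fun ε h2 h3 => h1 ⟨h2, h3⟩⟩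
  · rintro ⟨ε₀, h0, h⟩
    filter_upwards [Ioo_mem_nhdsGT h0] with ε hε using h ε hε.1 hε.2

end ContinuousConvergence

/-! ### Uniform neighbourhoods of the diagonal over a compact set -/

section Tube

variable {M : Type*} [MetricSpace M]

/-- The points `(x, u, v)` with `x ∈ K` and `u, v` at distance at most `R` of `x`. -/
def tube (K : Set M) (R : ℝ) : Set (M × M × M) :=
  {q | q.1 ∈ K ∧ dist q.2.1 q.1 ≤ R ∧ dist q.2.2 q.1 ≤ R}

/-- The diagonal over `K` is compact, so an open set which contains it contains a thickening of it
of fixed radius. Local compactness makes the resulting tube compact. -/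
theorem IsCompact.exists_tube [LocallyCompactSpace M] {K U : Set M} (hK : IsCompact K)
    (hU : IsOpen U) (hKU : K ⊆ U) {p : M × M × M → Prop}
    (hp : ∀ x ∈ K, ∀ᶠ q in 𝓝 (x, x, x), p q) :
    ∃ R > 0, IsCompact (tube K R) ∧ (∀ x ∈ K, IsCompact (Metric.closedBall x R)) ∧
      (∀ x ∈ K, Metric.closedBall x R ⊆ U) ∧ ∀ q ∈ tube K R, p q := by
  obtain ⟨r₀, hr₀, hcpt⟩ := hK.exists_isCompact_cthickening
  obtain ⟨r₁, hr₁, hsub⟩ := hK.exists_cthickening_subset_open hU hKU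
  have hdiag : IsCompact ((fun x : M => (x, x, x)) '' K) := hK.image (by fun_prop)
  obtain ⟨r₂, hr₂, hth⟩ := hdiag.exists_thickening_subset_open
    (isOpen_setOfPred_eventually_nhds (p := p)) (by rintro _ ⟨x, hx, rfl⟩; exact hp x hx)
  set R := min (min r₀ r₁) (r₂ / 2) with hR
  have hR0 : 0 < R := by positivity
  have hRr₀ : R ≤ r₀ := (min_le_left _ _).trans (min_le_left _ _)
  have hRr₁ : R ≤ r₁ := (min_le_left _ _).trans (min_le_right _ _)
  have hRr₂ : R < r₂ := (min_le_right _ _).trans_lt (by linarith)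
  refine ⟨R, hR0, ?_, fun x hx => ?_, fun x hx => ?_, ?_⟩
  · refine (hK.prod (hcpt.prod hcpt)).of_isClosed_subset ?_ ?_
    · refine (hK.isClosed.preimage continuous_fst).inter (IsClosed.inter ?_ ?_)
      · exact isClosed_le (continuous_snd.fst.dist continuous_fst) continuous_const
      · exact isClosed_le (continuous_snd.snd.dist continuous_fst) continuous_const
    · rintro ⟨x, u, v⟩ ⟨hx, hu, hv⟩
      exact ⟨hx, Metric.mem_cthickening_of_dist_le u x _ _ hx (le_trans hu hRr₀),
        Metric.mem_cthickening_of_dist_le v x _ _ hx (le_trans hv hRr₀)⟩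
  · refine hcpt.of_isClosed_subset Metric.isClosed_closedBall fun u hu => ?_
    exact Metric.mem_cthickening_of_dist_le u x _ _ hx (le_trans hu hRr₀)
  · intro u hu
    exact hsub (Metric.mem_cthickening_of_dist_le u x _ _ hx (le_trans hu hRr₁))
  · rintro ⟨x, u, v⟩ ⟨hx, hu, hv⟩
    have h1 : (x, u, v) ∈ Metric.thickening r₂ ((fun x : M => (x, x, x)) '' K) := by
      refine Metric.mem_thickening_iff.2 ⟨(x, x, x), ⟨x, hx, rfl⟩, ?_⟩
      rw [Prod.dist_eq, Prod.dist_eq, dist_self]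
      exact max_lt hr₂ (max_lt (lt_of_le_of_lt hu hRr₂) (lt_of_le_of_lt hv hRr₂))
    have h2 : ∀ᶠ q in 𝓝 (x, u, v), p q := hth h1
    exact h2.self_of_nhds

theorem mem_tube {K : Set M} {R : ℝ} {x u v : M} (hx : x ∈ K) (hu : u ∈ Metric.closedBall x R)
    (hv : v ∈ Metric.closedBall x R) : (x, u, v) ∈ tube K R :=
  ⟨hx, hu, hv⟩

/-- A criterion for uniform convergence near the base points. -/
theorem uniformLimitNear_of_tendsto [LocallyCompactSpace M] {U : Set M} (hU : IsOpen U)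
    {F : ℝ → M → M → M → M} {L : M → M → M → M} (hL : ∀ x ∈ U, ∀ u v, L x u v ∈ U)
    (h : ∀ p ∈ U, ∀ᶠ q : M × M × M in 𝓝 (p, p, p),
      Tendsto (fun z : ℝ × M × M × M => F z.1 z.2.1 z.2.2.1 z.2.2.2) (𝓝[>] 0 ×ˢ 𝓝 q)
        (𝓝 (L q.1 q.2.1 q.2.2))) :
    UniformLimitNear U F L := by
  intro K hKU hK
  obtain ⟨R, hR, hcpt, -, hRU, ht⟩ := IsCompact.exists_tube hK hU hKU fun x hx => h x (hKU hx)
  refine ⟨R, hR, hRU, fun x hx u _ v _ => hL x (hKU hx) u v, fun η hη => ?_⟩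
  obtain ⟨ε₀, h0, h1⟩ := eventually_nhdsGT_zero_iff.1
    (IsCompact.eventually_dist_lt_of_tendsto_prod hcpt (f := fun q => L q.1 q.2.1 q.2.2) ht hη)
  exact ⟨ε₀, h0, fun ε h2 h3 x hx u hu v hv => h1 ε h2 h3 (x, u, v) (mem_tube hx hu hv)⟩

end Tube

open Asymptotics

/-! ### Norms on coordinate space given by their axioms -/

section Norm

variable {n : ℕ} {f : (Fin n → ℝ) → ℝ}

/-- The norms `g p` of a frame system are plain functions with subadditivity and homogeneity; their
equivalence with the supremum norm is derived from these axioms here and below. -/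
theorem exists_le_mul_norm (hadd : ∀ v w, f (v + w) ≤ f v + f w)
    (hsmul : ∀ (s : ℝ) v, f (s • v) = |s| * f v) : ∃ C > 0, ∀ v, f v ≤ C * ‖v‖ := by
  have h0 : f 0 = 0 := by simpa using hsmul 0 0
  have hnonneg : ∀ v, 0 ≤ f v := fun v => by
    have h1 := hadd v ((-1 : ℝ) • v)
    rw [hsmul] at h1
    simp only [neg_smul, one_smul, add_neg_cancel, h0, abs_neg, abs_one, one_mul] at h1
    linarith
  refine ⟨(∑ i, f (Pi.single i 1)) + 1, ?_, fun v => ?_⟩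
  · have := Finset.sum_nonneg fun i (_ : i ∈ Finset.univ) => hnonneg (Pi.single i (1 : ℝ))
    linarith
  · have h1 : f v ≤ ∑ i, f (v i • Pi.single i (1 : ℝ)) := by
      have h2 : v = ∑ i, v i • Pi.single i (1 : ℝ) := pi_eq_sum_univ' v
      conv_lhs => rw [h2]
      exact Finset.le_sum_of_subadditive f h0.le hadd _ _
    refine h1.trans ?_
    calc ∑ i, f (v i • Pi.single i (1 : ℝ)) ≤ ∑ i, ‖v‖ * f (Pi.single i 1) := by
          refine Finset.sum_le_sum fun i _ => ?_
          rw [hsmul]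
          exact mul_le_mul_of_nonneg_right (norm_le_pi_norm v i) (hnonneg _)
      _ = ‖v‖ * ∑ i, f (Pi.single i 1) := by rw [Finset.mul_sum]
      _ ≤ ((∑ i, f (Pi.single i 1)) + 1) * ‖v‖ := by nlinarith [norm_nonneg v]

theorem continuous_of_subadditive (hadd : ∀ v w, f (v + w) ≤ f v + f w)
    (hsmul : ∀ (s : ℝ) v, f (s • v) = |s| * f v) : Continuous f := by
  obtain ⟨C, hC, hle⟩ := exists_le_mul_norm hadd hsmul
  refine (LipschitzWith.of_le_add_mul ⟨C, hC.le⟩ fun v w => ?_).continuous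
  have h1 := hadd w (v - w)
  rw [add_sub_cancel] at h1
  refine h1.trans (add_le_add_right ?_ _)
  rw [dist_eq_norm]
  exact hle _

theorem exists_mul_norm_le (hadd : ∀ v w, f (v + w) ≤ f v + f w)
    (hsmul : ∀ (s : ℝ) v, f (s • v) = |s| * f v) (hpos : ∀ v, v ≠ 0 → 0 < f v) :
    ∃ c > 0, ∀ v, c * ‖v‖ ≤ f v := by
  have hc := continuous_of_subadditive hadd hsmul
  have h0 : f 0 = 0 := by simpa using hsmul 0 0
  by_cases hne : (Metric.sphere (0 : Fin n → ℝ) 1).Nonempty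
  · obtain ⟨w, hw, hmin⟩ := (isCompact_sphere (0 : Fin n → ℝ) 1).exists_isMinOn hne hc.continuousOn
    have hw1 : ‖w‖ = 1 := by simpa using hw
    refine ⟨f w, hpos w (norm_ne_zero_iff.1 (by rw [hw1]; exact one_ne_zero)), fun v => ?_⟩
    rcases eq_or_ne v 0 with rfl | hv
    · simp [h0]
    · have hv' : ‖v‖ ≠ 0 := norm_ne_zero_iff.2 hv
      have h1 : f w ≤ f (‖v‖⁻¹ • v) := isMinOn_iff.1 hmin _ (by
        rw [mem_sphere_zero_iff_norm, norm_smul, norm_inv, norm_norm, inv_mul_cancel₀ hv'])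
      rw [hsmul, abs_inv, abs_norm] at h1
      calc f w * ‖v‖ ≤ ‖v‖⁻¹ * f v * ‖v‖ := by gcongr
        _ = f v := by field_simp
  -- The unit sphere is empty, so every vector is zero and any constant will do.
  · refine ⟨1, one_pos, fun v => ?_⟩
    rcases eq_or_ne v 0 with rfl | hv
    · simp [h0]
    · refine absurd ⟨‖v‖⁻¹ • v, ?_⟩ hne
      rw [mem_sphere_zero_iff_norm, norm_smul, norm_inv, norm_norm,
        inv_mul_cancel₀ (norm_ne_zero_iff.2 hv)]

end Norm

/-! ### First order calculus of exponentials, logarithms and distances -/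

section Infinitesimal

set_option linter.unusedSectionVars false

variable {n : ℕ} {M : Type*} [MetricSpace M]
    [ChartedSpace (EuclideanSpace ℝ (Fin n)) M] [IsManifold (𝓡 n) ∞ M]
    {U : Set M} {X : Fin n → VField n M} {g : M → (Fin n → ℝ) → ℝ} {ρ : M → ℝ}
    {ι : Type*} {l : Filter ι}

theorem IsFrameSystem.frameExp_zero (h : IsFrameSystem U X g) {x : M} (hx : x ∈ U) :
    frameExp U X x 0 = x :=
  SubRiem.frameExp_zero h.isOpen h.smooth hx

theorem IsFrameSystem.continuous (h : IsFrameSystem U X g) {p : M} (hp : p ∈ U) :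
    Continuous (g p) :=
  continuous_of_subadditive (h.norm_add_le p hp) (h.norm_smul p hp)

theorem IsFrameSystem.eventually_mem (h : IsFrameSystem U X g) {p : M} (hp : p ∈ U) {x : ι → M}
    (hx : Tendsto x l (𝓝 p)) : ∀ᶠ i in l, x i ∈ U :=
  hx.eventually (h.isOpen.mem_nhds hp)

/-- The strict estimate for two displacements with the same base point, where the terms containing
the base points cancel. -/
theorem IsFrameChart.isEquivalent_frameExp {κ : OpenPartialHomeomorph M (Fin n → ℝ)}
    {f : (Fin n → ℝ) → ℝ} {p : M} (hκ : IsFrameChart U X f p κ) {x : ι → M}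
    {A B : ι → Fin n → ℝ} (hx : Tendsto x l (𝓝 p)) (hA : Tendsto A l (𝓝 0))
    (hB : Tendsto B l (𝓝 0)) :
    (fun i => κ (frameExp U X (x i) (A i)) - κ (frameExp U X (x i) (B i))) ~[l]
      fun i => A i - B i := by
  refine isLittleO_iff.2 fun η hη => ?_
  filter_upwards [((hx.prodMk_nhds hA).prodMk_nhds (hx.prodMk_nhds hB)).eventually
    (hκ.strict η hη)] with i hi
  simpa using hi

/-- The logarithm is the difference of the coordinates, to first order. -/
theorem IsFrameChart.isEquivalent_frameLog (h : IsFrameSystem U X g) (hρ : IsGoodRadius U X ρ)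
    {κ : OpenPartialHomeomorph M (Fin n → ℝ)} {p : M} (hp : p ∈ U)
    {f : (Fin n → ℝ) → ℝ} (hκ : IsFrameChart U X f p κ) {y z : ι → M}
    (hy : Tendsto y l (𝓝 p)) (hz : Tendsto z l (𝓝 p)) :
    (fun i => κ (z i) - κ (y i)) ~[l] fun i => frameLog U X ρ (y i) (z i) := by
  have hz' : Tendsto z l (𝓝 (frameExp U X p 0)) := by rwa [h.frameExp_zero hp]
  obtain ⟨h1, h2⟩ := hρ.tendsto_frameLog h.isOpen hp (by simpa using hρ.pos p hp) hy hz'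
  have h3 := hκ.isEquivalent_frameExp hy h1 (tendsto_const_nhds (x := (0 : Fin n → ℝ)))
  refine (h3.congr_left ?_).congr_right ?_
  · filter_upwards [h2] with i hi
    rw [hi.2.2, h.frameExp_zero hi.1]
  · exact Eventually.of_forall fun i => sub_zero _

/-- Both sides are equivalent to the same difference of `κ`-coordinates: the exponential from `x`
and the exponential from `exp A` are both translations to first order. -/
theorem IsGoodRadius.isEquivalent_frameLog (hρ : IsGoodRadius U X ρ) (h : IsFrameSystem U X g)
    {p : M} (hp : p ∈ U) {x : ι → M} {A B : ι → Fin n → ℝ} (hx : Tendsto x l (𝓝 p))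
    (hA : Tendsto A l (𝓝 0)) (hB : Tendsto B l (𝓝 0)) :
    (fun i => B i - A i) ~[l]
      fun i => frameLog U X ρ (frameExp U X (x i) (A i)) (frameExp U X (x i) (B i)) := by
  obtain ⟨κ, hκ⟩ := h.chart p hp
  have hp0 : ‖(0 : Fin n → ℝ)‖ < ρ p := by simpa using hρ.pos p hp
  have e1 := hρ.tendsto_frameExp hp hp0 hx hA
  have e2 := hρ.tendsto_frameExp hp hp0 hx hB
  rw [h.frameExp_zero hp] at e1 e2
  exact (hκ.isEquivalent_frameExp hx hB hA).symm.trans (hκ.isEquivalent_frameLog h hρ hp e1 e2)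

theorem tendsto_zero_of_inv_smul {ε : ι → ℝ} (hε : Tendsto ε l (𝓝[>] 0)) {A : ι → Fin n → ℝ}
    {a : Fin n → ℝ} (hA : Tendsto (fun i => (ε i)⁻¹ • A i) l (𝓝 a)) : Tendsto A l (𝓝 0) := by
  have h1 := (tendsto_nhds_of_tendsto_nhdsWithin hε).smul hA
  rw [zero_smul] at h1
  refine h1.congr' ?_
  filter_upwards [hε.eventually self_mem_nhdsWithin] with i hi
  exact smul_inv_smul₀ (ne_of_gt hi) _

theorem _root_.Asymptotics.IsEquivalent.tendsto_inv_smul {E : Type*} [NormedAddCommGroup E]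
    [NormedSpace ℝ E] {A B : ι → E} (hAB : A ~[l] B) {ε : ι → ℝ} {c : E}
    (hA : Tendsto (fun i => (ε i)⁻¹ • A i) l (𝓝 c)) :
    Tendsto (fun i => (ε i)⁻¹ • B i) l (𝓝 c) :=
  (IsEquivalent.smul (IsEquivalent.refl (u := fun i => (ε i)⁻¹)) hAB).tendsto_nhds hA

/-- The infinitesimal difference of displacements of order `ε` is the vector difference. This is the
source of the limit in (A4). -/
theorem IsGoodRadius.tendsto_inv_smul_frameLog (hρ : IsGoodRadius U X ρ)
    (h : IsFrameSystem U X g) {p : M} (hp : p ∈ U) {ε : ι → ℝ} (hε : Tendsto ε l (𝓝[>] 0))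
    {x : ι → M} {A B : ι → Fin n → ℝ} (hx : Tendsto x l (𝓝 p)) {a b : Fin n → ℝ}
    (hA : Tendsto (fun i => (ε i)⁻¹ • A i) l (𝓝 a))
    (hB : Tendsto (fun i => (ε i)⁻¹ • B i) l (𝓝 b)) :
    Tendsto (fun i => (ε i)⁻¹ •
      frameLog U X ρ (frameExp U X (x i) (A i)) (frameExp U X (x i) (B i))) l (𝓝 (b - a)) := by
  refine (hρ.isEquivalent_frameLog h hp hx (tendsto_zero_of_inv_smul hε hA)
    (tendsto_zero_of_inv_smul hε hB)).tendsto_inv_smul ?_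
  simpa only [smul_sub] using hB.sub hA

/-- Successive displacements of order `ε` add up: the `κ`-coordinates telescope, and each increment
is its displacement to first order. Needed for the limit of `Θ`. -/
theorem IsGoodRadius.tendsto_inv_smul_frameLog_frameExp (hρ : IsGoodRadius U X ρ)
    (h : IsFrameSystem U X g) {p : M} (hp : p ∈ U) {ε : ι → ℝ} (hε : Tendsto ε l (𝓝[>] 0))
    {x : ι → M} {A B : ι → Fin n → ℝ} (hx : Tendsto x l (𝓝 p)) {a b : Fin n → ℝ}
    (hA : Tendsto (fun i => (ε i)⁻¹ • A i) l (𝓝 a))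
    (hB : Tendsto (fun i => (ε i)⁻¹ • B i) l (𝓝 b)) :
    Tendsto (fun i => (ε i)⁻¹ •
      frameLog U X ρ (x i) (frameExp U X (frameExp U X (x i) (A i)) (B i))) l (𝓝 (a + b)) := by
  obtain ⟨κ, hκ⟩ := h.chart p hp
  have hp0 : ‖(0 : Fin n → ℝ)‖ < ρ p := by simpa using hρ.pos p hp
  have hA0 := tendsto_zero_of_inv_smul hε hA
  have hB0 := tendsto_zero_of_inv_smul hε hB
  have h0 : Tendsto (fun _ : ι => (0 : Fin n → ℝ)) l (𝓝 0) := tendsto_const_nhds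
  have hy := hρ.tendsto_frameExp hp hp0 hx hA0
  rw [h.frameExp_zero hp] at hy
  have hz := hρ.tendsto_frameExp hp hp0 hy hB0
  rw [h.frameExp_zero hp] at hz
  have hyU := h.eventually_mem hp hy
  have hxU := h.eventually_mem hp hx
  refine (hκ.isEquivalent_frameLog h hρ hp hx hz).tendsto_inv_smul ?_
  have e1 := (hκ.isEquivalent_frameExp hx hA0 h0).symm.tendsto_inv_smul (ε := ε) (c := a)
    (by simpa using hA)
  have e2 := (hκ.isEquivalent_frameExp hy hB0 h0).symm.tendsto_inv_smul (ε := ε) (c := b)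
    (by simpa using hB)
  refine (e1.add e2).congr' ?_
  filter_upwards [hyU, hxU] with i h1 h2
  rw [h.frameExp_zero h1, h.frameExp_zero h2, ← smul_add]
  congr 1
  abel

/-- The error is relative to `‖a - b‖`, not to `‖a‖ + ‖b‖`. This gives two-sided Lipschitz bounds
and lets the formula be used on every subinterval of a curve. -/
theorem IsFrameSystem.eventually_dist_sub_le (h : IsFrameSystem U X g) {p : M} (hp : p ∈ U)
    {η : ℝ} (hη : 0 < η) : ∀ᶠ q : M × (Fin n → ℝ) × (Fin n → ℝ) in 𝓝 (p, 0, 0),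
      |dist (frameExp U X q.1 q.2.1) (frameExp U X q.1 q.2.2) - g p (q.2.1 - q.2.2)| ≤
        η * ‖q.2.1 - q.2.2‖ := by
  obtain ⟨κ, hκ⟩ := h.chart p hp
  obtain ⟨C, hC, hgC⟩ := exists_le_mul_norm (h.norm_add_le p hp) (h.norm_smul p hp)
  -- `θ ≤ 1` gives `‖D‖ ≤ 2 * ‖w‖`. The metric error `θ * 2` and the error `C * θ` from replacing
  -- `D` by `w` then add up to at most `η`.
  set θ := min 1 (η / (2 + C)) with hθ
  have hθ0 : 0 < θ := by positivity
  have hθ1 : θ ≤ 1 := min_le_left _ _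
  have hθη : θ * (2 + C) ≤ η := by
    calc θ * (2 + C) ≤ η / (2 + C) * (2 + C) := by gcongr; exact min_le_right _ _
      _ = η := by field_simp
  have c1 : Tendsto (fun q : M × (Fin n → ℝ) × (Fin n → ℝ) => q.1) (𝓝 (p, 0, 0)) (𝓝 p) :=
    continuousAt_fst
  have c2 : Tendsto (fun q : M × (Fin n → ℝ) × (Fin n → ℝ) => q.2.1) (𝓝 (p, 0, 0)) (𝓝 0) :=
    (continuous_snd.fst).continuousAt
  have c3 : Tendsto (fun q : M × (Fin n → ℝ) × (Fin n → ℝ) => q.2.2) (𝓝 (p, 0, 0)) (𝓝 0) :=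
    (continuous_snd.snd).continuousAt
  have e1 := isLittleO_iff.1 (hκ.isEquivalent_frameExp c1 c2 c3).isLittleO hθ0
  have t1 := Tendsto.comp hκ.tendsto (c1.prodMk_nhds c2)
  have t2 := Tendsto.comp hκ.tendsto (c1.prodMk_nhds c3)
  have e2 := (t1.prodMk_nhds t2).eventually (hκ.metric θ hθ0)
  filter_upwards [e1, e2] with q h1 h2
  simp only [Pi.sub_apply, Function.comp_apply] at h1 h2
  set D := κ (frameExp U X q.1 q.2.1) - κ (frameExp U X q.1 q.2.2)
  set w := q.2.1 - q.2.2
  have h3 : ‖D‖ ≤ 2 * ‖w‖ := by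
    have := _root_.norm_add_le (D - w) w
    rw [sub_add_cancel] at this
    nlinarith [norm_nonneg w]
  have h4 : |g p D - g p w| ≤ C * ‖D - w‖ := by
    have e3 := h.norm_add_le p hp w (D - w)
    have e4 := h.norm_add_le p hp D (w - D)
    rw [add_sub_cancel] at e3 e4
    have e5 := hgC (D - w)
    have e6 := hgC (w - D)
    rw [norm_sub_rev] at e6
    rw [abs_le]
    constructor <;> linarith
  calc |dist (frameExp U X q.1 q.2.1) (frameExp U X q.1 q.2.2) - g p w|
      ≤ |dist (frameExp U X q.1 q.2.1) (frameExp U X q.1 q.2.2) - g p D| + |g p D - g p w| :=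
        abs_sub_le _ _ _
    _ ≤ θ * (2 * ‖w‖) + C * (θ * ‖w‖) := by
        refine add_le_add (h2.trans ?_) (h4.trans ?_) <;> gcongr
    _ = θ * (2 + C) * ‖w‖ := by ring
    _ ≤ η * ‖w‖ := by gcongr

theorem IsFrameSystem.tendsto_dist_div (h : IsFrameSystem U X g) {p : M} (hp : p ∈ U)
    {ε : ι → ℝ} (hε : Tendsto ε l (𝓝[>] 0)) {x : ι → M} {A B : ι → Fin n → ℝ}
    (hx : Tendsto x l (𝓝 p)) {a b : Fin n → ℝ} (hA : Tendsto (fun i => (ε i)⁻¹ • A i) l (𝓝 a))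
    (hB : Tendsto (fun i => (ε i)⁻¹ • B i) l (𝓝 b)) :
    Tendsto (fun i => dist (frameExp U X (x i) (A i)) (frameExp U X (x i) (B i)) / ε i) l
      (𝓝 (g p (a - b))) := by
  have hd : Tendsto (fun i => (ε i)⁻¹ • (A i - B i)) l (𝓝 (a - b)) := by
    simpa only [smul_sub] using hA.sub hB
  have hg : Tendsto (fun i => g p ((ε i)⁻¹ • (A i - B i))) l (𝓝 (g p (a - b))) :=
    ((h.continuous hp).tendsto _).comp hd
  have hlo : (fun i => dist (frameExp U X (x i) (A i)) (frameExp U X (x i) (B i)) -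
      g p (A i - B i)) =o[l] fun i => A i - B i := by
    refine isLittleO_iff.2 fun η hη => ?_
    filter_upwards [(hx.prodMk_nhds ((tendsto_zero_of_inv_smul hε hA).prodMk_nhds
      (tendsto_zero_of_inv_smul hε hB))).eventually (h.eventually_dist_sub_le hp hη)] with i hi
    exact hi
  have h1 := (isBigO_refl (fun i => (ε i)⁻¹) l).smul_isLittleO hlo
  have h2 : (fun i => (ε i)⁻¹ • (dist (frameExp U X (x i) (A i)) (frameExp U X (x i) (B i)) -
      g p (A i - B i))) =o[l] fun _ => (1 : ℝ) := h1.trans_isBigO (hd.isBigO_one ℝ)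
  have h3 := ((isLittleO_one_iff ℝ).1 h2).add hg
  rw [zero_add] at h3
  refine h3.congr' ?_
  filter_upwards [hε.eventually self_mem_nhdsWithin] with i hi
  have hi : 0 < ε i := hi
  rw [h.norm_smul p hp, abs_of_pos (inv_pos.2 hi), smul_eq_mul]
  ring

end Infinitesimal

/-! ### Algebra of weighted scalings of coordinate vectors -/

section Scale

variable {n : ℕ} (w w' : Fin n → ℕ)

@[simp] theorem scale_apply (ε : ℝ) (a : Fin n → ℝ) (i : Fin n) :
    scale w ε a i = ε ^ w i * a i := rfl

@[simp] theorem scale_one (a : Fin n → ℝ) : scale w 1 a = a := by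
  ext i; simp

@[simp] theorem scale_zero_right (ε : ℝ) : scale w ε 0 = 0 := by
  ext i; simp

theorem scale_scale (ε μ : ℝ) (a : Fin n → ℝ) : scale w ε (scale w μ a) = scale w (ε * μ) a := by
  ext i; simp [mul_pow, mul_assoc]

theorem scale_comm (ε μ : ℝ) (a : Fin n → ℝ) :
    scale w ε (scale w' μ a) = scale w' μ (scale w ε a) := by
  ext i; simp only [scale_apply]; ring

theorem scale_inv_scale {ε : ℝ} (hε : ε ≠ 0) (a : Fin n → ℝ) :
    scale w ε⁻¹ (scale w ε a) = a := by
  rw [scale_scale, inv_mul_cancel₀ hε, scale_one]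

theorem scale_scale_inv {ε : ℝ} (hε : ε ≠ 0) (a : Fin n → ℝ) :
    scale w ε (scale w ε⁻¹ a) = a := by
  rw [scale_scale, mul_inv_cancel₀ hε, scale_one]

theorem scale_smul (ε s : ℝ) (a : Fin n → ℝ) : scale w ε (s • a) = s • scale w ε a := by
  ext i; simp only [scale_apply, Pi.smul_apply, smul_eq_mul]; ring

theorem scale_sub (ε : ℝ) (a b : Fin n → ℝ) :
    scale w ε (a - b) = scale w ε a - scale w ε b := by
  ext i; simp [mul_sub]

theorem scale_neg (ε : ℝ) (a : Fin n → ℝ) : scale w ε (-a) = -scale w ε a := by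
  ext i; simp

theorem scale_const_one (ε : ℝ) (a : Fin n → ℝ) : scale (fun _ => 1) ε a = ε • a := by
  ext i; simp

/-- The coordinate form of `δ̄ Q = δ`. Positivity of the weights is what makes the truncated
subtraction harmless. -/
theorem scale_scale_pred {w : Fin n → ℕ} (hw : ∀ i, 1 ≤ w i) (ε : ℝ) (a : Fin n → ℝ) :
    ε • scale (fun i => w i - 1) ε a = scale w ε a := by
  ext i
  simp only [Pi.smul_apply, scale_apply, smul_eq_mul, ← mul_assoc, ← pow_succ']
  rw [Nat.sub_add_cancel (hw i)]

theorem norm_scale_le {ε : ℝ} (h0 : 0 ≤ ε) (h1 : ε ≤ 1) (a : Fin n → ℝ) :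
    ‖scale w ε a‖ ≤ ‖a‖ := by
  refine (pi_norm_le_iff_of_nonneg (norm_nonneg _)).2 fun i => ?_
  rw [scale_apply, norm_mul, norm_pow, Real.norm_of_nonneg h0]
  calc ε ^ w i * ‖a i‖ ≤ 1 * ‖a‖ :=
        mul_le_mul (pow_le_one₀ h0 h1) (norm_le_pi_norm a i) (norm_nonneg _) zero_le_one
    _ = ‖a‖ := one_mul _

theorem norm_scale_le_mul {w : Fin n → ℕ} (hw : ∀ i, 1 ≤ w i) {ε : ℝ} (h0 : 0 ≤ ε) (h1 : ε ≤ 1)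
    (a : Fin n → ℝ) : ‖scale w ε a‖ ≤ ε * ‖a‖ := by
  rw [← scale_scale_pred hw, norm_smul, Real.norm_of_nonneg h0]
  exact mul_le_mul_of_nonneg_left (norm_scale_le _ h0 h1 a) h0

theorem continuous_scale : Continuous fun q : ℝ × (Fin n → ℝ) => scale w q.1 q.2 := by
  unfold scale
  fun_prop

variable {ι : Type*} {l : Filter ι}

theorem tendsto_scale {ε : ι → ℝ} {a : ι → Fin n → ℝ} {ε₀ : ℝ} {a₀ : Fin n → ℝ}
    (hε : Tendsto ε l (𝓝 ε₀)) (ha : Tendsto a l (𝓝 a₀)) :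
    Tendsto (fun i => scale w (ε i) (a i)) l (𝓝 (scale w ε₀ a₀)) := by
  have h := Tendsto.comp ((continuous_scale w).tendsto (ε₀, a₀)) (hε.prodMk_nhds ha)
  exact h

theorem scale_zero_of_one_le {w : Fin n → ℕ} (hw : ∀ i, 1 ≤ w i) (a : Fin n → ℝ) :
    scale w 0 a = 0 := by
  ext i
  simp [Nat.one_le_iff_ne_zero.1 (hw i)]

/-- Since `0 ^ 0 = 1`, the scaling with weights `w - 1` at `0` is the projection onto the
coordinates of degree one; to order `ε` only these survive. -/
theorem tendsto_inv_smul_scale {w : Fin n → ℕ} (hw : ∀ i, 1 ≤ w i) {ε : ι → ℝ}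
    (hε : Tendsto ε l (𝓝[>] 0)) {a : ι → Fin n → ℝ} {a₀ : Fin n → ℝ} (ha : Tendsto a l (𝓝 a₀)) :
    Tendsto (fun i => (ε i)⁻¹ • scale w (ε i) (a i)) l
      (𝓝 (scale (fun i => w i - 1) 0 a₀)) := by
  refine (tendsto_scale _ (tendsto_nhds_of_tendsto_nhdsWithin hε) ha).congr' ?_
  filter_upwards [hε.eventually self_mem_nhdsWithin] with i hi
  rw [← scale_scale_pred hw, inv_smul_smul₀ (ne_of_gt hi)]

/-- The horizontal part of a coordinate vector is homogeneous of degree one. -/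
theorem scale_scale_pred_zero {w : Fin n → ℕ} (hw : ∀ i, 1 ≤ w i) (s : ℝ) (a : Fin n → ℝ) :
    scale w s (scale (fun i => w i - 1) 0 a) = s • scale (fun i => w i - 1) 0 a := by
  ext i
  simp only [Pi.smul_apply, scale_apply, smul_eq_mul]
  rcases (hw i).eq_or_lt with h | h
  · simp [← h]
  · simp [Nat.sub_ne_zero_of_lt h]

/-- A vector fixed by the limit projection has no coordinates of degree above one, hence is already
fixed by every `Q_s`. -/
theorem scale_pred_zero_of_eq {w : Fin n → ℕ} {a : Fin n → ℝ}
    (ha : scale (fun i => w i - 1) 0 a = a) (s : ℝ) : scale (fun i => w i - 1) s a = a := by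
  ext i
  have h := congrFun ha i
  simp only [scale_apply] at h ⊢
  rcases Nat.eq_zero_or_pos (w i - 1) with h0 | h0
  · simp [h0]
  · rw [zero_pow h0.ne', zero_mul] at h
    rw [← h, mul_zero]

end Scale

/-! ### Algebraic axioms for the maps defined by a frame -/

section Maps

variable {n : ℕ} {M : Type*} [MetricSpace M]
    [ChartedSpace (EuclideanSpace ℝ (Fin n)) M]
    {U : Set M} {X : Fin n → VField n M} {ρ : M → ℝ} {w : Fin n → ℕ}

theorem mem_frameMaps_dom {ε : ℝ} {x u : M} :
    u ∈ (frameMaps U X ρ w).dom ε x ↔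
      ∃ a, ‖a‖ < ρ x ∧ ‖scale w ε a‖ < ρ x ∧ frameExp U X x a = u := by
  simp [frameMaps, and_assoc]

theorem mem_frameMaps_U {x u : M} :
    u ∈ (frameMaps U X ρ w).U x ↔ ∃ a, ‖a‖ < ρ x ∧ frameExp U X x a = u := by
  refine mem_frameMaps_dom.trans ⟨?_, ?_⟩
  · rintro ⟨a, ha, -, h⟩
    exact ⟨a, ha, h⟩
  · rintro ⟨a, ha, h⟩
    exact ⟨a, ha, by rwa [scale_one], h⟩

theorem IsGoodRadius.mem_dom_iff (hρ : IsGoodRadius U X ρ) {x : M} (hx : x ∈ U)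
    {a : Fin n → ℝ} (ha : ‖a‖ < ρ x) {ε : ℝ} :
    frameExp U X x a ∈ (frameMaps U X ρ w).dom ε x ↔ ‖scale w ε a‖ < ρ x := by
  rw [mem_frameMaps_dom]
  constructor
  · rintro ⟨b, hb, hb', h⟩
    rwa [← hρ.frameExp_inj hx hb ha h]
  · exact fun h => ⟨a, ha, h, rfl⟩

theorem IsGoodRadius.map_frameExp (hρ : IsGoodRadius U X ρ) {x : M} (hx : x ∈ U)
    {a : Fin n → ℝ} (ha : ‖a‖ < ρ x) (ε : ℝ) :
    (frameMaps U X ρ w).map ε x (frameExp U X x a) = frameExp U X x (scale w ε a) := by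
  change frameExp U X x (scale w ε (frameLog U X ρ x (frameExp U X x a))) = _
  rw [hρ.frameLog_frameExp hx ha]

theorem frameMaps_map_mem {ε : ℝ} {x : M} (hx : x ∈ U) (u : M) :
    (frameMaps U X ρ w).map ε x u ∈ U :=
  frameExp_mem hx _

theorem frameMaps_dom_subset {ε : ℝ} {x : M} (hx : x ∈ U) :
    (frameMaps U X ρ w).dom ε x ⊆ U := by
  intro u hu
  obtain ⟨a, -, -, rfl⟩ := mem_frameMaps_dom.1 hu
  exact frameExp_mem hx _

theorem frameMaps_dom_le_one {ε : ℝ} (h0 : 0 < ε) (h1 : ε ≤ 1) {x : M} :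
    (frameMaps U X ρ w).dom ε x = (frameMaps U X ρ w).U x := by
  ext u
  rw [mem_frameMaps_dom, mem_frameMaps_U]
  constructor
  · rintro ⟨a, ha, -, h⟩
    exact ⟨a, ha, h⟩
  · rintro ⟨a, ha, h⟩
    exact ⟨a, ha, (norm_scale_le w h0.le h1 a).trans_lt ha, h⟩

theorem frameMaps_U_eq (w' : Fin n → ℕ) {x : M} :
    (frameMaps U X ρ w).U x = (frameMaps U X ρ w').U x := by
  ext u
  rw [mem_frameMaps_U, mem_frameMaps_U]

theorem IsGoodRadius.frameMaps_map_one (hρ : IsGoodRadius U X ρ) {x u : M} (hx : x ∈ U)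
    (hu : u ∈ (frameMaps U X ρ w).U x) : (frameMaps U X ρ w).map 1 x u = u := by
  obtain ⟨a, ha, rfl⟩ := mem_frameMaps_U.1 hu
  rw [hρ.map_frameExp hx ha, scale_one]

theorem IsGoodRadius.frameMaps_comp_dom (hρ : IsGoodRadius U X ρ) {x u : M} (hx : x ∈ U)
    {ε μ : ℝ} (hu : u ∈ (frameMaps U X ρ w).dom μ x) :
    (frameMaps U X ρ w).map μ x u ∈ (frameMaps U X ρ w).dom ε x ↔
      u ∈ (frameMaps U X ρ w).dom (ε * μ) x := by
  obtain ⟨a, ha, ha', rfl⟩ := mem_frameMaps_dom.1 hu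
  rw [hρ.map_frameExp hx ha, hρ.mem_dom_iff hx ha', hρ.mem_dom_iff hx ha, scale_scale]

theorem IsGoodRadius.frameMaps_comp (hρ : IsGoodRadius U X ρ) {x u : M} (hx : x ∈ U)
    {ε μ : ℝ} (hu : u ∈ (frameMaps U X ρ w).dom μ x) :
    (frameMaps U X ρ w).map ε x ((frameMaps U X ρ w).map μ x u) =
      (frameMaps U X ρ w).map (ε * μ) x u := by
  obtain ⟨a, ha, ha', rfl⟩ := mem_frameMaps_dom.1 hu
  rw [hρ.map_frameExp hx ha, hρ.map_frameExp hx ha', hρ.map_frameExp hx ha, scale_scale]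

theorem IsGoodRadius.frameMaps_dom_inv (hρ : IsGoodRadius U X ρ) {x : M} (hx : x ∈ U)
    {ε : ℝ} (h0 : 0 < ε) (h1 : ε ≤ 1) :
    (frameMaps U X ρ w).dom ε⁻¹ x = (frameMaps U X ρ w).map ε x '' (frameMaps U X ρ w).U x := by
  ext u
  rw [mem_frameMaps_dom]
  constructor
  · rintro ⟨a, ha, ha', rfl⟩
    refine ⟨_, mem_frameMaps_U.2 ⟨_, ha', rfl⟩, ?_⟩
    rw [hρ.map_frameExp hx ha', scale_scale_inv w h0.ne']
  · rintro ⟨_, hu, rfl⟩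
    obtain ⟨a, ha, rfl⟩ := mem_frameMaps_U.1 hu
    refine ⟨scale w ε a, (norm_scale_le w h0.le h1 a).trans_lt ha, ?_, ?_⟩
    · rwa [scale_inv_scale w h0.ne']
    · rw [hρ.map_frameExp hx ha]

theorem IsGoodRadius.frameMaps_comm_dom (hρ : IsGoodRadius U X ρ) {w' : Fin n → ℕ} {x u : M}
    (hx : x ∈ U) {ε μ : ℝ} (hu : u ∈ (frameMaps U X ρ w).dom ε x ∩ (frameMaps U X ρ w').dom μ x) :
    (frameMaps U X ρ w').map μ x u ∈ (frameMaps U X ρ w).dom ε x ↔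
      (frameMaps U X ρ w).map ε x u ∈ (frameMaps U X ρ w').dom μ x := by
  obtain ⟨a, ha, ha', rfl⟩ := mem_frameMaps_dom.1 hu.1
  have ha'' := (hρ.mem_dom_iff hx ha).1 hu.2
  rw [hρ.map_frameExp hx ha, hρ.map_frameExp hx ha, hρ.mem_dom_iff hx ha', hρ.mem_dom_iff hx ha'',
    scale_comm]

theorem IsGoodRadius.frameMaps_comm (hρ : IsGoodRadius U X ρ) {w' : Fin n → ℕ} {x u : M}
    (hx : x ∈ U) {ε μ : ℝ} (hu : u ∈ (frameMaps U X ρ w).dom ε x ∩ (frameMaps U X ρ w').dom μ x) :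
    (frameMaps U X ρ w).map ε x ((frameMaps U X ρ w').map μ x u) =
      (frameMaps U X ρ w').map μ x ((frameMaps U X ρ w).map ε x u) := by
  obtain ⟨a, ha, ha', rfl⟩ := mem_frameMaps_dom.1 hu.1
  have ha'' := (hρ.mem_dom_iff hx ha).1 hu.2
  rw [hρ.map_frameExp hx ha, hρ.map_frameExp hx ha, hρ.map_frameExp hx ha',
    hρ.map_frameExp hx ha'', scale_comm]

theorem IsGoodRadius.isAdmissibleRadius (hρ : IsGoodRadius U X ρ) : IsAdmissibleRadius U X ρ := by
  refine ⟨hρ.continuousOn, fun x hx => ⟨hρ.pos x hx, fun a ha => ?_, (hρ.good x hx).injOn⟩⟩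
  exact ⟨_, (hρ.good x hx).isExp a (by simpa using ha)⟩

end Maps

/-! ### Base points and the group property inside the good radius -/

section Flow

variable {n : ℕ} {M : Type*} [MetricSpace M]
    [ChartedSpace (EuclideanSpace ℝ (Fin n)) M] [IsManifold (𝓡 n) ∞ M]
    {U : Set M} {X : Fin n → VField n M} {g : M → (Fin n → ℝ) → ℝ} {ρ : M → ℝ} {w : Fin n → ℕ}

theorem IsGoodRadius.mem_dom_self (hρ : IsGoodRadius U X ρ) (h : IsFrameSystem U X g) {x : M}
    (hx : x ∈ U) (ε : ℝ) : x ∈ (frameMaps U X ρ w).dom ε x := by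
  have h0 : ‖(0 : Fin n → ℝ)‖ < ρ x := by simpa using hρ.pos x hx
  exact mem_frameMaps_dom.2 ⟨0, h0, by rwa [scale_zero_right], h.frameExp_zero hx⟩

theorem IsGoodRadius.map_self (hρ : IsGoodRadius U X ρ) (h : IsFrameSystem U X g) {x : M}
    (hx : x ∈ U) (ε : ℝ) : (frameMaps U X ρ w).map ε x x = x := by
  have h0 : ‖(0 : Fin n → ℝ)‖ < ρ x := by simpa using hρ.pos x hx
  have h1 := hρ.map_frameExp (w := w) hx h0 ε
  rwa [scale_zero_right, h.frameExp_zero hx] at h1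

/-- The one-parameter group property inside the good radius. -/
theorem IsGoodRadius.frameExp_frameExp_smul (hρ : IsGoodRadius U X ρ) (h : IsFrameSystem U X g)
    {x : M} (hx : x ∈ U) {a : Fin n → ℝ} (ha : ‖a‖ < ρ x) {s t : ℝ} (hs : s ∈ Icc (0 : ℝ) 1)
    (ht : t ∈ Icc (0 : ℝ) 1) :
    frameExp U X (frameExp U X x (s • a)) ((t - s) • a) = frameExp U X x (t • a) :=
  (((hρ.good x hx).isExp a ha).frameExp_flow h.isOpen h.smooth hs ht).frameExp_eq h.isOpen h.smooth

theorem IsGoodRadius.frameExp_frameExp_neg (hρ : IsGoodRadius U X ρ) (h : IsFrameSystem U X g)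
    {x : M} (hx : x ∈ U) {a : Fin n → ℝ} (ha : ‖a‖ < ρ x) :
    frameExp U X (frameExp U X x a) (-a) = x := by
  have h1 := hρ.frameExp_frameExp_smul h hx ha (s := 1) (t := 0) (by simp) (by simp)
  rwa [one_smul, zero_smul, zero_sub, neg_smul, one_smul, h.frameExp_zero hx] at h1

end Flow

/-! ### Convergence of the rescaled logarithms -/

section Composition

set_option linter.unusedSectionVars false

variable {n : ℕ} {M : Type*} [MetricSpace M]
    [ChartedSpace (EuclideanSpace ℝ (Fin n)) M] [IsManifold (𝓡 n) ∞ M]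

/-- The rescaled coordinates of `exp(∑ ε^{wᵢ} aᵢ Xᵢ)(x)` with respect to the base point
`exp(∑ ε^{wᵢ} bᵢ Xᵢ)(x)`. -/
noncomputable def scaledLog (U : Set M) (X : Fin n → VField n M) (ρ : M → ℝ) (w : Fin n → ℕ)
    (z : ℝ × M × (Fin n → ℝ) × (Fin n → ℝ)) : Fin n → ℝ :=
  scale w z.1⁻¹ (frameLog U X ρ (frameExp U X z.2.1 (scale w z.1 z.2.2.2))
    (frameExp U X z.2.1 (scale w z.1 z.2.2.1)))

/-- The composition property (b) of normal frames, near the point `p`. -/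
def HasComposition (U : Set M) (X : Fin n → VField n M) (w : Fin n → ℕ) (p : M) : Prop :=
  ∃ K ∈ 𝓝 p, ∃ UK ∈ 𝓝 (0 : Fin n → ℝ), ∃ P P₀ : (Fin n → ℝ) → (Fin n → ℝ) → M → (Fin n → ℝ),
    (∀ x ∈ K, ∀ a ∈ UK, ∀ b ∈ UK, ∃ y z,
      IsExp U (combination X b) x y ∧ IsExp U (combination X (P a b x)) y z ∧
      IsExp U (combination X a) x z) ∧
    ∀ η > 0, ∃ ε₀ > 0, ∀ ε, 0 < ε → ε < ε₀ → ∀ x ∈ K, ∀ a ∈ UK, ∀ b ∈ UK,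
      scale w ε a ∈ UK → scale w ε b ∈ UK →
      ∀ i, |(ε ^ w i)⁻¹ * P (scale w ε a) (scale w ε b) x i - P₀ a b x i| < η

variable {U : Set M} {X : Fin n → VField n M} {g : M → (Fin n → ℝ) → ℝ} {ρ : M → ℝ}
    {w : Fin n → ℕ} {ι : Type*} {l : Filter ι}

theorem IsGoodRadius.tendsto_frameExp_scale (hρ : IsGoodRadius U X ρ) (h : IsFrameSystem U X g)
    (hw : ∀ i, 1 ≤ w i) {p : M} (hp : p ∈ U) {ε : ι → ℝ} (hε : Tendsto ε l (𝓝 0)) {x : ι → M}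
    (hx : Tendsto x l (𝓝 p)) {a : ι → Fin n → ℝ} {a₀ : Fin n → ℝ} (ha : Tendsto a l (𝓝 a₀)) :
    Tendsto (fun i => frameExp U X (x i) (scale w (ε i) (a i))) l (𝓝 p) := by
  have h1 := tendsto_scale w hε ha
  rw [scale_zero_of_one_le hw] at h1
  have h2 := hρ.tendsto_frameExp hp (by simpa using hρ.pos p hp) hx h1
  rwa [h.frameExp_zero hp] at h2

theorem IsGoodRadius.norm_zero_lt (hρ : IsGoodRadius U X ρ) {x : M} (hx : x ∈ U) :
    ‖(0 : Fin n → ℝ)‖ < ρ x := by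
  simpa using hρ.pos x hx

theorem norm_sub_scale_le (hw : ∀ i, 1 ≤ w i) {ε : ℝ} (h0 : 0 < ε) (h1 : ε ≤ 1)
    {c c₀ : Fin n → ℝ} (hc : ∀ i, |(ε ^ w i)⁻¹ * c i - c₀ i| < 1) :
    ‖c - scale w ε c₀‖ ≤ ε := by
  refine (pi_norm_le_iff_of_nonneg h0.le).2 fun i => ?_
  have h2 : 0 < ε ^ w i := pow_pos h0 _
  have h3 : c i - ε ^ w i * c₀ i = ε ^ w i * ((ε ^ w i)⁻¹ * c i - c₀ i) := by
    field_simp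
  rw [Pi.sub_apply, scale_apply, h3, Real.norm_eq_abs, abs_mul, abs_of_pos h2]
  calc ε ^ w i * |(ε ^ w i)⁻¹ * c i - c₀ i| ≤ ε ^ w i * 1 := by gcongr; exact (hc i).le
    _ ≤ ε := by
      rw [mul_one]
      exact pow_le_of_le_one h0.le h1 (Nat.one_le_iff_ne_zero.1 (hw i))

/-- The vector `P` of the composition property has the same exponential as the logarithm but could
lie outside the ball of injectivity. It equals the logarithm as soon as its norm is below `s`, a
lower bound for the radii near `p`; excluding large values takes a continuity argument in `ε`.
Uniform convergence then passes from `P` to the logarithm. -/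
theorem IsGoodRadius.exists_tendsto_scaledLog_of_small (hρ : IsGoodRadius U X ρ)
    (h : IsFrameSystem U X g) (hw : ∀ i, 1 ≤ w i) {p : M} (hp : p ∈ U)
    (hcomp : HasComposition U X w p) :
    ∃ r > 0, ∀ a₀ b₀ : Fin n → ℝ, ‖a₀‖ < r → ‖b₀‖ < r →
      ∃ c, Tendsto (scaledLog U X ρ w) (𝓝[>] 0 ×ˢ 𝓝 (p, a₀, b₀)) (𝓝 c) := by
  obtain ⟨K, hK, UK, hUK, P, P₀, hP, hlim⟩ := hcomp
  obtain ⟨r, hr, hrUK⟩ := Metric.mem_nhds_iff.1 hUK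
  have hrUK' : ∀ a : Fin n → ℝ, ‖a‖ < r → a ∈ UK := fun a ha => hrUK (by simpa using ha)
  refine ⟨r, hr, fun a₀ b₀ ha₀ hb₀ => ?_⟩
  obtain ⟨s, hs, hsρ⟩ : ∃ s > 0, ∀ᶠ y in 𝓝 p, s < ρ y :=
    ⟨ρ p / 2, half_pos (hρ.pos p hp),
      (hρ.continuousOn.continuousAt (h.isOpen.mem_nhds hp)).eventually_const_lt
        (half_lt_self (hρ.pos p hp))⟩
  set y : ℝ → M × (Fin n → ℝ) × (Fin n → ℝ) → M :=
    fun ε q => frameExp U X q.1 (scale w ε q.2.2) with hy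
  set z : ℝ → M × (Fin n → ℝ) × (Fin n → ℝ) → M :=
    fun ε q => frameExp U X q.1 (scale w ε q.2.1) with hz
  have cε : Tendsto (fun t : ℝ × M × (Fin n → ℝ) × (Fin n → ℝ) => t.1)
      (𝓝[>] 0 ×ˢ 𝓝 (p, a₀, b₀)) (𝓝 0) :=
    tendsto_nhds_of_tendsto_nhdsWithin tendsto_fst
  have cq : Tendsto (fun t : ℝ × M × (Fin n → ℝ) × (Fin n → ℝ) => t.2)
      (𝓝[>] 0 ×ˢ 𝓝 (p, a₀, b₀)) (𝓝 (p, a₀, b₀)) := tendsto_snd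
  have cx := cq.fst_nhds
  have ca := cq.snd_nhds.fst_nhds
  have cb := cq.snd_nhds.snd_nhds
  have ty := hρ.tendsto_frameExp_scale h hw hp cε cx cb
  have tz := hρ.tendsto_frameExp_scale h hw hp cε cx ca
  have tz' : Tendsto (fun t => z t.1 t.2) (𝓝[>] 0 ×ˢ 𝓝 (p, a₀, b₀)) (𝓝 (frameExp U X p 0)) := by
    rwa [h.frameExp_zero hp]
  obtain ⟨tL, eL⟩ := hρ.tendsto_frameLog h.isOpen hp (hρ.norm_zero_lt hp) ty tz'
  have tL' := tL.norm
  rw [norm_zero] at tL'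
  have e1 : ∀ᶠ t : ℝ × M × (Fin n → ℝ) × (Fin n → ℝ) in 𝓝[>] 0 ×ˢ 𝓝 (p, a₀, b₀),
      t.2.1 ∈ K ∧ ‖t.2.2.1‖ < r ∧ ‖t.2.2.2‖ < r ∧ y t.1 t.2 ∈ U ∧ s < ρ (y t.1 t.2) ∧
      frameExp U X (y t.1 t.2) (frameLog U X ρ (y t.1 t.2) (z t.1 t.2)) = z t.1 t.2 ∧
      ‖frameLog U X ρ (y t.1 t.2) (z t.1 t.2)‖ < s / 4 ∧
      ‖scale w t.1 t.2.2.1‖ < ρ t.2.1 ∧ ‖scale w t.1 t.2.2.2‖ < ρ t.2.1 := by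
    have sa := tendsto_scale w cε ca
    have sb := tendsto_scale w cε cb
    rw [scale_zero_of_one_le hw] at sa sb
    filter_upwards [cx.eventually hK, ca.norm.eventually_lt_const ha₀,
      cb.norm.eventually_lt_const hb₀, ty.eventually hsρ, eL,
      tL'.eventually_lt_const (show (0 : ℝ) < s / 4 by positivity),
      hρ.eventually_lt h.isOpen hp (hρ.norm_zero_lt hp) cx sa,
      hρ.eventually_lt h.isOpen hp (hρ.norm_zero_lt hp) cx sb] with t h1 h2 h3 h4 h5 h6 h7 h8
    exact ⟨h1, h2, h3, h5.1, h4, h5.2.2, h6, h7, h8⟩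
  obtain ⟨pa, hpa, pb, hpb, hab⟩ := eventually_prod_iff.1 e1
  obtain ⟨ε₁, hε₁, hpa⟩ := eventually_nhdsGT_zero_iff.1 hpa
  obtain ⟨ε₂, hε₂, hP1⟩ := hlim 1 one_pos
  set ε₃ := min (min ε₁ ε₂) (min 1 (s / 4)) with hε₃
  have hε₃0 : 0 < ε₃ := by positivity
  have h31 : ε₃ ≤ ε₁ := (min_le_left _ _).trans (min_le_left _ _)
  have h32 : ε₃ ≤ ε₂ := (min_le_left _ _).trans (min_le_right _ _)
  have h33 : ε₃ ≤ 1 := (min_le_right _ _).trans (min_le_left _ _)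
  have h34 : ε₃ ≤ s / 4 := (min_le_right _ _).trans (min_le_right _ _)
  -- the vector `P` agrees with the logarithm as soon as it is small
  have hsmall : ∀ ε, 0 < ε → ε < ε₃ → ∀ q, pb q →
      ‖P (scale w ε q.2.1) (scale w ε q.2.2) q.1‖ < s →
      P (scale w ε q.2.1) (scale w ε q.2.2) q.1 = frameLog U X ρ (y ε q) (z ε q) := by
    intro ε h0 h1 q hq hs'
    obtain ⟨k1, k2, k3, k4, k5, k6, k7, -⟩ := hab (hpa ε h0 (h1.trans_le h31)) hq
    simp only at k1 k2 k3 k4 k5 k6 k7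
    have hε1 : ε ≤ 1 := h1.le.trans h33
    obtain ⟨y', z', m1, m2, m3⟩ := hP q.1 k1 (scale w ε q.2.1)
      (hrUK' _ ((norm_scale_le w h0.le hε1 _).trans_lt k2)) (scale w ε q.2.2)
      (hrUK' _ ((norm_scale_le w h0.le hε1 _).trans_lt k3))
    have hy' : y ε q = y' := m1.frameExp_eq h.isOpen h.smooth
    have hz' : z ε q = z' := m3.frameExp_eq h.isOpen h.smooth
    refine hρ.frameExp_inj k4 (hs'.trans k5) (k7.trans (by linarith)) ?_
    rw [k6, hz', hy']
    exact m2.frameExp_eq h.isOpen h.smooth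
  have hclose : ∀ ε, 0 < ε → ε < ε₃ → ∀ q, pb q →
      ‖P (scale w ε q.2.1) (scale w ε q.2.2) q.1 - scale w ε (P₀ q.2.1 q.2.2 q.1)‖ ≤ ε := by
    intro ε h0 h1 q hq
    obtain ⟨k1, k2, k3, -⟩ := hab (hpa ε h0 (h1.trans_le h31)) hq
    simp only at k1 k2 k3
    have hε1 : ε ≤ 1 := h1.le.trans h33
    exact norm_sub_scale_le hw h0 hε1 (hP1 ε h0 (h1.trans_le h32) q.1 k1 _ (hrUK' _ k2) _
      (hrUK' _ k3) (hrUK' _ ((norm_scale_le w h0.le hε1 _).trans_lt k2))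
      (hrUK' _ ((norm_scale_le w h0.le hε1 _).trans_lt k3)))
  -- If `scale w ε P₀` had norm above `s / 2`, then by continuity in the parameter some `τ ≤ ε`
  -- would give exactly `s / 2`. There `P` is within `τ < s / 4` of it, so its norm lies strictly
  -- between `s / 4` and `s`; but then `P` is the logarithm, of norm below `s / 4`.
  have hbound : ∀ ε, 0 < ε → ε < ε₃ → ∀ q, pb q →
      ‖scale w ε (P₀ q.2.1 q.2.2 q.1)‖ ≤ s / 2 := by
    intro ε h0 h1 q hq
    by_contra! hlt
    have hcont : ContinuousOn (fun τ : ℝ => ‖scale w τ (P₀ q.2.1 q.2.2 q.1)‖) (Icc 0 ε) := by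
      have := (continuous_scale w).comp
        (continuous_id.prodMk (continuous_const (y := P₀ q.2.1 q.2.2 q.1)))
      exact this.norm.continuousOn
    obtain ⟨τ, hτ, hτs⟩ := intermediate_value_Icc h0.le hcont (show s / 2 ∈ Icc _ _ by
      refine ⟨?_, hlt.le⟩
      rw [scale_zero_of_one_le hw, norm_zero]
      positivity)
    simp only at hτs
    have hτ0 : 0 < τ := by
      refine lt_of_le_of_ne hτ.1 fun h0' => ?_
      rw [← h0', scale_zero_of_one_le hw, norm_zero] at hτs
      linarith
    have hτ1 : τ < ε₃ := hτ.2.trans_lt h1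
    have c1 := hclose τ hτ0 hτ1 q hq
    set c := P (scale w τ q.2.1) (scale w τ q.2.2) q.1 with hc
    have c2 := norm_le_norm_add_norm_sub' c (scale w τ (P₀ q.2.1 q.2.2 q.1))
    have c3 := norm_le_norm_add_norm_sub' (scale w τ (P₀ q.2.1 q.2.2 q.1)) c
    rw [norm_sub_rev] at c3
    have c4 := hsmall τ hτ0 hτ1 q hq (by rw [← hc]; linarith)
    obtain ⟨-, -, -, -, -, -, k7, -⟩ := hab (hpa τ hτ0 (hτ1.trans_le h31)) hq
    simp only at k7
    rw [← c4, ← hc] at k7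
    linarith
  have heq : ∀ ε, 0 < ε → ε < ε₃ → ∀ q, pb q →
      P (scale w ε q.2.1) (scale w ε q.2.2) q.1 = frameLog U X ρ (y ε q) (z ε q) := by
    intro ε h0 h1 q hq
    refine hsmall ε h0 h1 q hq ?_
    have c1 := hclose ε h0 h1 q hq
    have c2 := hbound ε h0 h1 q hq
    have c3 := norm_le_norm_add_norm_sub' (P (scale w ε q.2.1) (scale w ε q.2.2) q.1)
      (scale w ε (P₀ q.2.1 q.2.2 q.1))
    linarith
  have hunif : ∀ η > 0, ∃ ε₄ > 0, ∀ ε, 0 < ε → ε < ε₄ → ∀ q, pb q →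
      dist (scaledLog U X ρ w (ε, q)) (P₀ q.2.1 q.2.2 q.1) < η := by
    intro η hη
    obtain ⟨ε₅, hε₅, hη'⟩ := hlim η hη
    refine ⟨min ε₃ ε₅, by positivity, fun ε h0 h1 q hq => ?_⟩
    have h13 := h1.trans_le (min_le_left _ _)
    obtain ⟨k1, k2, k3, -⟩ := hab (hpa ε h0 (h13.trans_le h31)) hq
    simp only at k1 k2 k3
    have hε1 : ε ≤ 1 := h13.le.trans h33
    refine (dist_pi_lt_iff hη).2 fun i => ?_
    have := hη' ε h0 (h1.trans_le (min_le_right _ _)) q.1 k1 _ (hrUK' _ k2) _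
      (hrUK' _ k3) (hrUK' _ ((norm_scale_le w h0.le hε1 _).trans_lt k2))
      (hrUK' _ ((norm_scale_le w h0.le hε1 _).trans_lt k3)) i
    rw [heq ε h0 h13 q hq] at this
    rw [Real.dist_eq]
    change |ε⁻¹ ^ w i * frameLog U X ρ (y ε q) (z ε q) i - _| < η
    rwa [inv_pow]
  -- `P₀` is not assumed continuous. Continuity of the scaled logarithm at the limit point for one
  -- fixed `ε`, together with uniform closeness to `P₀`, gives the joint limit.
  have hcts : ∀ ε, 0 < ε → ε < ε₃ →
      Tendsto (fun q => scaledLog U X ρ w (ε, q)) (𝓝 (p, a₀, b₀))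
        (𝓝 (scaledLog U X ρ w (ε, (p, a₀, b₀)))) := by
    intro ε h0 h1
    have hq₀ : pb (p, a₀, b₀) := hpb.self_of_nhds
    obtain ⟨-, -, -, k4, k5, k6, k7, k8, k9⟩ := hab (hpa ε h0 (h1.trans_le h31)) hq₀
    simp only at k4 k5 k6 k7 k8 k9
    have dx : Tendsto (fun q : M × (Fin n → ℝ) × (Fin n → ℝ) => q.1) (𝓝 (p, a₀, b₀)) (𝓝 p) :=
      continuousAt_fst
    have da : Tendsto (fun q : M × (Fin n → ℝ) × (Fin n → ℝ) => q.2.1) (𝓝 (p, a₀, b₀)) (𝓝 a₀) :=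
      continuous_snd.fst.continuousAt
    have db : Tendsto (fun q : M × (Fin n → ℝ) × (Fin n → ℝ) => q.2.2) (𝓝 (p, a₀, b₀)) (𝓝 b₀) :=
      continuous_snd.snd.continuousAt
    have uy := hρ.tendsto_frameExp hp k9 dx (tendsto_scale w (tendsto_const_nhds (x := ε)) db)
    have uz := hρ.tendsto_frameExp hp k8 dx (tendsto_scale w (tendsto_const_nhds (x := ε)) da)
    have uz' : Tendsto (z ε) (𝓝 (p, a₀, b₀)) (𝓝 (frameExp U X (y ε (p, a₀, b₀))
        (frameLog U X ρ (y ε (p, a₀, b₀)) (z ε (p, a₀, b₀))))) := by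
      rw [k6]
      exact uz
    have uL := (hρ.tendsto_frameLog h.isOpen k4 (k7.trans (by linarith)) uy uz').1
    exact tendsto_scale w (tendsto_const_nhds (x := ε⁻¹)) uL
  refine ⟨P₀ a₀ b₀ p, Metric.tendsto_nhds.2 fun η hη => ?_⟩
  obtain ⟨ε₄, hε₄, hu⟩ := hunif (η / 4) (by positivity)
  obtain ⟨ε, h0, h1⟩ := exists_between (show 0 < min ε₃ ε₄ by positivity)
  have d1 := Metric.tendsto_nhds.1 (hcts ε h0 (h1.trans_le (min_le_left _ _))) (η / 4)
    (by positivity)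
  have d2 := hu ε h0 (h1.trans_le (min_le_right _ _)) _ hpb.self_of_nhds
  filter_upwards [prod_mem_prod (Ioo_mem_nhdsGT hε₄) (hpb.and d1)] with t ht
  obtain ⟨ht1, ht2, ht3⟩ := ht
  have d3 := hu t.1 ht1.1 ht1.2 t.2 ht2
  have d4 := hu ε h0 (h1.trans_le (min_le_right _ _)) t.2 ht2
  have d5 := dist_triangle4 (scaledLog U X ρ w t) (P₀ t.2.2.1 t.2.2.2 t.2.1)
    (scaledLog U X ρ w (ε, t.2)) (scaledLog U X ρ w (ε, (p, a₀, b₀)))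
  have d6 := dist_triangle (scaledLog U X ρ w t) (scaledLog U X ρ w (ε, (p, a₀, b₀)))
    (P₀ a₀ b₀ p)
  rw [dist_comm (P₀ t.2.2.1 t.2.2.2 t.2.1)] at d5
  simp only at d2 d3 d4 d5 d6
  linarith

/-- The rescaled coordinates converge, locally uniformly. -/
theorem IsGoodRadius.exists_tendsto_scaledLog (hρ : IsGoodRadius U X ρ)
    (h : IsFrameSystem U X g) (hw : ∀ i, 1 ≤ w i) {p : M} (hp : p ∈ U)
    (hcomp : HasComposition U X w p) (a₀ b₀ : Fin n → ℝ) :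
    ∃ c, Tendsto (scaledLog U X ρ w) (𝓝[>] 0 ×ˢ 𝓝 (p, a₀, b₀)) (𝓝 c) := by
  obtain ⟨r, hr, hlim⟩ := hρ.exists_tendsto_scaledLog_of_small h hw hp hcomp
  have hs : ∀ a : Fin n → ℝ, ∀ᶠ μ : ℝ in 𝓝[>] 0, ‖scale w μ a‖ < r := by
    intro a
    have h1 := (tendsto_scale w (tendsto_nhds_of_tendsto_nhdsWithin
      (tendsto_id (x := 𝓝[>] (0 : ℝ)))) (tendsto_const_nhds (x := a))).norm
    rw [scale_zero_of_one_le hw, norm_zero] at h1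
    exact h1.eventually_lt_const hr
  -- Homogeneity reduces to small vectors: replacing `ε` by `ε / μ` and `a`, `b` by their scalings
  -- by `μ` leaves both points unchanged and changes the result only by the scaling by `μ`.
  obtain ⟨μ, ⟨ha, hb⟩, hμ⟩ := (((hs a₀).and (hs b₀)).and
    (self_mem_nhdsWithin (s := Ioi (0 : ℝ)))).exists
  have hμ : 0 < μ := hμ
  obtain ⟨c, hc⟩ := hlim _ _ ha hb
  have cε : Tendsto (fun t : ℝ × M × (Fin n → ℝ) × (Fin n → ℝ) => t.1 / μ)
      (𝓝[>] 0 ×ˢ 𝓝 (p, a₀, b₀)) (𝓝[>] 0) := by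
    refine tendsto_nhdsWithin_iff.2 ⟨?_, ?_⟩
    · have h1 : Tendsto (fun t : ℝ × M × (Fin n → ℝ) × (Fin n → ℝ) => t.1)
        (𝓝[>] 0 ×ˢ 𝓝 (p, a₀, b₀)) (𝓝 0) := tendsto_nhds_of_tendsto_nhdsWithin tendsto_fst
      simpa using h1.div_const μ
    · have h1 : ∀ᶠ t : ℝ × M × (Fin n → ℝ) × (Fin n → ℝ) in 𝓝[>] 0 ×ˢ 𝓝 (p, a₀, b₀), 0 < t.1 :=
        tendsto_fst.eventually (self_mem_nhdsWithin (s := Ioi (0 : ℝ)))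
      filter_upwards [h1] with t ht using div_pos ht hμ
  have cq : Tendsto (fun t : ℝ × M × (Fin n → ℝ) × (Fin n → ℝ) => t.2)
      (𝓝[>] 0 ×ˢ 𝓝 (p, a₀, b₀)) (𝓝 (p, a₀, b₀)) := tendsto_snd
  have h2 := Tendsto.comp hc (cε.prodMk (cq.fst_nhds.prodMk_nhds
    ((tendsto_scale w (tendsto_const_nhds (x := μ)) cq.snd_nhds.fst_nhds).prodMk_nhds
      (tendsto_scale w (tendsto_const_nhds (x := μ)) cq.snd_nhds.snd_nhds))))
  refine ⟨scale w μ⁻¹ c, (tendsto_scale w (tendsto_const_nhds (x := μ⁻¹)) h2).congr' ?_⟩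
  refine Eventually.of_forall fun t => ?_
  simp only [Function.comp_apply, scaledLog, scale_scale, div_mul_cancel₀ _ hμ.ne']
  congr 1
  field_simp

end Composition

/-! ### Uniform bi-Lipschitz bounds, homeomorphisms and extension to `ε = 0` -/

section Strong

set_option linter.unusedSectionVars false

variable {n : ℕ} {M : Type*} [MetricSpace M]
    [ChartedSpace (EuclideanSpace ℝ (Fin n)) M] [IsManifold (𝓡 n) ∞ M]
    {U : Set M} {X : Fin n → VField n M} {g : M → (Fin n → ℝ) → ℝ} {ρ : M → ℝ}
    {w : Fin n → ℕ} {ι : Type*} {l : Filter ι}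

/-- Near the diagonal all points are given by small coordinates. -/
theorem IsGoodRadius.eventually_diag (hρ : IsGoodRadius U X ρ) (h : IsFrameSystem U X g)
    {p : M} (hp : p ∈ U) {Φ : M × (Fin n → ℝ) × (Fin n → ℝ) → Prop}
    (hΦ : ∀ᶠ q in 𝓝 (p, 0, 0), Φ q) :
    ∀ᶠ q : M × M × M in 𝓝 (p, p, p), ∃ a b, q.1 ∈ U ∧ ‖a‖ < ρ q.1 ∧ ‖b‖ < ρ q.1 ∧
      frameExp U X q.1 a = q.2.1 ∧ frameExp U X q.1 b = q.2.2 ∧ Φ (q.1, a, b) := by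
  have cx : Tendsto (fun q : M × M × M => q.1) (𝓝 (p, p, p)) (𝓝 p) := continuousAt_fst
  have cu : Tendsto (fun q : M × M × M => q.2.1) (𝓝 (p, p, p)) (𝓝 p) :=
    continuous_snd.fst.continuousAt
  have cv : Tendsto (fun q : M × M × M => q.2.2) (𝓝 (p, p, p)) (𝓝 p) :=
    continuous_snd.snd.continuousAt
  obtain ⟨t1, e1⟩ := hρ.tendsto_frameLog h.isOpen hp (hρ.norm_zero_lt hp) cx
    (show Tendsto _ _ (𝓝 (frameExp U X p 0)) by rw [h.frameExp_zero hp]; exact cu)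
  obtain ⟨t2, e2⟩ := hρ.tendsto_frameLog h.isOpen hp (hρ.norm_zero_lt hp) cx
    (show Tendsto _ _ (𝓝 (frameExp U X p 0)) by rw [h.frameExp_zero hp]; exact cv)
  filter_upwards [e1, e2, (cx.prodMk_nhds (t1.prodMk_nhds t2)).eventually hΦ] with q h1 h2 h3
  exact ⟨_, _, h1.1, h1.2.1, h2.2.1, h1.2.2, h2.2.2, h3⟩

/-- Uniform comparison of the distance with the norm of the coordinates. -/
theorem IsGoodRadius.exists_biLipschitz (hρ : IsGoodRadius U X ρ) (h : IsFrameSystem U X g)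
    {K : Set M} (hKU : K ⊆ U) (hK : IsCompact K) :
    ∃ s > 0, ∃ c > 0, ∃ C > 0, ∀ x ∈ K, s ≤ ρ x ∧ ∀ a b : Fin n → ℝ, ‖a‖ < s → ‖b‖ < s →
      c * ‖a - b‖ ≤ dist (frameExp U X x a) (frameExp U X x b) ∧
      dist (frameExp U X x a) (frameExp U X x b) ≤ C * ‖a - b‖ := by
  refine hK.induction_on (p := fun D => ∃ s > 0, ∃ c > 0, ∃ C > 0, ∀ x ∈ D, s ≤ ρ x ∧
    ∀ a b : Fin n → ℝ, ‖a‖ < s → ‖b‖ < s →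
      c * ‖a - b‖ ≤ dist (frameExp U X x a) (frameExp U X x b) ∧
      dist (frameExp U X x a) (frameExp U X x b) ≤ C * ‖a - b‖)
    ⟨1, one_pos, 1, one_pos, 1, one_pos, by simp⟩ ?_ ?_ ?_
  · rintro D D' hD ⟨s, hs, c, hc, C, hC, hD'⟩
    exact ⟨s, hs, c, hc, C, hC, fun x hx => hD' x (hD hx)⟩
  · rintro D D' ⟨s, hs, c, hc, C, hC, hD⟩ ⟨s', hs', c', hc', C', hC', hD'⟩
    refine ⟨min s s', lt_min hs hs', min c c', lt_min hc hc', max C C', lt_max_of_lt_left hC, ?_⟩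
    rintro x (hx | hx)
    · refine ⟨(min_le_left _ _).trans (hD x hx).1, fun a b ha hb => ?_⟩
      obtain ⟨h1, h2⟩ := (hD x hx).2 a b (ha.trans_le (min_le_left _ _))
        (hb.trans_le (min_le_left _ _))
      refine ⟨le_trans ?_ h1, h2.trans ?_⟩
      · exact mul_le_mul_of_nonneg_right (min_le_left _ _) (norm_nonneg _)
      · exact mul_le_mul_of_nonneg_right (le_max_left _ _) (norm_nonneg _)
    · refine ⟨(min_le_right _ _).trans (hD' x hx).1, fun a b ha hb => ?_⟩
      obtain ⟨h1, h2⟩ := (hD' x hx).2 a b (ha.trans_le (min_le_right _ _))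
        (hb.trans_le (min_le_right _ _))
      refine ⟨le_trans ?_ h1, h2.trans ?_⟩
      · exact mul_le_mul_of_nonneg_right (min_le_right _ _) (norm_nonneg _)
      · exact mul_le_mul_of_nonneg_right (le_max_right _ _) (norm_nonneg _)
  · intro p hpK
    have hp := hKU hpK
    obtain ⟨C, hC, hgC⟩ := exists_le_mul_norm (h.norm_add_le p hp) (h.norm_smul p hp)
    obtain ⟨c, hc, hgc⟩ := exists_mul_norm_le (h.norm_add_le p hp) (h.norm_smul p hp)
      (h.norm_pos p hp)
    have e1 := h.eventually_dist_sub_le hp (half_pos hc)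
    rw [nhds_prod_eq, nhds_prod_eq] at e1
    obtain ⟨pa, ha, pb, hb, hab⟩ := eventually_prod_iff.1 e1
    obtain ⟨pc, hpc, pd, hpd, hcd⟩ := eventually_prod_iff.1 hb
    obtain ⟨s, hs, hsub⟩ := Metric.eventually_nhds_iff.1 (hpc.and hpd)
    have e2 : ∀ᶠ y in 𝓝 p, ρ p / 2 < ρ y :=
      (hρ.continuousOn.continuousAt (h.isOpen.mem_nhds hp)).eventually_const_lt
        (half_lt_self (hρ.pos p hp))
    refine ⟨{y | pa y ∧ ρ p / 2 < ρ y}, nhdsWithin_le_nhds (ha.and e2), min s (ρ p / 2),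
      lt_min hs (half_pos (hρ.pos p hp)), c / 2, half_pos hc, C + c / 2, by positivity,
      fun x hx => ⟨(min_le_right _ _).trans hx.2.le, fun a b ha' hb' => ?_⟩⟩
    have ha2 := hsub (y := a) (by simpa using ha'.trans_le (min_le_left _ _))
    have hb2 := hsub (y := b) (by simpa using hb'.trans_le (min_le_left _ _))
    have h1 := hab hx.1 (hcd ha2.1 hb2.2)
    simp only at h1
    have h2 := hgC (a - b)
    have h3 := hgc (a - b)
    rw [abs_le] at h1
    constructor <;> linarith

/-- The exponential map at `x`, as a homeomorphism from the ball of radius `ρ x`. -/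
noncomputable def IsGoodRadius.expHomeo (hρ : IsGoodRadius U X ρ) (hU : IsOpen U) {x : M}
    (hx : x ∈ U) : OpenPartialHomeomorph (Fin n → ℝ) M where
  toFun := frameExp U X x
  invFun := frameLog U X ρ x
  source := Metric.ball 0 (ρ x)
  target := frameExp U X x '' Metric.ball 0 (ρ x)
  map_source' _ ha := mem_image_of_mem _ ha
  map_target' := by
    rintro _ ⟨a, ha, rfl⟩
    rwa [hρ.frameLog_frameExp hx (by simpa using ha)]
  left_inv' a ha := hρ.frameLog_frameExp hx (by simpa using ha)
  right_inv' := by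
    rintro _ ⟨a, ha, rfl⟩
    rw [hρ.frameLog_frameExp hx (by simpa using ha)]
  open_source := Metric.isOpen_ball
  open_target := by
    refine isOpen_iff_mem_nhds.2 ?_
    rintro _ ⟨a, ha, rfl⟩
    filter_upwards [(hρ.tendsto_frameLog hU hx (by simpa using ha) tendsto_const_nhds
      tendsto_id).2] with u hu
    exact ⟨_, by simpa using hu.2.1, hu.2.2⟩
  continuousOn_toFun a ha := by
    have h := hρ.tendsto_frameExp hx (a₀ := a) (by simpa using ha)
      (tendsto_const_nhds (f := 𝓝 a) (x := x)) tendsto_id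
    exact ContinuousAt.continuousWithinAt h
  continuousOn_invFun := by
    rintro _ ⟨a, ha, rfl⟩
    have h := (hρ.tendsto_frameLog hU hx (by simpa using ha) tendsto_const_nhds tendsto_id).1
    rw [← hρ.frameLog_frameExp hx (a := a) (by simpa using ha)] at h
    refine ContinuousAt.continuousWithinAt ?_
    rw [hρ.frameLog_frameExp hx (a := a) (by simpa using ha)] at h
    unfold ContinuousAt
    rw [hρ.frameLog_frameExp hx (a := a) (by simpa using ha)]
    exact h

theorem riemDilation_map (ε : ℝ) (x u : M) :
    (riemDilation U X ρ).map ε x u = frameExp U X x (ε • frameLog U X ρ x u) := by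
  rw [← scale_const_one]
  rfl

theorem IsGoodRadius.riemDilation_frameExp (hρ : IsGoodRadius U X ρ) {x : M} (hx : x ∈ U)
    {a : Fin n → ℝ} (ha : ‖a‖ < ρ x) (ε : ℝ) :
    (riemDilation U X ρ).map ε x (frameExp U X x a) = frameExp U X x (ε • a) := by
  rw [riemDilation_map, hρ.frameLog_frameExp hx ha]

theorem mem_riemDilation_dom {ε : ℝ} {x u : M} :
    u ∈ (riemDilation U X ρ).dom ε x ↔
      ∃ a, ‖a‖ < ρ x ∧ ‖ε • a‖ < ρ x ∧ frameExp U X x a = u := by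
  simp_rw [← scale_const_one]
  exact mem_frameMaps_dom

/-- The dilation is multiplication by `ε` conjugated by the exponential homeomorphism of the ball.
For `ε > 1` the inverse shrinks the ball, so the target is all of `U(x)`. -/
theorem IsGoodRadius.exists_riemDilation_homeo (hρ : IsGoodRadius U X ρ) (hU : IsOpen U) {x : M}
    (hx : x ∈ U) {ε : ℝ} (hε : 0 < ε) : ∃ e : OpenPartialHomeomorph M M,
      e.source = (riemDilation U X ρ).dom ε x ∧
      EqOn e ((riemDilation U X ρ).map ε x) ((riemDilation U X ρ).dom ε x) ∧
      (1 < ε → e.target = (riemDilation U X ρ).U x) := by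
  set E := hρ.expHomeo hU hx with hE
  set m := (Homeomorph.smulOfNeZero ε hε.ne' : (Fin n → ℝ) ≃ₜ (Fin n → ℝ)) with hm
  refine ⟨(E.symm.trans m.toOpenPartialHomeomorph).trans E, ?_, ?_, ?_⟩
  · ext u
    rw [mem_riemDilation_dom, OpenPartialHomeomorph.trans_source,
      OpenPartialHomeomorph.trans_source]
    constructor
    · rintro ⟨⟨⟨a, ha, rfl⟩, -⟩, h2⟩
      refine ⟨a, by simpa using ha, ?_, rfl⟩
      have h3 : ε • frameLog U X ρ x (frameExp U X x a) ∈ Metric.ball 0 (ρ x) := h2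
      rw [hρ.frameLog_frameExp hx (by simpa using ha)] at h3
      simpa using h3
    · rintro ⟨a, ha, ha', rfl⟩
      refine ⟨⟨⟨a, by simpa using ha, rfl⟩, mem_univ _⟩, ?_⟩
      change ε • frameLog U X ρ x (frameExp U X x a) ∈ Metric.ball 0 (ρ x)
      rw [hρ.frameLog_frameExp hx ha]
      simpa using ha'
  · intro u _
    rw [riemDilation_map]
    rfl
  · intro hε1
    ext u
    refine Iff.trans ?_ mem_frameMaps_U.symm
    rw [OpenPartialHomeomorph.trans_target, OpenPartialHomeomorph.trans_target]
    constructor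
    · rintro ⟨⟨a, ha, rfl⟩, -⟩
      exact ⟨a, by simpa using ha, rfl⟩
    · rintro ⟨a, ha, rfl⟩
      refine ⟨⟨a, by simpa using ha, rfl⟩, mem_univ _, ?_⟩
      change ε⁻¹ • frameLog U X ρ x (frameExp U X x a) ∈ Metric.ball 0 (ρ x)
      rw [hρ.frameLog_frameExp hx ha, mem_ball_zero_iff, norm_smul, norm_inv,
        Real.norm_of_nonneg hε.le]
      refine lt_of_le_of_lt ?_ ha
      exact mul_le_of_le_one_left (norm_nonneg _) (inv_le_one_of_one_le₀ hε1.le)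

/-- The points of the closure of the domain of the dilations have coordinates in the closed
ball. -/
theorem IsGoodRadius.exists_of_mem_closure (hρ : IsGoodRadius U X ρ) (hU : IsOpen U) {σ : M → ℝ}
    (hσ : IsGoodRadius U X σ) (hρσ : ∀ x ∈ U, ρ x < σ x) {p : ℝ × M × M}
    (hp : p ∈ closure {p : ℝ × M × M | 0 < p.1 ∧ p.2.1 ∈ U ∧
      p.2.2 ∈ (riemDilation U X ρ).dom p.1 p.2.1}) (hpU : p.2.1 ∈ U) :
    ∃ a, ‖a‖ < σ p.2.1 ∧ ‖p.1 • a‖ < σ p.2.1 ∧ frameExp U X p.2.1 a = p.2.2 := by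
  obtain ⟨𝓤, h𝓤, hle⟩ := mem_closure_iff_ultrafilter.1 hp
  have h1 : ∀ᶠ q in (𝓤 : Filter (ℝ × M × M)), ∃ a, ‖a‖ < ρ q.2.1 ∧ ‖q.1 • a‖ < ρ q.2.1 ∧
      frameExp U X q.2.1 a = q.2.2 := by
    filter_upwards [h𝓤] with q hq
    exact mem_riemDilation_dom.1 hq.2.2
  obtain ⟨a, ha⟩ := h1.choice
  have c0 : Tendsto id (𝓤 : Filter (ℝ × M × M)) (𝓝 p) := hle
  have c1 := c0.fst_nhds
  have c2 := c0.snd_nhds.fst_nhds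
  have c3 := c0.snd_nhds.snd_nhds
  have cρ : Tendsto (fun q : ℝ × M × M => ρ q.2.1) (𝓤 : Filter (ℝ × M × M)) (𝓝 (ρ p.2.1)) :=
    Tendsto.comp (hρ.continuousOn.continuousAt (hU.mem_nhds hpU)) c2
  -- Near `p` the radii are bounded, so the coordinate vectors converge along the ultrafilter. Their
  -- limit obeys only weak inequalities with `ρ`; the gap between `ρ` and `σ` makes them strict for
  -- `σ`.
  have hbd : ∀ᶠ q in (𝓤 : Filter (ℝ × M × M)), a q ∈ Metric.closedBall (0 : Fin n → ℝ)
      (ρ p.2.1 + 1) := by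
    filter_upwards [ha, cρ.eventually_lt_const (lt_add_one _)] with q hq hq'
    simpa using (hq.1.trans hq').le
  obtain ⟨a₀, -, ha₀⟩ := (isCompact_closedBall (0 : Fin n → ℝ) (ρ p.2.1 + 1)).ultrafilter_le_nhds
    (𝓤.map a) (le_principal_iff.2 hbd)
  have ca : Tendsto a (𝓤 : Filter (ℝ × M × M)) (𝓝 a₀) := ha₀
  have n1 : ‖a₀‖ < σ p.2.1 :=
    (le_of_tendsto_of_tendsto ca.norm cρ (ha.mono fun q hq => hq.1.le)).trans_lt (hρσ _ hpU)
  have n2 : ‖p.1 • a₀‖ < σ p.2.1 :=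
    (le_of_tendsto_of_tendsto (c1.smul ca).norm cρ (ha.mono fun q hq => hq.2.1.le)).trans_lt
      (hρσ _ hpU)
  refine ⟨a₀, n1, n2, tendsto_nhds_unique ((hσ.tendsto_frameExp hpU n1 c2 ca).congr' ?_) c3⟩
  filter_upwards [ha] with q hq using hq.2.2

/-- The same formula with the logarithm for the larger radius `σ` extends the dilations: points of
the closure have coordinates in the closed `ρ`-ball, which lies in the open `σ`-ball where
everything is continuous, including at `ε = 0`. -/
theorem IsGoodRadius.riemDilation_extension (hρ : IsGoodRadius U X ρ) (h : IsFrameSystem U X g)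
    {σ : M → ℝ} (hσ : IsGoodRadius U X σ) (hρσ : ∀ x ∈ U, ρ x < σ x) :
    ∃ F : ℝ × M × M → M,
    (∀ ε > 0, ∀ x ∈ U, ∀ y ∈ (riemDilation U X ρ).dom ε x,
      F (ε, x, y) = (riemDilation U X ρ).map ε x y) ∧
    ContinuousOn F (closure {p : ℝ × M × M | 0 < p.1 ∧ p.2.1 ∈ U ∧
      p.2.2 ∈ (riemDilation U X ρ).dom p.1 p.2.1} ∩ {p | p.2.1 ∈ U ∧ p.2.2 ∈ U}) ∧
    MapsTo F (closure {p : ℝ × M × M | 0 < p.1 ∧ p.2.1 ∈ U ∧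
      p.2.2 ∈ (riemDilation U X ρ).dom p.1 p.2.1} ∩ {p | p.2.1 ∈ U ∧ p.2.2 ∈ U}) U ∧
    ∀ x ∈ U, ∀ y ∈ (riemDilation U X ρ).U x, F (0, x, y) = x := by
  refine ⟨fun p => frameExp U X p.2.1 (p.1 • frameLog U X σ p.2.1 p.2.2), ?_, ?_, ?_, ?_⟩
  · intro ε _ x hx y hy
    obtain ⟨a, ha, -, rfl⟩ := mem_riemDilation_dom.1 hy
    rw [hρ.riemDilation_frameExp hx ha]
    simp only
    rw [hσ.frameLog_frameExp hx (ha.trans (hρσ x hx))]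
  · rintro p ⟨hp, hpU, -⟩
    obtain ⟨a, ha, ha', heq⟩ := hρ.exists_of_mem_closure h.isOpen hσ hρσ hp hpU
    refine ContinuousAt.continuousWithinAt ?_
    have c0 : Tendsto id (𝓝 p) (𝓝 p) := tendsto_id
    have c3 := c0.snd_nhds.snd_nhds
    rw [← heq] at c3
    have cL := (hσ.tendsto_frameLog h.isOpen hpU ha c0.snd_nhds.fst_nhds c3).1
    have cF := hσ.tendsto_frameExp hpU ha' c0.snd_nhds.fst_nhds (c0.fst_nhds.smul cL)
    have hval : frameLog U X σ p.2.1 p.2.2 = a := by rw [← heq, hσ.frameLog_frameExp hpU ha]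
    rw [← hval] at cF
    exact cF
  · rintro p ⟨-, hpU, -⟩
    exact frameExp_mem hpU _
  · intro x hx y _
    simp only [zero_smul]
    exact h.frameExp_zero hx


end Strong

/-! ### The strong dilation structure of the Riemannian dilations -/

section Strong

set_option linter.unusedSectionVars false

variable {n : ℕ} {M : Type*} [MetricSpace M]
    [ChartedSpace (EuclideanSpace ℝ (Fin n)) M] [IsManifold (𝓡 n) ∞ M]
    {U : Set M} {X : Fin n → VField n M} {g : M → (Fin n → ℝ) → ℝ} {ρ : M → ℝ}
    {w : Fin n → ℕ} {ι : Type*} {l : Filter ι}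

theorem tendsto_inv_smul_smul {ε : ι → ℝ} (hε : Tendsto ε l (𝓝[>] 0)) {a : ι → Fin n → ℝ}
    {a₀ : Fin n → ℝ} (ha : Tendsto a l (𝓝 a₀)) :
    Tendsto (fun i => (ε i)⁻¹ • ε i • a i) l (𝓝 a₀) := by
  refine ha.congr' ?_
  filter_upwards [hε.eventually self_mem_nhdsWithin] with i hi
  rw [inv_smul_smul₀ (ne_of_gt hi)]

/-- The moving base point tends to `x₀`, while the rescaled logarithm between the two dilated points
tends to `b - a`. -/
theorem IsGoodRadius.tendsto_approxDiff (hρ : IsGoodRadius U X ρ) (h : IsFrameSystem U X g)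
    {x₀ : M} (hx₀ : x₀ ∈ U) {a b : Fin n → ℝ} (ha : ‖a‖ < ρ x₀) (hb : ‖b‖ < ρ x₀)
    (hab : ‖b - a‖ < ρ x₀) {ε : ι → ℝ} {x u v : ι → M} (hε : Tendsto ε l (𝓝[>] 0))
    (hx : Tendsto x l (𝓝 x₀)) (hu : Tendsto u l (𝓝 (frameExp U X x₀ a)))
    (hv : Tendsto v l (𝓝 (frameExp U X x₀ b))) :
    Tendsto (fun i => approxDiff (riemDilation U X ρ) (ε i) (x i) (u i) (v i)) l
      (𝓝 (frameExp U X x₀ (b - a))) := by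
  have ta := (hρ.tendsto_frameLog h.isOpen hx₀ ha hx hu).1
  have tb := (hρ.tendsto_frameLog h.isOpen hx₀ hb hx hv).1
  have t1 := hρ.tendsto_inv_smul_frameLog h hx₀ hε hx (tendsto_inv_smul_smul hε ta)
    (tendsto_inv_smul_smul hε tb)
  have t2 := (tendsto_nhds_of_tendsto_nhdsWithin hε).smul ta
  rw [zero_smul] at t2
  have t3 := hρ.tendsto_frameExp hx₀ (hρ.norm_zero_lt hx₀) hx t2
  rw [h.frameExp_zero hx₀] at t3
  have t4 := hρ.tendsto_frameExp hx₀ hab t3 t1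
  refine t4.congr fun i => ?_
  simp only [approxDiff, riemDilation_map]

theorem IsGoodRadius.eventually_mem_dom_inv (hρ : IsGoodRadius U X ρ) (h : IsFrameSystem U X g)
    {x₀ : M} (hx₀ : x₀ ∈ U) {a b : Fin n → ℝ} (ha : ‖a‖ < ρ x₀) (hb : ‖b‖ < ρ x₀)
    (hab : ‖b - a‖ < ρ x₀) {ε : ι → ℝ} {x u v : ι → M} (hε : Tendsto ε l (𝓝[>] 0))
    (hx : Tendsto x l (𝓝 x₀)) (hu : Tendsto u l (𝓝 (frameExp U X x₀ a)))
    (hv : Tendsto v l (𝓝 (frameExp U X x₀ b))) :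
    ∀ᶠ i in l, (riemDilation U X ρ).map (ε i) (x i) (v i) ∈
      (riemDilation U X ρ).dom (ε i)⁻¹ ((riemDilation U X ρ).map (ε i) (x i) (u i)) := by
  have ta := (hρ.tendsto_frameLog h.isOpen hx₀ ha hx hu).1
  have tb := (hρ.tendsto_frameLog h.isOpen hx₀ hb hx hv).1
  have t1 := hρ.tendsto_inv_smul_frameLog h hx₀ hε hx (tendsto_inv_smul_smul hε ta)
    (tendsto_inv_smul_smul hε tb)
  have t2 := (tendsto_nhds_of_tendsto_nhdsWithin hε).smul ta
  have t2' := (tendsto_nhds_of_tendsto_nhdsWithin hε).smul tb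
  rw [zero_smul] at t2 t2'
  have t3 := hρ.tendsto_frameExp hx₀ (hρ.norm_zero_lt hx₀) hx t2
  have t3' := hρ.tendsto_frameExp hx₀ (hρ.norm_zero_lt hx₀) hx t2'
  rw [h.frameExp_zero hx₀] at t3
  have e1 := (hρ.tendsto_frameLog h.isOpen hx₀ (hρ.norm_zero_lt hx₀) t3 t3').2
  filter_upwards [e1, hρ.eventually_lt h.isOpen hx₀ hab t3 t1] with i h1 h2
  rw [riemDilation_map, riemDilation_map, mem_riemDilation_dom]
  exact ⟨_, h1.2.1, h2, h1.2.2⟩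

theorem IsGoodRadius.tendsto_dist_riemDilation (hρ : IsGoodRadius U X ρ)
    (h : IsFrameSystem U X g) {x₀ : M} (hx₀ : x₀ ∈ U) {a b : Fin n → ℝ} (ha : ‖a‖ < ρ x₀)
    (hb : ‖b‖ < ρ x₀) {ε : ι → ℝ} {x u v : ι → M} (hε : Tendsto ε l (𝓝[>] 0))
    (hx : Tendsto x l (𝓝 x₀)) (hu : Tendsto u l (𝓝 (frameExp U X x₀ a)))
    (hv : Tendsto v l (𝓝 (frameExp U X x₀ b))) :
    Tendsto (fun i => dist ((riemDilation U X ρ).map (ε i) (x i) (u i))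
      ((riemDilation U X ρ).map (ε i) (x i) (v i)) / ε i) l (𝓝 (g x₀ (a - b))) := by
  have ta := (hρ.tendsto_frameLog h.isOpen hx₀ ha hx hu).1
  have tb := (hρ.tendsto_frameLog h.isOpen hx₀ hb hx hv).1
  simp only [riemDilation_map]
  exact h.tendsto_dist_div hx₀ hε hx (tendsto_inv_smul_smul hε ta) (tendsto_inv_smul_smul hε tb)

variable [LocallyCompactSpace M]

/-- On a compact set, `c‖a - b‖` and `C‖a - b‖` bound the distance of points with coordinates below
`s`. The inclusions of (A0) follow by pulling back coordinates, and the limit distance is the norm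
at `x` of the difference of the coordinates. -/
theorem IsGoodRadius.a0_a3 (hρ : IsGoodRadius U X ρ) (h : IsFrameSystem U X g) {K : Set M}
    (hKU : K ⊆ U) (hK : IsCompact K) :
    ∃ r A B : ℝ, 0 < r ∧ 1 < A ∧ A < B ∧
    (∀ x ∈ K, IsCompact (Metric.closedBall x (r * 3)) ∧ Metric.closedBall x (r * 3) ⊆ U) ∧
    (∀ x ∈ K, Metric.closedBall x (r * A) ⊆ (riemDilation U X ρ).U x) ∧
    (∀ x ∈ K, ∀ ε, 0 < ε → ε < 1 →
      Metric.ball x (r * ε) ⊆ (riemDilation U X ρ).map ε x '' Metric.ball x (r * A) ∧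
      (riemDilation U X ρ).map ε x '' Metric.ball x (r * A) ⊆
        (riemDilation U X ρ).map ε x '' (riemDilation U X ρ).U x ∧
      (riemDilation U X ρ).map ε x '' (riemDilation U X ρ).U x ⊆
        (riemDilation U X ρ).dom ε⁻¹ x ∧
      (riemDilation U X ρ).dom ε⁻¹ x ⊆ (riemDilation U X ρ).map ε x ''
        (Metric.ball x (r * B) ∩ (riemDilation U X ρ).U x)) ∧
    (∃ R > 0, ∃ ε₀ ∈ Ioo (0 : ℝ) 1, ∀ x ∈ K,
      Metric.closedBall x R ⊆ (riemDilation U X ρ).U x ∧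
      ∀ u ∈ Metric.closedBall x R, ∀ v ∈ Metric.closedBall x R, ∀ ε ∈ Ioo 0 ε₀,
        (riemDilation U X ρ).map ε x v ∈
          (riemDilation U X ρ).dom ε⁻¹ ((riemDilation U X ρ).map ε x u)) ∧
    (∀ x ∈ K, ∀ u ∈ Metric.closedBall x (r * A), ∀ v ∈ Metric.closedBall x (r * A),
      (g x (frameLog U X ρ x u - frameLog U X ρ x v) = 0 ↔ u = v) ∧
      g x (frameLog U X ρ x u - frameLog U X ρ x v) =
        g x (frameLog U X ρ x v - frameLog U X ρ x u) ∧
      ∀ y ∈ Metric.closedBall x (r * A), g x (frameLog U X ρ x u - frameLog U X ρ x y) ≤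
        g x (frameLog U X ρ x u - frameLog U X ρ x v) +
        g x (frameLog U X ρ x v - frameLog U X ρ x y)) ∧
    ∀ η > 0, ∃ ε₀ > 0, ∀ ε, 0 < ε → ε < ε₀ → ∀ x ∈ K,
      ∀ u ∈ Metric.closedBall x (r * A), ∀ v ∈ Metric.closedBall x (r * A),
        |dist ((riemDilation U X ρ).map ε x u) ((riemDilation U X ρ).map ε x v) / ε -
          g x (frameLog U X ρ x u - frameLog U X ρ x v)| < η := by
  obtain ⟨s, hs, c, hc, C, hC, hbi⟩ := hρ.exists_biLipschitz h hKU hK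
  have hΦ : ∀ p : M, ∀ᶠ q : M × (Fin n → ℝ) × (Fin n → ℝ) in 𝓝 (p, 0, 0),
      ‖q.2.1‖ < s / 2 ∧ ‖q.2.2‖ < s / 2 := by
    intro p
    have c2 : Tendsto (fun q : M × (Fin n → ℝ) × (Fin n → ℝ) => ‖q.2.1‖) (𝓝 (p, 0, 0)) (𝓝 ‖(0 : Fin n → ℝ)‖) :=
      (continuous_snd.fst).norm.continuousAt
    have c3 : Tendsto (fun q : M × (Fin n → ℝ) × (Fin n → ℝ) => ‖q.2.2‖) (𝓝 (p, 0, 0)) (𝓝 ‖(0 : Fin n → ℝ)‖) :=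
      (continuous_snd.snd).norm.continuousAt
    rw [norm_zero] at c2 c3
    exact (c2.eventually_lt_const (half_pos hs)).and (c3.eventually_lt_const (half_pos hs))
  obtain ⟨R, hR, hcpt, hcb, hRU, htube⟩ := IsCompact.exists_tube hK h.isOpen hKU
    fun x hx => hρ.eventually_diag h (hKU hx) (hΦ x)
  have hsmall : ∀ x ∈ K, ∀ u ∈ Metric.closedBall x R, ∃ a, ‖a‖ < s / 2 ∧ frameExp U X x a = u := by
    intro x hx u hu
    obtain ⟨a, b, -, -, -, h1, -, h2, -⟩ := htube (x, u, u) (mem_tube hx hu hu)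
    exact ⟨a, h2, h1⟩
  have hsρ : ∀ x ∈ K, ∀ a : Fin n → ℝ, ‖a‖ < s → ‖a‖ < ρ x := fun x hx a ha =>
    ha.trans_le (hbi x hx).1
  have hRd : ∀ x ∈ K, Metric.closedBall x R ⊆ (riemDilation U X ρ).U x := by
    intro x hx u hu
    obtain ⟨a, ha, rfl⟩ := hsmall x hx u hu
    exact mem_frameMaps_U.2 ⟨a, hsρ x hx a (by linarith), rfl⟩
  -- Undoing a dilation can enlarge the distance to `x`, relative to `ε`, by at most the distortion
  -- `C / c`; the summand `1` makes the inclusion strict.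
  set A := C / c + 1 with hA
  have hA1 : 1 < A := by
    have : 0 < C / c := by positivity
    linarith
  -- The first bound puts the balls of radii `r * A` and `r * 3` inside the tube. The second keeps
  -- the coordinates below `s` after multiplication by `ε⁻¹`.
  set r := min (R / (A + 3)) (c * s / 2) with hr
  have hr0 : 0 < r := by positivity
  have hrA3 : r * (A + 3) ≤ R := by
    calc r * (A + 3) ≤ R / (A + 3) * (A + 3) := by gcongr; exact min_le_left _ _
      _ = R := by field_simp
  have hrA : r * A ≤ R := by nlinarith
  have hr3 : r * 3 ≤ R := by nlinarith
  have hrs : r ≤ c * s / 2 := min_le_right _ _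
  have hrR : r ≤ R := by nlinarith
  have hcbA : ∀ x : M, Metric.closedBall x (r * A) ⊆ Metric.closedBall x R := fun x =>
    Metric.closedBall_subset_closedBall hrA
  -- The value of `B` gives `r * B > 1`, and good radii keep all of `U(x)` within distance `1` of
  -- `x`.
  refine ⟨r, A, A + 1 / r + 1, hr0, hA1, ?_, ?_, ?_, ?_, ?_, ?_, ?_⟩
  · have : 0 < 1 / r := by positivity
    linarith
  · intro x hx
    have h1 := Metric.closedBall_subset_closedBall (x := x) hr3
    exact ⟨(hcb x hx).of_isClosed_subset Metric.isClosed_closedBall h1, h1.trans (hRU x hx)⟩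
  · exact fun x hx => (hcbA x).trans (hRd x hx)
  · intro x hx ε h0 h1
    have hxU := hKU hx
    refine ⟨?_, ?_, ?_, ?_⟩
    · intro u hu
      have hu' : dist u x < r * ε := hu
      have hrε : r * ε ≤ r := mul_le_of_le_one_right hr0.le h1.le
      obtain ⟨a, ha, rfl⟩ := hsmall x hx u (Metric.mem_closedBall.2 (by linarith))
      have h2 := ((hbi x hx).2 a 0 (by linarith) (by simpa using hs)).1
      rw [h.frameExp_zero hxU, sub_zero] at h2
      have h3 : c * ‖ε⁻¹ • a‖ < r := by
        rw [norm_smul, norm_inv, Real.norm_of_nonneg h0.le]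
        calc c * (ε⁻¹ * ‖a‖) = ε⁻¹ * (c * ‖a‖) := by ring
          _ < ε⁻¹ * (r * ε) := mul_lt_mul_of_pos_left (h2.trans_lt hu') (inv_pos.2 h0)
          _ = r := by field_simp
      have h4 : ‖ε⁻¹ • a‖ < s := by
        have : c * ‖ε⁻¹ • a‖ < c * s := by nlinarith
        exact lt_of_mul_lt_mul_left this hc.le
      refine ⟨frameExp U X x (ε⁻¹ • a), ?_, ?_⟩
      · have h5 := ((hbi x hx).2 (ε⁻¹ • a) 0 h4 (by simpa using hs)).2
        rw [h.frameExp_zero hxU, sub_zero] at h5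
        refine Metric.mem_ball.2 (h5.trans_lt ?_)
        calc C * ‖ε⁻¹ • a‖ = C / c * (c * ‖ε⁻¹ • a‖) := by field_simp
          _ ≤ C / c * r := by gcongr
          _ < r * A := by rw [hA]; nlinarith
      · rw [hρ.riemDilation_frameExp hxU (hsρ x hx _ h4), smul_inv_smul₀ h0.ne']
    · exact image_mono ((Metric.ball_subset_closedBall.trans (hcbA x)).trans (hRd x hx))
    · exact (hρ.frameMaps_dom_inv hxU h0 h1.le).superset
    · intro u hu
      obtain ⟨a, ha, ha', rfl⟩ := mem_riemDilation_dom.1 hu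
      refine ⟨frameExp U X x (ε⁻¹ • a), ⟨?_, mem_frameMaps_U.2 ⟨_, ha', rfl⟩⟩, ?_⟩
      · have h2 := (hρ.good x hxU).dist_le _ ha'
        refine Metric.mem_ball.2 (h2.trans_lt ?_)
        have h3 : r * (A + 1 / r + 1) = r * A + 1 + r := by field_simp
        rw [h3]
        nlinarith
      · rw [hρ.riemDilation_frameExp hxU ha', smul_inv_smul₀ h0.ne']
  · have hev : ∀ q ∈ tube K R, ∀ᶠ z : ℝ × M × M × M in 𝓝[>] 0 ×ˢ 𝓝 q,
        (riemDilation U X ρ).map z.1 z.2.1 z.2.2.2 ∈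
          (riemDilation U X ρ).dom z.1⁻¹ ((riemDilation U X ρ).map z.1 z.2.1 z.2.2.1) := by
      rintro ⟨x, u, v⟩ ⟨hx, hu, hv⟩
      obtain ⟨a, ha, rfl⟩ := hsmall x hx u hu
      obtain ⟨b, hb, rfl⟩ := hsmall x hx v hv
      have c0 : Tendsto (fun z : ℝ × M × M × M => z.2)
        (𝓝[>] 0 ×ˢ 𝓝 (x, frameExp U X x a, frameExp U X x b))
        (𝓝 (x, frameExp U X x a, frameExp U X x b)) := tendsto_snd
      refine hρ.eventually_mem_dom_inv h (hKU hx) (hsρ x hx a (by linarith))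
        (hsρ x hx b (by linarith)) (hsρ x hx _ ?_) tendsto_fst c0.fst_nhds
        c0.snd_nhds.fst_nhds c0.snd_nhds.snd_nhds
      have := norm_sub_le b a
      linarith
    obtain ⟨ε₀, h0, h1⟩ := eventually_nhdsGT_zero_iff.1
      (IsCompact.eventually_forall_of_eventually_prod hcpt hev)
    refine ⟨R, hR, min ε₀ (1 / 2), ⟨by positivity, (min_le_right _ _).trans_lt (by norm_num)⟩,
      fun x hx => ⟨hRd x hx, fun u hu v hv ε hε => ?_⟩⟩
    exact h1 ε hε.1 (hε.2.trans_le (min_le_left _ _)) (x, u, v) (mem_tube hx hu hv)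
  · intro x hx u hu v hv
    have hxU := hKU hx
    have hsymm : ∀ v w, g x (v - w) = g x (w - v) := fun v w => by
      have := h.norm_smul x hxU (-1) (w - v)
      rw [neg_one_smul, neg_sub, abs_neg, abs_one, one_mul] at this
      exact this
    refine ⟨?_, hsymm _ _, fun y _ => ?_⟩
    · obtain ⟨a, ha, rfl⟩ := hsmall x hx u (hcbA x hu)
      obtain ⟨b, hb, rfl⟩ := hsmall x hx v (hcbA x hv)
      rw [hρ.frameLog_frameExp hxU (hsρ x hx a (by linarith)),
        hρ.frameLog_frameExp hxU (hsρ x hx b (by linarith))]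
      constructor
      · intro h0
        by_contra hne
        refine (h.norm_pos x hxU (a - b) ?_).ne' h0
        exact fun h1 => hne (by rw [sub_eq_zero.1 h1])
      · intro h0
        rw [hρ.frameExp_inj hxU (hsρ x hx a (by linarith)) (hsρ x hx b (by linarith)) h0, sub_self]
        simpa using h.norm_smul x hxU 0 0
    · have := h.norm_add_le x hxU (frameLog U X ρ x u - frameLog U X ρ x v)
        (frameLog U X ρ x v - frameLog U X ρ x y)
      rwa [sub_add_sub_cancel] at this
  · intro η hη
    have hlim : ∀ q ∈ tube K R, Tendsto (fun z : ℝ × M × M × M =>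
        dist ((riemDilation U X ρ).map z.1 z.2.1 z.2.2.1)
          ((riemDilation U X ρ).map z.1 z.2.1 z.2.2.2) / z.1) (𝓝[>] 0 ×ˢ 𝓝 q)
        (𝓝 (g q.1 (frameLog U X ρ q.1 q.2.1 - frameLog U X ρ q.1 q.2.2))) := by
      rintro ⟨x, u, v⟩ ⟨hx, hu, hv⟩
      obtain ⟨a, ha, rfl⟩ := hsmall x hx u hu
      obtain ⟨b, hb, rfl⟩ := hsmall x hx v hv
      have ha' := hsρ x hx a (by linarith)
      have hb' := hsρ x hx b (by linarith)
      have c0 : Tendsto (fun z : ℝ × M × M × M => z.2)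
        (𝓝[>] 0 ×ˢ 𝓝 (x, frameExp U X x a, frameExp U X x b))
        (𝓝 (x, frameExp U X x a, frameExp U X x b)) := tendsto_snd
      simp only
      rw [hρ.frameLog_frameExp (hKU hx) ha', hρ.frameLog_frameExp (hKU hx) hb']
      exact hρ.tendsto_dist_riemDilation h (hKU hx) ha' hb' tendsto_fst c0.fst_nhds
        c0.snd_nhds.fst_nhds c0.snd_nhds.snd_nhds
    obtain ⟨ε₀, h0, h1⟩ := eventually_nhdsGT_zero_iff.1
      (IsCompact.eventually_dist_lt_of_tendsto_prod hcpt
        (f := fun q => g q.1 (frameLog U X ρ q.1 q.2.1 - frameLog U X ρ q.1 q.2.2)) hlim hη)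
    exact ⟨ε₀, h0, fun ε h2 h3 x hx u hu v hv =>
      h1 ε h2 h3 (x, u, v) (mem_tube hx (hcbA x hu) (hcbA x hv))⟩

theorem IsGoodRadius.exists_uniformLimitNear_approxDiff (hρ : IsGoodRadius U X ρ)
    (h : IsFrameSystem U X g) :
    ∃ Δ : M → M → M → M, UniformLimitNear U (approxDiff (riemDilation U X ρ)) Δ := by
  refine ⟨fun x u v => frameExp U X x (frameLog U X ρ x v - frameLog U X ρ x u),
    uniformLimitNear_of_tendsto h.isOpen (fun x hx u v => frameExp_mem hx _) fun p hp => ?_⟩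
  have hΦ : ∀ᶠ q : M × (Fin n → ℝ) × (Fin n → ℝ) in 𝓝 (p, 0, 0), ‖q.2.2 - q.2.1‖ < ρ q.1 := by
    refine hρ.eventually_lt h.isOpen hp (hρ.norm_zero_lt hp) continuousAt_fst ?_
    have : Continuous fun q : M × (Fin n → ℝ) × (Fin n → ℝ) => q.2.2 - q.2.1 := by fun_prop
    have := this.tendsto (p, 0, 0)
    simpa using this
  filter_upwards [hρ.eventually_diag h hp hΦ] with q hq
  obtain ⟨a, b, hx, ha, hb, h1, h2, hab⟩ := hq
  obtain ⟨x, u, v⟩ := q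
  simp only at hx ha hb h1 h2 hab
  subst h1 h2
  have c0 : Tendsto (fun z : ℝ × M × M × M => z.2)
    (𝓝[>] 0 ×ˢ 𝓝 (x, frameExp U X x a, frameExp U X x b))
    (𝓝 (x, frameExp U X x a, frameExp U X x b)) := tendsto_snd
  simp only
  rw [hρ.frameLog_frameExp hx ha, hρ.frameLog_frameExp hx hb]
  exact hρ.tendsto_approxDiff h hx ha hb hab tendsto_fst c0.fst_nhds c0.snd_nhds.fst_nhds
    c0.snd_nhds.snd_nhds

theorem IsGoodRadius.isStrongDilationStructure (hρ : IsGoodRadius U X ρ)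
    (h : IsFrameSystem U X g) {σ : M → ℝ} (hσ : IsGoodRadius U X σ)
    (hρσ : ∀ x ∈ U, ρ x < σ x) : IsStrongDilationStructure U (riemDilation U X ρ) where
  dom_le_one _ _ _ h0 h1 := frameMaps_dom_le_one h0 h1
  U_subset _ hx := frameMaps_dom_subset hx
  mem_dom _ hx ε _ := hρ.mem_dom_self h hx ε
  mapsTo _ hx _ _ u _ := frameMaps_map_mem hx u
  homeo _ hx _ hε := hρ.exists_riemDilation_homeo h.isOpen hx hε
  a0_a3 := ⟨fun x u v => g x (frameLog U X ρ x u - frameLog U X ρ x v),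
    fun _ hKU hK => hρ.a0_a3 h hKU hK⟩
  a1_base _ hx ε _ := hρ.map_self h hx ε
  a1_one _ hx _ hu := hρ.frameMaps_map_one hx hu
  a1_extension := hρ.riemDilation_extension h hσ hρσ
  a2_dom _ hx _ _ _ _ _ hu := hρ.frameMaps_comp_dom hx hu
  a2_eq _ hx _ _ _ _ _ hu _ := hρ.frameMaps_comp hx hu
  a4 := hρ.exists_uniformLimitNear_approxDiff h

end Strong

/-! ### The coherent projection and condition (A) -/

section Projection

set_option linter.unusedSectionVars false

variable {n : ℕ} {M : Type*} [MetricSpace M]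
    [ChartedSpace (EuclideanSpace ℝ (Fin n)) M] [IsManifold (𝓡 n) ∞ M]
    {U : Set M} {X : Fin n → VField n M} {g : M → (Fin n → ℝ) → ℝ} {ρ : M → ℝ}
    {w : Fin n → ℕ} {ι : Type*} {l : Filter ι}

/-- `P` is the limit of the rescaled logarithms. -/
def IsScaledLogLimit (U : Set M) (X : Fin n → VField n M) (ρ : M → ℝ) (w : Fin n → ℕ)
    (P : M → (Fin n → ℝ) → (Fin n → ℝ) → (Fin n → ℝ)) : Prop :=
  ∀ x ∈ U, ∀ a b, Tendsto (scaledLog U X ρ w) (𝓝[>] 0 ×ˢ 𝓝 (x, a, b)) (𝓝 (P x a b))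

variable {P : M → (Fin n → ℝ) → (Fin n → ℝ) → (Fin n → ℝ)}

/-- Continuity at zero displacements is what keeps the limits of `Θ` and `Σ` inside the ball of
radius `ρ` for points near the diagonal. -/
theorem IsScaledLogLimit.continuousAt (hP : IsScaledLogLimit U X ρ w P) (hU : IsOpen U) {x : M}
    (hx : x ∈ U) (a b : Fin n → ℝ) :
    ContinuousAt (fun q : M × (Fin n → ℝ) × (Fin n → ℝ) => P q.1 q.2.1 q.2.2) (x, a, b) := by
  rw [← continuousWithinAt_univ]
  refine continuousWithinAt_of_tendsto_prod (l := 𝓝[>] (0 : ℝ)) (F := scaledLog U X ρ w)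
    (hP x hx a b) ?_
  rw [nhdsWithin_univ]
  have c1 : Tendsto (fun q : M × (Fin n → ℝ) × (Fin n → ℝ) => q.1) (𝓝 (x, a, b)) (𝓝 x) :=
    continuousAt_fst
  filter_upwards [c1.eventually (hU.mem_nhds hx)] with q hq using hP q.1 hq q.2.1 q.2.2

theorem IsScaledLogLimit.zero (hP : IsScaledLogLimit U X ρ w P) (hρ : IsGoodRadius U X ρ)
    (h : IsFrameSystem U X g) {x : M} (hx : x ∈ U) : P x 0 0 = 0 := by
  refine tendsto_nhds_unique (tendsto_left_of_tendsto_prod (hP x hx 0 0)) ?_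
  refine tendsto_const_nhds.congr fun ε => ?_
  have h0 := hρ.frameLog_frameExp hx (hρ.norm_zero_lt hx)
  rw [h.frameExp_zero hx] at h0
  simp [scaledLog, h.frameExp_zero hx, h0]

theorem IsScaledLogLimit.tendsto (hP : IsScaledLogLimit U X ρ w P) {x₀ : M} (hx₀ : x₀ ∈ U)
    {a₀ b₀ : Fin n → ℝ} {ε : ι → ℝ} {x : ι → M} {a b : ι → Fin n → ℝ}
    (hε : Tendsto ε l (𝓝[>] 0)) (hx : Tendsto x l (𝓝 x₀)) (ha : Tendsto a l (𝓝 a₀))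
    (hb : Tendsto b l (𝓝 b₀)) :
    Tendsto (fun i => scaledLog U X ρ w (ε i, x i, a i, b i)) l (𝓝 (P x₀ a₀ b₀)) :=
  Tendsto.comp (hP x₀ hx₀ a₀ b₀) (hε.prodMk (hx.prodMk_nhds (ha.prodMk_nhds hb)))

/-- In a neighbourhood of a compact set all points are given by small coordinates. -/
theorem IsGoodRadius.exists_tube (hρ : IsGoodRadius U X ρ) (h : IsFrameSystem U X g)
    [LocallyCompactSpace M] {K : Set M} (hKU : K ⊆ U) (hK : IsCompact K)
    {Φ : M × (Fin n → ℝ) × (Fin n → ℝ) → Prop} (hΦ : ∀ p ∈ K, ∀ᶠ q in 𝓝 (p, 0, 0), Φ q) :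
    ∃ R > 0, IsCompact (tube K R) ∧
      (∀ x ∈ K, Metric.closedBall x R ⊆ (riemDilation U X ρ).U x) ∧
      ∀ x ∈ K, ∀ u ∈ Metric.closedBall x R, ∀ v ∈ Metric.closedBall x R,
        ∃ a b, ‖a‖ < ρ x ∧ ‖b‖ < ρ x ∧ frameExp U X x a = u ∧ frameExp U X x b = v ∧
          Φ (x, a, b) := by
  obtain ⟨R, hR, hcpt, -, -, htube⟩ := IsCompact.exists_tube hK h.isOpen hKU
    fun x hx => hρ.eventually_diag h (hKU hx) (hΦ x hx)
  have key : ∀ x ∈ K, ∀ u ∈ Metric.closedBall x R, ∀ v ∈ Metric.closedBall x R,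
        ∃ a b, ‖a‖ < ρ x ∧ ‖b‖ < ρ x ∧ frameExp U X x a = u ∧ frameExp U X x b = v ∧
          Φ (x, a, b) := by
    intro x hx u hu v hv
    obtain ⟨a, b, -, h1⟩ := htube (x, u, v) (mem_tube hx hu hv)
    exact ⟨a, b, h1⟩
  refine ⟨R, hR, hcpt, fun x hx u hu => ?_, key⟩
  obtain ⟨a, -, ha, -, rfl, -⟩ := key x hx u hu u hu
  exact mem_frameMaps_U.2 ⟨a, ha, rfl⟩

theorem scale_pred_inv (hw : ∀ i, 1 ≤ w i) {ε : ℝ} (hε : ε ≠ 0) (c : Fin n → ℝ) :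
    scale (fun i => w i - 1) ε⁻¹ c = ε • scale w ε⁻¹ c := by
  rw [← scale_scale_pred hw, smul_inv_smul₀ hε]

theorem IsGoodRadius.induced_map (hρ : IsGoodRadius U X ρ) (hw : ∀ i, 1 ≤ w i) {x : M}
    (hx : x ∈ U) {a : Fin n → ℝ} (ha : ‖a‖ < ρ x) {ε : ℝ} (h0 : 0 ≤ ε) (h1 : ε ≤ 1) :
    (riemDilation U X ρ).map ε x ((frameProjection U X ρ w).map ε x (frameExp U X x a)) =
      frameExp U X x (scale w ε a) := by
  have e1 : (frameProjection U X ρ w).map ε x (frameExp U X x a) =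
    frameExp U X x (scale (fun i => w i - 1) ε a) := hρ.map_frameExp hx ha ε
  rw [e1, hρ.riemDilation_frameExp hx ((norm_scale_le _ h0 h1 a).trans_lt ha),
    scale_scale_pred hw]

theorem frameProjection_U (x : M) :
    (riemDilation U X ρ).U x = (frameMaps U X ρ fun i => w i - 1).U x :=
  frameMaps_U_eq _

/-- The approximate operations `Θ` are defined and converge. -/
theorem IsScaledLogLimit.tendsto_approxTheta (hP : IsScaledLogLimit U X ρ w P)
    (hρ : IsGoodRadius U X ρ) (h : IsFrameSystem U X g) (hw : ∀ i, 1 ≤ w i)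
    {x₀ : M} (hx₀ : x₀ ∈ U) {a b : Fin n → ℝ} (ha : ‖a‖ < ρ x₀) (hb : ‖b‖ < ρ x₀)
    (hab : ‖scale (fun i => w i - 1) 0 a + P x₀ b a‖ < ρ x₀) {ε : ι → ℝ} {x u v : ι → M}
    (hε : Tendsto ε l (𝓝[>] 0)) (hx : Tendsto x l (𝓝 x₀))
    (hu : Tendsto u l (𝓝 (frameExp U X x₀ a))) (hv : Tendsto v l (𝓝 (frameExp U X x₀ b))) :
    Tendsto (fun i => approxTheta (riemDilation U X ρ) (frameProjection U X ρ w) (ε i) (x i)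
      (u i) (v i)) l (𝓝 (frameExp U X x₀ (scale (fun i => w i - 1) 0 a + P x₀ b a))) ∧
    ∀ᶠ i in l, (riemDilation U X ρ).map (ε i) (x i)
        ((frameProjection U X ρ w).map (ε i) (x i) (v i)) ∈
          (frameProjection U X ρ w).dom (ε i)⁻¹ ((riemDilation U X ρ).map (ε i) (x i)
            ((frameProjection U X ρ w).map (ε i) (x i) (u i))) ∧
      (frameProjection U X ρ w).map (ε i)⁻¹
        ((riemDilation U X ρ).map (ε i) (x i) ((frameProjection U X ρ w).map (ε i) (x i) (u i)))
        ((riemDilation U X ρ).map (ε i) (x i) ((frameProjection U X ρ w).map (ε i) (x i) (v i))) ∈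
          (riemDilation U X ρ).dom (ε i)⁻¹ (x i) := by
  obtain ⟨ta, ea⟩ := hρ.tendsto_frameLog h.isOpen hx₀ ha hx hu
  obtain ⟨tb, eb⟩ := hρ.tendsto_frameLog h.isOpen hx₀ hb hx hv
  set a' := fun i => frameLog U X ρ (x i) (u i) with ha'
  set b' := fun i => frameLog U X ρ (x i) (v i) with hb'
  have hε0 := tendsto_nhds_of_tendsto_nhdsWithin hε
  have hεpos : ∀ᶠ i in l, 0 < ε i := hε.eventually self_mem_nhdsWithin
  set y := fun i => frameExp U X (x i) (scale w (ε i) (a' i)) with hy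
  set z := fun i => frameExp U X (x i) (scale w (ε i) (b' i)) with hz
  have tS := hP.tendsto hx₀ hε hx tb ta
  set S := fun i => scaledLog U X ρ w (ε i, x i, b' i, a' i) with hS
  -- Seen from `y`, the map `Q_{1/ε}` multiplies a coordinate of degree `d` by `ε^{-(d-1)} = ε *
  -- ε^{-d}`. The new coordinates are therefore `ε` times the scaled logarithm, which converges.
  have hSeq : ∀ᶠ i in l, scale (fun i => w i - 1) (ε i)⁻¹ (frameLog U X ρ (y i) (z i)) =
      ε i • S i := by
    filter_upwards [hεpos] with i hi
    rw [scale_pred_inv hw hi.ne']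
    rfl
  have tεS := hε0.smul tS
  rw [zero_smul] at tεS
  have ty : Tendsto y l (𝓝 x₀) := hρ.tendsto_frameExp_scale h hw hx₀ hε0 hx ta
  have tz : Tendsto z l (𝓝 x₀) := hρ.tendsto_frameExp_scale h hw hx₀ hε0 hx tb
  have tt := hρ.tendsto_frameExp hx₀ (hρ.norm_zero_lt hx₀) ty tεS
  -- The final point is reached from `x` by the displacement to `y`, whose quotient by `ε` tends to
  -- the degree one part of `a`, followed by `ε • S`; such displacements add in the limit.
  have tlim := hρ.tendsto_inv_smul_frameLog_frameExp h hx₀ hε hx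
    (tendsto_inv_smul_scale hw hε ta) (tendsto_inv_smul_smul hε tS)
  have eL := (hρ.tendsto_frameLog h.isOpen hx₀ (hρ.norm_zero_lt hx₀) ty
    (show Tendsto z l (𝓝 (frameExp U X x₀ 0)) by rwa [h.frameExp_zero hx₀])).2
  have eT := (hρ.tendsto_frameLog h.isOpen hx₀ (hρ.norm_zero_lt hx₀) hx tt).2
  have emap : ∀ᶠ i in l,
      (riemDilation U X ρ).map (ε i) (x i) ((frameProjection U X ρ w).map (ε i) (x i) (u i)) = y i ∧
      (riemDilation U X ρ).map (ε i) (x i) ((frameProjection U X ρ w).map (ε i) (x i) (v i)) =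
        z i ∧
      (frameProjection U X ρ w).map (ε i)⁻¹ (y i) (z i) = frameExp U X (y i) (ε i • S i) := by
    filter_upwards [ea, eb, hεpos, hε0.eventually_le_const one_pos, hSeq] with i h1 h2 h3 h4 h5
    refine ⟨?_, ?_, ?_⟩
    · rw [← h1.2.2, hρ.induced_map hw h1.1 h1.2.1 h3.le h4]
    · rw [← h2.2.2, hρ.induced_map hw h2.1 h2.2.1 h3.le h4]
    · rw [← h5]
      rfl
  constructor
  · refine (hρ.tendsto_frameExp hx₀ hab hx tlim).congr' ?_
    filter_upwards [emap] with i hi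
    rw [approxTheta, hi.1, hi.2.1, hi.2.2, riemDilation_map]
  · filter_upwards [emap, eL, eT, hSeq, hρ.eventually_lt h.isOpen hx₀ (hρ.norm_zero_lt hx₀) ty tεS,
      hρ.eventually_lt h.isOpen hx₀ hab hx tlim] with i h1 h2 h3 h4 h5 h6
    rw [h1.1, h1.2.1, h1.2.2]
    constructor
    · refine mem_frameMaps_dom.2 ⟨_, h2.2.1, ?_, h2.2.2⟩
      rwa [h4]
    · exact mem_riemDilation_dom.2 ⟨_, h3.2.1, h6, h3.2.2⟩

theorem IsGoodRadius.tendsto_frameProjection (hρ : IsGoodRadius U X ρ) (h : IsFrameSystem U X g)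
    {x₀ : M} (hx₀ : x₀ ∈ U) {a : Fin n → ℝ} (ha : ‖a‖ < ρ x₀) {ε : ι → ℝ} {x u : ι → M}
    (hε : Tendsto ε l (𝓝[>] 0)) (hx : Tendsto x l (𝓝 x₀))
    (hu : Tendsto u l (𝓝 (frameExp U X x₀ a))) :
    Tendsto (fun i => (frameProjection U X ρ w).map (ε i) (x i) (u i)) l
      (𝓝 (frameExp U X x₀ (scale (fun i => w i - 1) 0 a))) := by
  obtain ⟨ta, -⟩ := hρ.tendsto_frameLog h.isOpen hx₀ ha hx hu
  exact hρ.tendsto_frameExp hx₀ ((norm_scale_le _ le_rfl zero_le_one a).trans_lt ha) hx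
    (tendsto_scale _ (tendsto_nhds_of_tendsto_nhdsWithin hε) ta)

/-- The limit `Q^x = lim Q_ε^x`. -/
noncomputable def limitProjection (U : Set M) (X : Fin n → VField n M) (ρ : M → ℝ)
    (w : Fin n → ℕ) (x u : M) : M :=
  frameExp U X x (scale (fun i => w i - 1) 0 (frameLog U X ρ x u))

theorem IsGoodRadius.limitProjection_frameExp (hρ : IsGoodRadius U X ρ) {x : M} (hx : x ∈ U)
    {a : Fin n → ℝ} (ha : ‖a‖ < ρ x) : limitProjection U X ρ w x (frameExp U X x a) =
      frameExp U X x (scale (fun i => w i - 1) 0 a) := by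
  rw [limitProjection, hρ.frameLog_frameExp hx ha]

/-- The norm of the limit of `Θ` is small for small arguments. -/
theorem IsScaledLogLimit.eventually_norm_theta_lt (hP : IsScaledLogLimit U X ρ w P)
    (hρ : IsGoodRadius U X ρ) (h : IsFrameSystem U X g) {p : M} (hp : p ∈ U) :
    ∀ᶠ q : M × (Fin n → ℝ) × (Fin n → ℝ) in 𝓝 (p, 0, 0),
      ‖scale (fun i => w i - 1) 0 q.2.1 + P q.1 q.2.2 q.2.1‖ < ρ q.1 := by
  have c1 : Tendsto (fun q : M × (Fin n → ℝ) × (Fin n → ℝ) => q.1) (𝓝 (p, 0, 0)) (𝓝 p) :=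
    continuousAt_fst
  have c2 : Tendsto (fun q : M × (Fin n → ℝ) × (Fin n → ℝ) => q.2.1) (𝓝 (p, 0, 0)) (𝓝 0) :=
    (continuous_snd.fst).continuousAt
  have c3 : Tendsto (fun q : M × (Fin n → ℝ) × (Fin n → ℝ) => q.2.2) (𝓝 (p, 0, 0)) (𝓝 0) :=
    (continuous_snd.snd).continuousAt
  have c4 := Tendsto.comp (hP.continuousAt h.isOpen hp 0 0) (c1.prodMk_nhds (c3.prodMk_nhds c2))
  have c5 := (tendsto_scale (fun i => w i - 1) (tendsto_const_nhds (x := (0 : ℝ))) c2).add c4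
  simp only [scale_zero_right, hP.zero hρ h hp, add_zero] at c5
  exact hρ.eventually_lt h.isOpen hp (hρ.norm_zero_lt hp) c1 c5

variable [LocallyCompactSpace M]

theorem IsScaledLogLimit.theta_defined (hP : IsScaledLogLimit U X ρ w P)
    (hρ : IsGoodRadius U X ρ) (h : IsFrameSystem U X g) (hw : ∀ i, 1 ≤ w i) {K : Set M}
    (hKU : K ⊆ U) (hK : IsCompact K) : ∃ R > 0, ∃ ε₀ > 0, ε₀ ≤ 1 ∧
    ∀ x ∈ K, Metric.closedBall x R ⊆ (riemDilation U X ρ).U x ∧ ∀ ε, 0 < ε → ε < ε₀ →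
      ∀ u ∈ Metric.closedBall x R, ∀ v ∈ Metric.closedBall x R,
        (riemDilation U X ρ).map ε x ((frameProjection U X ρ w).map ε x v) ∈
          (frameProjection U X ρ w).dom ε⁻¹
            ((riemDilation U X ρ).map ε x ((frameProjection U X ρ w).map ε x u)) ∧
        (frameProjection U X ρ w).map ε⁻¹
          ((riemDilation U X ρ).map ε x ((frameProjection U X ρ w).map ε x u))
          ((riemDilation U X ρ).map ε x ((frameProjection U X ρ w).map ε x v)) ∈
            (riemDilation U X ρ).dom ε⁻¹ x := by
  obtain ⟨R, hR, hcpt, hRd, htube⟩ := hρ.exists_tube h hKU hK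
    fun p hp => hP.eventually_norm_theta_lt hρ h (hKU hp)
  have hev : ∀ q ∈ tube K R, ∀ᶠ z : ℝ × M × M × M in 𝓝[>] 0 ×ˢ 𝓝 q,
      (riemDilation U X ρ).map z.1 z.2.1 ((frameProjection U X ρ w).map z.1 z.2.1 z.2.2.2) ∈
          (frameProjection U X ρ w).dom z.1⁻¹
            ((riemDilation U X ρ).map z.1 z.2.1 ((frameProjection U X ρ w).map z.1 z.2.1 z.2.2.1)) ∧
        (frameProjection U X ρ w).map z.1⁻¹
          ((riemDilation U X ρ).map z.1 z.2.1 ((frameProjection U X ρ w).map z.1 z.2.1 z.2.2.1))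
          ((riemDilation U X ρ).map z.1 z.2.1 ((frameProjection U X ρ w).map z.1 z.2.1 z.2.2.2)) ∈
            (riemDilation U X ρ).dom z.1⁻¹ z.2.1 := by
    rintro ⟨x, u, v⟩ ⟨hx, hu, hv⟩
    obtain ⟨a, b, ha, hb, rfl, rfl, hab⟩ := htube x hx u hu v hv
    have c0 : Tendsto (fun z : ℝ × M × M × M => z.2)
      (𝓝[>] 0 ×ˢ 𝓝 (x, frameExp U X x a, frameExp U X x b))
      (𝓝 (x, frameExp U X x a, frameExp U X x b)) := tendsto_snd
    exact (hP.tendsto_approxTheta hρ h hw (hKU hx) ha hb hab tendsto_fst c0.fst_nhds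
      c0.snd_nhds.fst_nhds c0.snd_nhds.snd_nhds).2
  obtain ⟨ε₀, h0, h1⟩ := eventually_nhdsGT_zero_iff.1
    (IsCompact.eventually_forall_of_eventually_prod hcpt hev)
  exact ⟨R, hR, min ε₀ 1, by positivity, min_le_right _ _, fun x hx => ⟨hRd x hx,
    fun ε hε hε' u hu v hv => h1 ε hε (hε'.trans_le (min_le_left _ _)) (x, u, v)
      (mem_tube hx hu hv)⟩⟩

theorem IsScaledLogLimit.uniformLimitNear_approxTheta (hP : IsScaledLogLimit U X ρ w P)
    (hρ : IsGoodRadius U X ρ) (h : IsFrameSystem U X g) (hw : ∀ i, 1 ≤ w i) :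
    UniformLimitNear U (approxTheta (riemDilation U X ρ) (frameProjection U X ρ w))
      fun x u v => frameExp U X x (scale (fun i => w i - 1) 0 (frameLog U X ρ x u) +
        P x (frameLog U X ρ x v) (frameLog U X ρ x u)) := by
  refine uniformLimitNear_of_tendsto h.isOpen (fun x hx u v => frameExp_mem hx _) fun p hp => ?_
  filter_upwards [hρ.eventually_diag h hp (hP.eventually_norm_theta_lt hρ h hp)] with q hq
  obtain ⟨a, b, hx, ha, hb, h1, h2, hab⟩ := hq
  obtain ⟨x, u, v⟩ := q
  simp only at hx ha hb h1 h2 hab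
  subst h1 h2
  have c0 : Tendsto (fun z : ℝ × M × M × M => z.2)
    (𝓝[>] 0 ×ˢ 𝓝 (x, frameExp U X x a, frameExp U X x b))
    (𝓝 (x, frameExp U X x a, frameExp U X x b)) := tendsto_snd
  simp only
  rw [hρ.frameLog_frameExp hx ha, hρ.frameLog_frameExp hx hb]
  exact (hP.tendsto_approxTheta hρ h hw hx ha hb hab tendsto_fst c0.fst_nhds c0.snd_nhds.fst_nhds
    c0.snd_nhds.snd_nhds).1

/-- Only (II) and (IV) involve limits. The other axioms say that scalings with different weights
commute and that those with equal weights compose. -/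
theorem IsScaledLogLimit.isCoherentProjection (hP : IsScaledLogLimit U X ρ w P)
    (hρ : IsGoodRadius U X ρ) (h : IsFrameSystem U X g) (hw : ∀ i, 1 ≤ w i) {σ : M → ℝ}
    (hσ : IsGoodRadius U X σ) (hρσ : ∀ x ∈ U, ρ x < σ x) :
    IsCoherentProjection U (riemDilation U X ρ) (frameProjection U X ρ w)
      (limitProjection U X ρ w) where
  strong := hρ.isStrongDilationStructure h hσ hρσ
  dom_le_one x _ _ h0 h1 := (frameMaps_dom_le_one h0 h1).trans (frameProjection_U x).symm
  mapsTo _ hx _ _ u _ := frameMaps_map_mem hx u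
  induced_defined x hx ε h0 h1 u hu := by
    obtain ⟨a, ha, rfl⟩ := mem_frameMaps_U.1 hu
    have e1 : (frameProjection U X ρ w).map ε x (frameExp U X x a) =
      frameExp U X x (scale (fun i => w i - 1) ε a) := hρ.map_frameExp hx ha ε
    have e2 := (norm_scale_le (fun i => w i - 1) h0.le h1 a).trans_lt ha
    rw [e1]
    exact (hρ.mem_dom_iff hx e2).2 ((norm_scale_le _ h0.le h1 _).trans_lt e2)
  dom_inv x hx _ h0 h1 := by
    rw [frameProjection_U (w := w) x]
    exact hρ.frameMaps_dom_inv hx h0 h1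
  leftInv x hx ε h0 h1 u hu := by
    rw [frameProjection_U (w := w) x] at hu
    have hu' : u ∈ (frameProjection U X ρ w).dom ε x := by
      rw [frameProjection, frameMaps_dom_le_one h0 h1]
      exact hu
    have e1 := hρ.frameMaps_comp hx (ε := ε⁻¹) hu'
    rw [inv_mul_cancel₀ h0.ne'] at e1
    exact e1.trans (hρ.frameMaps_map_one hx hu)
  comm_dom _ hx _ _ _ _ _ hu := hρ.frameMaps_comm_dom hx hu
  comm _ hx _ _ _ _ _ hu _ := hρ.frameMaps_comm hx hu
  limit_mem _ hx _ _ := frameExp_mem hx _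
  limit C hC hCU η hη := by
    have hlim : ∀ q ∈ C, Tendsto (fun z : ℝ × M × M => (frameProjection U X ρ w).map z.1 z.2.1 z.2.2)
        (𝓝[>] 0 ×ˢ 𝓝 q) (𝓝 (limitProjection U X ρ w q.1 q.2)) := by
      intro q hq
      obtain ⟨hx, hu⟩ := hCU q hq
      obtain ⟨x, u⟩ := q
      simp only at hx hu
      obtain ⟨a, ha, rfl⟩ := mem_frameMaps_U.1 hu
      have c0 : Tendsto (fun z : ℝ × M × M => z.2) (𝓝[>] 0 ×ˢ 𝓝 (x, frameExp U X x a))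
        (𝓝 (x, frameExp U X x a)) := tendsto_snd
      simp only
      rw [hρ.limitProjection_frameExp hx ha]
      exact hρ.tendsto_frameProjection h hx ha tendsto_fst c0.fst_nhds c0.snd_nhds
    obtain ⟨ε₀, h0, h1⟩ := eventually_nhdsGT_zero_iff.1
      (IsCompact.eventually_dist_lt_of_tendsto_prod hC
        (f := fun q : M × M => limitProjection U X ρ w q.1 q.2) hlim hη)
    exact ⟨ε₀, h0, fun ε h2 h3 q hq => h1 ε h2 h3 q hq⟩
  semigroup_dom _ hx _ _ _ _ _ hu := hρ.frameMaps_comp_dom hx hu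
  semigroup _ hx _ _ _ _ _ hu _ := hρ.frameMaps_comp hx hu
  one x hx u hu := by
    rw [frameProjection_U (w := w) x] at hu
    exact hρ.frameMaps_map_one hx hu
  base _ hx ε _ := ⟨hρ.mem_dom_self h hx ε, hρ.map_self h hx ε⟩
  theta_defined _ hKU hK := hP.theta_defined hρ h hw hKU hK
  theta_limit := ⟨_, hP.uniformLimitNear_approxTheta hρ h hw⟩

/-- The scaling with weights at least one is linear and shrinks vectors by a factor `ε`. The
constant `C / c` is the price of passing from distances to coordinates and back. -/
theorem IsGoodRadius.conditionA (hρ : IsGoodRadius U X ρ) (h : IsFrameSystem U X g)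
    (hw : ∀ i, 1 ≤ w i) : ConditionA U (riemDilation U X ρ) (frameProjection U X ρ w) := by
  intro K hKU hK
  obtain ⟨s, hs, c, hc, C, hC, hbi⟩ := hρ.exists_biLipschitz h hKU hK
  have hΦ : ∀ p ∈ K, ∀ᶠ q : M × (Fin n → ℝ) × (Fin n → ℝ) in 𝓝 (p, 0, 0),
      ‖q.2.1‖ < s ∧ ‖q.2.2‖ < s := by
    intro p _
    have c2 : Tendsto (fun q : M × (Fin n → ℝ) × (Fin n → ℝ) => ‖q.2.1‖) (𝓝 (p, 0, 0))
        (𝓝 ‖(0 : Fin n → ℝ)‖) := (continuous_snd.fst).norm.continuousAt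
    have c3 : Tendsto (fun q : M × (Fin n → ℝ) × (Fin n → ℝ) => ‖q.2.2‖) (𝓝 (p, 0, 0))
        (𝓝 ‖(0 : Fin n → ℝ)‖) := (continuous_snd.snd).norm.continuousAt
    rw [norm_zero] at c2 c3
    exact (c2.eventually_lt_const hs).and (c3.eventually_lt_const hs)
  obtain ⟨R, hR, -, hRd, htube⟩ := hρ.exists_tube h hKU hK hΦ
  refine ⟨C / c, by positivity, R, hR, fun x hx => ⟨hRd x hx, fun ε h0 h1 u hu v hv => ?_⟩⟩
  obtain ⟨a, b, ha, hb, rfl, rfl, has, hbs⟩ := htube x hx u hu v hv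
  have e1 : ∀ a : Fin n → ℝ, ‖a‖ < ρ x → (induced (riemDilation U X ρ)
      (frameProjection U X ρ w)).map ε x (frameExp U X x a) = frameExp U X x (scale w ε a) :=
    fun a ha => hρ.induced_map hw (hKU hx) ha h0.le h1
  rw [e1 a ha, e1 b hb]
  have h2 := ((hbi x hx).2 _ _ ((norm_scale_le w h0.le h1 a).trans_lt has)
    ((norm_scale_le w h0.le h1 b).trans_lt hbs)).2
  rw [← scale_sub] at h2
  have h3 := norm_scale_le_mul hw h0.le h1 (a - b)
  have h4 := ((hbi x hx).2 a b has hbs).1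
  calc 1 / ε * dist (frameExp U X x (scale w ε a)) (frameExp U X x (scale w ε b))
      ≤ 1 / ε * (C * (ε * ‖a - b‖)) := by
        gcongr
        exact h2.trans (by gcongr)
    _ = C / c * (c * ‖a - b‖) := by field_simp
    _ ≤ C / c * dist (frameExp U X x a) (frameExp U X x b) := by gcongr

end Projection

/-! ### Approximate sums, horizontal curves and condition (B) -/

section Horizontal

set_option linter.unusedSectionVars false

variable {n : ℕ} {M : Type*} [MetricSpace M]
    [ChartedSpace (EuclideanSpace ℝ (Fin n)) M] [IsManifold (𝓡 n) ∞ M]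
    {U : Set M} {X : Fin n → VField n M} {g : M → (Fin n → ℝ) → ℝ} {ρ : M → ℝ}
    {w : Fin n → ℕ} {ι : Type*} {l : Filter ι}
    {P : M → (Fin n → ℝ) → (Fin n → ℝ) → (Fin n → ℝ)}

/-- With `y = δ_ε^x u`, the point `x` is the exponential of `-δ_ε a` from `y`. So the approximate
sum is the scaled logarithm of `b` relative to `-a`, based at the moving point `y`. -/
theorem IsScaledLogLimit.tendsto_approxSum (hP : IsScaledLogLimit U X ρ w P)
    (hρ : IsGoodRadius U X ρ) (h : IsFrameSystem U X g) (hw : ∀ i, 1 ≤ w i)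
    {x₀ : M} (hx₀ : x₀ ∈ U) {a b : Fin n → ℝ} (ha : ‖a‖ < ρ x₀) (hb : ‖b‖ < ρ x₀)
    (hab : ‖P x₀ b (-a)‖ < ρ x₀) {ε : ι → ℝ} {x u v : ι → M}
    (hε : Tendsto ε l (𝓝[>] 0)) (hx : Tendsto x l (𝓝 x₀))
    (hu : Tendsto u l (𝓝 (frameExp U X x₀ a))) (hv : Tendsto v l (𝓝 (frameExp U X x₀ b))) :
    Tendsto (fun i => approxSum (srDilation U X ρ w) (ε i) (x i) (u i) (v i)) l
      (𝓝 (frameExp U X x₀ (P x₀ b (-a)))) := by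
  obtain ⟨ta, ea⟩ := hρ.tendsto_frameLog h.isOpen hx₀ ha hx hu
  have hε0 := tendsto_nhds_of_tendsto_nhdsWithin hε
  have ty := hρ.tendsto_frameExp_scale h hw hx₀ hε0 hx ta
  obtain ⟨tb, eb⟩ := hρ.tendsto_frameLog h.isOpen hx₀ hb ty hv
  have tS := hP.tendsto hx₀ hε ty tb ta.neg
  refine (hρ.tendsto_frameExp hx₀ hab hx tS).congr' ?_
  filter_upwards [ea, hε.eventually self_mem_nhdsWithin, hε0.eventually_le_const one_pos]
    with i h1 h2 h3
  have h4 := hρ.frameExp_frameExp_neg h h1.1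
    ((norm_scale_le w (le_of_lt h2) h3 (frameLog U X ρ (x i) (u i))).trans_lt h1.2.1)
  rw [← scale_neg] at h4
  unfold scaledLog
  simp only
  rw [h4]
  rfl

/-- Homogeneous one-parameter groups belong to the distribution of the tangent space. -/
theorem IsGoodRadius.mem_tangentDistribution (hρ : IsGoodRadius U X ρ) (h : IsFrameSystem U X g)
    {x : M} (hx : x ∈ U) {a : Fin n → ℝ} (ha : ‖a‖ < ρ x) (hwa : ∀ s, scale w s a = s • a) :
    frameExp U X x a ∈ tangentDistribution (frameMaps U X ρ w) x := by
  refine ⟨mem_frameMaps_U.2 ⟨a, ha, rfl⟩, fun s hs t ht hds hdt hdst => ?_⟩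
  rw [hρ.mem_dom_iff hx ha, hwa] at hds hdt hdst
  rw [hρ.map_frameExp hx ha, hρ.map_frameExp hx ha, hρ.map_frameExp hx ha, hwa, hwa, hwa]
  have hs : 0 < s := hs
  have ht : 0 < t := ht
  have hsc : ∀ τ r : ℝ, scale w τ (r • a) = (τ * r) • a := fun τ r => by
    rw [scale_smul, hwa, smul_smul, mul_comm]
  have c0 : Tendsto (fun ε : ℝ => ε) (𝓝[>] 0) (𝓝 0) :=
    tendsto_nhds_of_tendsto_nhdsWithin tendsto_id
  have cpos : ∀ᶠ ε : ℝ in 𝓝[>] 0, 0 < ε := self_mem_nhdsWithin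
  have cx : Tendsto (fun _ : ℝ => x) (𝓝[>] 0) (𝓝 x) := tendsto_const_nhds
  have c1 : Tendsto (fun ε : ℝ => (ε * s) • a) (𝓝[>] 0) (𝓝 0) := by
    have := (c0.mul_const s).smul_const a
    rwa [zero_mul, zero_smul] at this
  have cy := hρ.tendsto_frameExp hx (hρ.norm_zero_lt hx) cx c1
  rw [h.frameExp_zero hx] at cy
  have c2 : Tendsto (fun ε : ℝ => (t - ε * s) • a) (𝓝[>] 0) (𝓝 (t • a)) := by
    have := ((c0.mul_const s).const_sub t).smul_const a
    rwa [zero_mul, sub_zero] at this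
  have c3 : Tendsto (fun ε : ℝ => (s + t - ε * s) • a) (𝓝[>] 0) (𝓝 ((s + t) • a)) := by
    have := ((c0.mul_const s).const_sub (s + t)).smul_const a
    rwa [zero_mul, sub_zero] at this
  have c4 : Tendsto (fun ε : ℝ => ε * (s + t - ε * s)) (𝓝[>] 0) (𝓝 0) := by
    have := c0.mul ((c0.mul_const s).const_sub (s + t))
    rwa [zero_mul] at this
  have c5 : Tendsto (fun ε : ℝ => ε * s) (𝓝[>] 0) (𝓝 0) := by
    have := c0.mul_const s
    rwa [zero_mul] at this
  -- The approximate sum is computed exactly. With `y = exp(εsa)(x)`, the point `exp(ta)(x)` is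
  -- `exp((t - εs)a)(y)`; dilating it at `y` gives `exp(ε(s + t - εs)a)(x)`, and dilating back at
  -- `x` gives `exp((s + t - εs)a)(x)`. The smallness of `ε` keeps the flow times in `[0, t]`.
  refine (hρ.tendsto_frameExp hx hdst cx c3).congr' ?_
  filter_upwards [cpos, hρ.eventually_lt h.isOpen hx hdt cy c2,
    hρ.eventually_lt h.isOpen hx hdst cx c3, hρ.eventually_lt h.isOpen hx (hρ.norm_zero_lt hx) cx
    (show Tendsto (fun ε : ℝ => (ε * (s + t - ε * s)) • a) (𝓝[>] 0) (𝓝 0) by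
      have := c4.smul_const a
      rwa [zero_smul] at this),
    c4.eventually_lt_const ht, c5.eventually_lt_const ht,
    c5.eventually_lt_const hs] with ε h0 h1 h2 h3 h4 h5 h6
  have hflow : ∀ r r' : ℝ, r ∈ Icc 0 t → r' ∈ Icc 0 t →
      frameExp U X (frameExp U X x (r • a)) ((r' - r) • a) = frameExp U X x (r' • a) := by
    intro r r' hr hr'
    have := hρ.frameExp_frameExp_smul h hx hdt (s := r / t) (t := r' / t)
      ⟨div_nonneg hr.1 ht.le, (div_le_one ht).2 hr.2⟩
      ⟨div_nonneg hr'.1 ht.le, (div_le_one ht).2 hr'.2⟩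
    rwa [smul_smul, smul_smul, smul_smul, ← sub_div, div_mul_cancel₀ _ ht.ne',
      div_mul_cancel₀ _ ht.ne', div_mul_cancel₀ _ ht.ne'] at this
  have hεs : 0 < ε * s := mul_pos h0 hs
  have hpos : 0 < ε * (s + t - ε * s) := mul_pos h0 (by linarith)
  have hy : (frameMaps U X ρ w).map ε x (frameExp U X x (s • a)) =
      frameExp U X x ((ε * s) • a) := by
    rw [hρ.map_frameExp hx hds, hsc]
  have hyU := frameExp_mem (X := X) hx ((ε * s) • a)
  rw [approxSum, hy]
  have e1 := hflow (ε * s) t ⟨hεs.le, h5.le⟩ ⟨ht.le, le_rfl⟩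
  rw [← e1, hρ.map_frameExp hyU h1, hsc]
  have e2 := hflow (ε * s) (ε * (s + t - ε * s)) ⟨hεs.le, h5.le⟩ ⟨hpos.le, h4.le⟩
  have e3 : ε * (s + t - ε * s) - ε * s = ε * (t - ε * s) := by ring
  rw [e3] at e2
  rw [e2, hρ.map_frameExp hx h3, hsc, inv_mul_cancel_left₀ h0.ne']

theorem IsGoodRadius.dilationCurve_eq (hρ : IsGoodRadius U X ρ) (h : IsFrameSystem U X g) {x : M}
    (hx : x ∈ U) {a : Fin n → ℝ} (ha : ‖a‖ < ρ x) :
    dilationCurve (riemDilation U X ρ) x (frameExp U X x a) =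
      fun t => frameExp U X x (t • a) := by
  funext t
  unfold dilationCurve
  split_ifs with h0
  · rw [h0, zero_smul, h.frameExp_zero hx]
  · exact hρ.riemDilation_frameExp hx ha t

theorem norm_smul_lt_of_mem_Icc {t : ℝ} (ht : t ∈ Icc (0 : ℝ) 1) {a : Fin n → ℝ} {r : ℝ}
    (ha : ‖a‖ < r) : ‖t • a‖ < r := by
  rw [norm_smul, Real.norm_of_nonneg ht.1]
  exact (mul_le_of_le_one_left (norm_nonneg _) ht.2).trans_lt ha

/-- Exponential curves are differentiable with respect to the dilations. -/
theorem IsGoodRadius.isDilationDeriv (hρ : IsGoodRadius U X ρ) (h : IsFrameSystem U X g) {x : M}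
    (hx : x ∈ U) {a : Fin n → ℝ} (ha : ‖a‖ < ρ x) {t : ℝ} (ht : t ∈ Icc (0 : ℝ) 1)
    (hat : ‖a‖ < ρ (frameExp U X x (t • a))) :
    IsDilationDeriv (riemDilation U X ρ) (fun t => frameExp U X x (t • a)) 0 1 t
      (frameExp U X (frameExp U X x (t • a)) a) := by
  set y := frameExp U X x (t • a) with hy
  have hyU : y ∈ U := frameExp_mem hx _
  -- The curve is a one-parameter group, so both difference quotients vanish identically on the sets
  -- where they are considered.
  have hzero : ∀ {f : ℝ → ℝ} {s : Set ℝ}, (∀ ε ∈ s, f ε = 0) → Tendsto f (𝓝[s] 0) (𝓝 0) :=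
    fun {f s} hf => tendsto_const_nhds.congr' (by
      filter_upwards [self_mem_nhdsWithin] with ε hε using (hf ε hε).symm)
  have hnat : ‖-a‖ < ρ y := by rwa [norm_neg]
  refine ⟨hρ.mem_tangentDistribution h hyU hat fun s => scale_const_one s a, hzero ?_,
    frameExp U X y (-a), mem_frameMaps_U.2 ⟨-a, hnat, rfl⟩, ?_, hzero ?_⟩
  · rintro ε ⟨h0, h1⟩
    rw [hρ.riemDilation_frameExp hyU hat]
    have := hρ.frameExp_frameExp_smul h hx ha ht h1
    rw [add_sub_cancel_left, ← hy] at this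
    rw [this, dist_self, zero_div]
  · have := hρ.tendsto_approxDiff h hyU hat (hρ.norm_zero_lt hyU) (by rwa [zero_sub])
      (ε := fun ε => ε) tendsto_id (tendsto_const_nhds (x := y))
      (tendsto_const_nhds (x := frameExp U X y a)) (tendsto_const_nhds (x := frameExp U X y 0))
    rwa [zero_sub, h.frameExp_zero hyU] at this
  · rintro ε ⟨h0, h1⟩
    rw [hρ.riemDilation_frameExp hyU hnat]
    have := hρ.frameExp_frameExp_smul h hx ha ht h1
    have e1 : (t - ε - t) • a = ε • -a := by rw [smul_neg, ← neg_smul]; congr 1; ring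
    rw [e1, ← hy] at this
    rw [this, dist_self, zero_div]

/-- Exponential curves are short: their length is comparable to the distance of their ends. -/
theorem IsFrameSystem.exists_length_ratio (h : IsFrameSystem U X g) {K : Set M} (hKU : K ⊆ U)
    (hK : IsCompact K) {η : ℝ} (hη : 0 < η) :
    ∃ r > 0, ∀ x ∈ K, ∀ a : Fin n → ℝ, a ≠ 0 → ∀ t > 0, ‖t • a‖ < r →
      eVariationOn (fun τ : ℝ => frameExp U X x (τ • a)) (Icc 0 t) ≠ ⊤ ∧
      |(eVariationOn (fun τ : ℝ => frameExp U X x (τ • a)) (Icc 0 t)).toReal /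
        dist x (frameExp U X x (t • a)) - 1| < η := by
  refine hK.induction_on (p := fun D => ∃ r > 0, ∀ x ∈ D, ∀ a : Fin n → ℝ, a ≠ 0 → ∀ t > 0,
      ‖t • a‖ < r →
      eVariationOn (fun τ : ℝ => frameExp U X x (τ • a)) (Icc 0 t) ≠ ⊤ ∧
      |(eVariationOn (fun τ : ℝ => frameExp U X x (τ • a)) (Icc 0 t)).toReal /
        dist x (frameExp U X x (t • a)) - 1| < η) ⟨1, one_pos, by simp⟩ ?_ ?_ ?_
  · rintro D D' hD ⟨r, hr, hD'⟩
    exact ⟨r, hr, fun x hx => hD' x (hD hx)⟩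
  · rintro D D' ⟨r, hr, hD⟩ ⟨r', hr', hD'⟩
    refine ⟨min r r', lt_min hr hr', ?_⟩
    rintro x (hx | hx) a ha t ht hat
    · exact hD x hx a ha t ht (hat.trans_le (min_le_left _ _))
    · exact hD' x hx a ha t ht (hat.trans_le (min_le_right _ _))
  · intro p hpK
    have hp := hKU hpK
    obtain ⟨c, hc, hgc⟩ := exists_mul_norm_le (h.norm_add_le p hp) (h.norm_smul p hp)
      (h.norm_pos p hp)
    -- With error `θ`, the speed lies between `μ = g(a) - θ‖a‖` and `Λ = g(a) + θ‖a‖`. The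
    -- inequality `(2 + η)θ < ηc` is what ensures `Λ < (1 + η)μ`, regardless of the size of `a`.
    set θ := η * c / (2 * (2 + η)) with hθ
    have hθ0 : 0 < θ := by positivity
    have hθη : (2 + η) * θ < η * c := by
      have : (2 + η) * θ = η * c / 2 := by rw [hθ]; field_simp
      rw [this]
      exact half_lt_self (by positivity)
    have hθc : θ < c := by nlinarith
    have e1 := h.eventually_dist_sub_le hp hθ0
    rw [nhds_prod_eq, nhds_prod_eq] at e1
    obtain ⟨pa, hpa, pb, hpb, hab⟩ := eventually_prod_iff.1 e1
    obtain ⟨pc, hpc, pd, hpd, hcd⟩ := eventually_prod_iff.1 hpb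
    obtain ⟨r, hr, hsub⟩ := Metric.eventually_nhds_iff.1 (hpc.and hpd)
    refine ⟨{y | pa y ∧ y ∈ U}, nhdsWithin_le_nhds (hpa.and (h.isOpen.mem_nhds hp)), r, hr,
      fun x hx a ha t ht hat => ?_⟩
    obtain ⟨hxa, hxU⟩ := hx
    have hest : ∀ τ ∈ Icc 0 t, ∀ τ' ∈ Icc 0 t,
        |dist (frameExp U X x (τ • a)) (frameExp U X x (τ' • a)) - |τ - τ'| * g p a| ≤
          θ * (|τ - τ'| * ‖a‖) := by
      intro τ hτ τ' hτ'
      have hball : ∀ τ ∈ Icc 0 t, dist (τ • a) 0 < r := fun τ hτ => by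
        rw [dist_zero_right, _root_.norm_smul, Real.norm_of_nonneg hτ.1]
        rw [_root_.norm_smul, Real.norm_of_nonneg ht.le] at hat
        exact (mul_le_mul_of_nonneg_right hτ.2 (norm_nonneg _)).trans_lt hat
      have h1 := hab hxa (hcd (hsub (hball τ hτ)).1 (hsub (hball τ' hτ')).2)
      simp only at h1
      rwa [← sub_smul, h.norm_smul p hp, _root_.norm_smul, Real.norm_eq_abs] at h1
    have ha0 : 0 < ‖a‖ := norm_pos_iff.2 ha
    have hga := hgc a
    set Λ := g p a + θ * ‖a‖ with hΛ
    set μ := g p a - θ * ‖a‖ with hμ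
    have hμ0 : 0 < μ := by nlinarith
    have hΛ0 : 0 < Λ := by nlinarith
    have hΛμ : Λ < (1 + η) * μ := by nlinarith
    have hlip : LipschitzOnWith ⟨Λ, hΛ0.le⟩ (fun τ : ℝ => frameExp U X x (τ • a)) (Icc 0 t) := by
      refine LipschitzOnWith.of_dist_le_mul fun τ hτ τ' hτ' => ?_
      have h1 := (abs_le.1 (hest τ hτ τ' hτ')).2
      rw [Real.dist_eq]
      change _ ≤ Λ * |τ - τ'|
      nlinarith
    have hvar : eVariationOn (fun τ : ℝ => frameExp U X x (τ • a)) (Icc 0 t) ≤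
        ENNReal.ofReal (Λ * t) := by
      have h1 := hlip.comp_eVariationOn_le (g := fun τ : ℝ => τ) (s := Icc 0 t) (fun τ hτ => hτ)
      have h2 := (monotone_id (α := ℝ)).monotoneOn (Icc 0 t) |>.eVariationOn_eq
        (left_mem_Icc.2 ht.le) (right_mem_Icc.2 ht.le)
      rw [inter_self] at h2
      refine h1.trans ?_
      rw [ENNReal.ofReal_mul hΛ0.le]
      rw [ENNReal.ofReal_eq_coe_nnreal hΛ0.le]
      refine mul_le_mul_right (h2.le.trans ?_) _
      simp
    have htop : eVariationOn (fun τ : ℝ => frameExp U X x (τ • a)) (Icc 0 t) ≠ ⊤ :=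
      ne_top_of_le_ne_top ENNReal.ofReal_ne_top hvar
    have hdist : t * μ ≤ dist x (frameExp U X x (t • a)) := by
      have h1 := (abs_le.1 (hest 0 (left_mem_Icc.2 ht.le) t (right_mem_Icc.2 ht.le))).1
      rw [zero_smul, h.frameExp_zero hxU, zero_sub, abs_neg, abs_of_pos ht] at h1
      rw [hμ]
      nlinarith
    have hdist0 : 0 < dist x (frameExp U X x (t • a)) := (mul_pos ht hμ0).trans_le hdist
    have hlow : dist x (frameExp U X x (t • a)) ≤
        (eVariationOn (fun τ : ℝ => frameExp U X x (τ • a)) (Icc 0 t)).toReal := by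
      have h1 := eVariationOn.edist_le (fun τ : ℝ => frameExp U X x (τ • a))
        (left_mem_Icc.2 ht.le) (right_mem_Icc.2 ht.le)
      simp only [zero_smul, h.frameExp_zero hxU] at h1
      rw [dist_edist]
      exact ENNReal.toReal_mono htop h1
    have hup : (eVariationOn (fun τ : ℝ => frameExp U X x (τ • a)) (Icc 0 t)).toReal ≤ Λ * t :=
      ENNReal.toReal_le_of_le_ofReal (by positivity) hvar
    refine ⟨htop, ?_⟩
    rw [abs_lt]
    constructor
    · have := (one_le_div hdist0).2 hlow
      linarith
    · rw [sub_lt_iff_lt_add', div_lt_iff₀ hdist0]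
      nlinarith

variable [LocallyCompactSpace M]

theorem IsScaledLogLimit.uniformLimitNear_approxSum (hP : IsScaledLogLimit U X ρ w P)
    (hρ : IsGoodRadius U X ρ) (h : IsFrameSystem U X g) (hw : ∀ i, 1 ≤ w i) :
    UniformLimitNear U (approxSum (srDilation U X ρ w)) fun x u v =>
      frameExp U X x (P x (frameLog U X ρ x v) (-frameLog U X ρ x u)) := by
  refine uniformLimitNear_of_tendsto h.isOpen (fun x hx u v => frameExp_mem hx _) fun p hp => ?_
  have hΦ : ∀ᶠ q : M × (Fin n → ℝ) × (Fin n → ℝ) in 𝓝 (p, 0, 0),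
      ‖P q.1 q.2.2 (-q.2.1)‖ < ρ q.1 := by
    have c1 : Tendsto (fun q : M × (Fin n → ℝ) × (Fin n → ℝ) => q.1) (𝓝 (p, 0, 0)) (𝓝 p) :=
      continuousAt_fst
    have c2 : Tendsto (fun q : M × (Fin n → ℝ) × (Fin n → ℝ) => q.2.1) (𝓝 (p, 0, 0)) (𝓝 0) :=
      (continuous_snd.fst).continuousAt
    have c3 : Tendsto (fun q : M × (Fin n → ℝ) × (Fin n → ℝ) => q.2.2) (𝓝 (p, 0, 0)) (𝓝 0) :=
      (continuous_snd.snd).continuousAt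
    have c2' := c2.neg
    rw [neg_zero] at c2'
    have c4 := Tendsto.comp (hP.continuousAt h.isOpen hp 0 0) (c1.prodMk_nhds (c3.prodMk_nhds c2'))
    simp only [hP.zero hρ h hp] at c4
    exact hρ.eventually_lt h.isOpen hp (hρ.norm_zero_lt hp) c1 c4
  filter_upwards [hρ.eventually_diag h hp hΦ] with q hq
  obtain ⟨a, b, hx, ha, hb, h1, h2, hab⟩ := hq
  obtain ⟨x, u, v⟩ := q
  simp only at hx ha hb h1 h2 hab
  subst h1 h2
  have c0 : Tendsto (fun z : ℝ × M × M × M => z.2)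
    (𝓝[>] 0 ×ˢ 𝓝 (x, frameExp U X x a, frameExp U X x b))
    (𝓝 (x, frameExp U X x a, frameExp U X x b)) := tendsto_snd
  simp only
  rw [hρ.frameLog_frameExp hx ha, hρ.frameLog_frameExp hx hb]
  exact hP.tendsto_approxSum hρ h hw hx ha hb hab tendsto_fst c0.fst_nhds c0.snd_nhds.fst_nhds
    c0.snd_nhds.snd_nhds

/-- By injectivity, `Q^x u = u` forces the coordinates of `u` to vanish in degrees above one. Then
every `Q_t` fixes them, all the curves of the condition coincide with `t ↦ exp(ta)(x)`, and the
derivative at each time has the same coordinates `a`. -/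
theorem IsGoodRadius.conditionB (hρ : IsGoodRadius U X ρ) (h : IsFrameSystem U X g)
    (hw : ∀ i, 1 ≤ w i) : ConditionB U (riemDilation U X ρ) (frameProjection U X ρ w)
      (limitProjection U X ρ w) := by
  intro K hKU hK
  -- The second condition puts the derivative `exp(a)(c(t))` in the domain at every point of the
  -- curve. The first makes `‖t • a‖ < r` for `t < r`, so that the time bound is independent of `u`.
  have hΦ : ∀ p ∈ K, ∀ᶠ q : M × (Fin n → ℝ) × (Fin n → ℝ) in 𝓝 (p, 0, 0),
      ‖q.2.1‖ < 1 ∧ ∀ t ∈ Icc (0 : ℝ) 1, ‖q.2.1‖ < ρ (frameExp U X q.1 (t • q.2.1)) := by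
    intro p hpK
    have hp := hKU hpK
    have e1 : ∀ᶠ q : M × (Fin n → ℝ) in 𝓝 (p, 0), ρ p / 2 < ρ (frameExp U X q.1 q.2) := by
      have c1 : Tendsto (fun q : M × (Fin n → ℝ) => q.1) (𝓝 (p, 0)) (𝓝 p) := continuousAt_fst
      have c2 : Tendsto (fun q : M × (Fin n → ℝ) => q.2) (𝓝 (p, 0)) (𝓝 0) := continuousAt_snd
      have c3 := hρ.tendsto_frameExp hp (hρ.norm_zero_lt hp) c1 c2
      rw [h.frameExp_zero hp] at c3
      exact c3.eventually ((hρ.continuousOn.continuousAt (h.isOpen.mem_nhds hp)).eventually_const_lt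
        (half_lt_self (hρ.pos p hp)))
    rw [nhds_prod_eq] at e1
    obtain ⟨pa, hpa, pb, hpb, hab⟩ := eventually_prod_iff.1 e1
    obtain ⟨r, hr, hsub⟩ := Metric.eventually_nhds_iff.1 hpb
    have c1 : Tendsto (fun q : M × (Fin n → ℝ) × (Fin n → ℝ) => q.1) (𝓝 (p, 0, 0)) (𝓝 p) :=
      continuousAt_fst
    have c2 : Tendsto (fun q : M × (Fin n → ℝ) × (Fin n → ℝ) => ‖q.2.1‖) (𝓝 (p, 0, 0))
        (𝓝 ‖(0 : Fin n → ℝ)‖) := (continuous_snd.fst).norm.continuousAt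
    rw [norm_zero] at c2
    filter_upwards [c1.eventually hpa, c2.eventually_lt_const one_pos, c2.eventually_lt_const hr,
      c2.eventually_lt_const (half_pos (hρ.pos p hp))] with q h1 h2 h3 h4
    refine ⟨h2, fun t ht => h4.trans (hab h1 (hsub ?_))⟩
    rw [dist_zero_right]
    exact norm_smul_lt_of_mem_Icc ht h3
  obtain ⟨R, hR, -, hRd, htube⟩ := hρ.exists_tube h hKU hK hΦ
  have hfix : ∀ x ∈ U, ∀ a, ‖a‖ < ρ x →
      limitProjection U X ρ w x (frameExp U X x a) = frameExp U X x a →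
      scale (fun i => w i - 1) 0 a = a := by
    intro x hx a ha hQ
    rw [hρ.limitProjection_frameExp hx ha] at hQ
    exact hρ.frameExp_inj hx ((norm_scale_le _ le_rfl zero_le_one a).trans_lt ha) ha hQ
  refine ⟨R, hR, hRd, fun x hxK u hu hQ => ?_, fun η hη => ?_⟩
  · have hx := hKU hxK
    obtain ⟨a, _, ha, _, rfl, _, ha1, hat⟩ := htube x hxK u hu u hu
    have hπ := hfix x hx a ha hQ
    have hπ' := scale_pred_zero_of_eq hπ
    have hinduced : ∀ t ∈ Icc (0 : ℝ) 1, dilationCurve (induced (riemDilation U X ρ)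
        (frameProjection U X ρ w)) x (frameExp U X x a) t = frameExp U X x (t • a) := by
      intro t ht
      unfold dilationCurve
      split_ifs with h0
      · rw [h0, zero_smul, h.frameExp_zero hx]
      · refine (hρ.induced_map hw hx ha ht.1 ht.2).trans ?_
        rw [← scale_scale_pred hw, hπ' t]
    rw [hρ.dilationCurve_eq h hx ha]
    refine ⟨fun t ht => ⟨(hinduced t ht).symm, ?_⟩, ?_, fun t _ => frameExp_mem hx _,
      fun t ht => ⟨_, hρ.isDilationDeriv h hx ha ht (hat t ht), ?_⟩⟩
    · rw [hinduced t ht, hρ.limitProjection_frameExp hx (norm_smul_lt_of_mem_Icc ht ha),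
        scale_smul, hπ]
    · intro t ht
      have c1 : Tendsto (fun τ : ℝ => τ • a) (𝓝 t) (𝓝 (t • a)) := tendsto_id.smul_const a
      have c2 := hρ.tendsto_frameExp hx (norm_smul_lt_of_mem_Icc ht ha)
        (tendsto_const_nhds (x := x)) c1
      exact ContinuousAt.continuousWithinAt c2
    · rw [hρ.limitProjection_frameExp (frameExp_mem hx _) (hat t ht), hπ]
  · obtain ⟨r, hr, hratio⟩ := h.exists_length_ratio hKU hK hη
    refine ⟨r, hr, fun t ht htr _ x hxK u hu _ hne => ?_⟩
    have hx := hKU hxK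
    obtain ⟨a, _, ha, _, rfl, _, ha1, _⟩ := htube x hxK u hu u hu
    rw [hρ.dilationCurve_eq h hx ha, hρ.riemDilation_frameExp hx ha]
    refine hratio x hxK a ?_ t ht ?_
    · rintro rfl
      exact hne (h.frameExp_zero hx)
    · simp only at ha1
      rw [norm_smul, Real.norm_of_nonneg ht.le]
      nlinarith [norm_nonneg a]

end Horizontal

/-! ### Linear independence and composition for normal frames -/

section NormalFrame

variable {n m : ℕ} {M : Type*} [MetricSpace M]
    [ChartedSpace (EuclideanSpace ℝ (Fin n)) M] [IsManifold (𝓡 n) ∞ M]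
    {S : SubRiemannianStructure n m M} {U : Set M} {X : Fin n → VField n M} {deg : Fin n → ℕ}

theorem filtration_mono (S : SubRiemannianStructure n m M) (U : Set M) :
    Monotone (filtration S U) := by
  refine monotone_nat_of_le_succ fun j => ?_
  cases j with
  | zero => rw [filtration.eq_1]; exact bot_le
  | succ j =>
    rw [filtration.eq_3]
    exact le_sup_left

/-- Induction on the word: brackets are nested on the right, so each further letter brackets with a
field of `𝒳¹` and raises the order by one. -/
theorem ChowCondition.bracketWord_mem {k : ℕ} {Y : Fin m → VField n M}
    (hY : ChowCondition S U k Y) :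
    ∀ v : List (Fin m), v ≠ [] → bracketWord Y v ∈ filtration S U v.length
  | [], h => absurd rfl h
  | [a], _ => by
      rw [bracketWord, List.length_singleton, filtration]
      refine Submodule.subset_span ⟨hY.smooth a, fun y hy => ?_⟩
      rw [← hY.span_distribution y hy]
      exact Submodule.subset_span (mem_range_self a)
  | a :: b :: v, _ => by
      have h1 := hY.bracketWord_mem [a] (by simp)
      rw [bracketWord, List.length_singleton] at h1
      rw [bracketWord, List.length_cons, List.length_cons, filtration]
      exact Submodule.mem_sup_right (Submodule.subset_span ⟨Y a, h1, bracketWord Y (b :: v),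
        hY.bracketWord_mem (b :: v) (by simp), rfl⟩)

theorem ChowCondition.flag_eq_top {k : ℕ} {Y : Fin m → VField n M}
    (hY : ChowCondition S U k Y) {y : M} (hy : y ∈ U) : flag S U k y = ⊤ := by
  rw [eq_top_iff, ← hY.span_tangent y hy, Submodule.span_le]
  rintro _ ⟨v, hv, hvk, rfl⟩
  exact ⟨bracketWord Y v, filtration_mono S U hvk (hY.bracketWord_mem v hv), rfl⟩

/-- Under (C), `V^k(y)` is the whole tangent space, of dimension `n`; hence the basis of `V^k(y)`
prescribed by adaptedness consists of all `n` fields. -/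
theorem IsAdaptedFrame.linearIndependent (hX : IsAdaptedFrame S U X deg) {y : M} (hy : y ∈ U) :
    LinearIndependent ℝ fun i => X i y := by
  obtain ⟨_, k, hk, -⟩ := hX.chow
  have h1 := (hX.basis k y hy).1
  have h2 : Module.finrank ℝ (flag S U k y) = n := by
    rw [hk.flag_eq_top hy, finrank_top]
    exact finrank_euclideanSpace_fin
  exact h1.comp (fun i : Fin n => ⟨i, by rw [h2]; exact i.2⟩) fun i j hij =>
    congrArg Subtype.val hij

theorem IsNormalFrame.hasComposition [LocallyCompactSpace M] (hU : IsOpen U)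
    (hX : IsNormalFrame S U X deg) {p : M} (hp : p ∈ U) : HasComposition U X deg p := by
  obtain ⟨N, hN, hcomp⟩ := hX.composition p hp
  obtain ⟨K, hK, hKs, hKc⟩ := local_compact_nhds (inter_mem (hU.mem_nhds hp) hN)
  obtain ⟨UK, P, P₀, -, hUK, h1, h2⟩ := hcomp K hKs hKc
  exact ⟨K, hK, UK, hUK, P, P₀, h1, h2⟩

variable [RiemannianBundle (fun x : M => TangentSpace (𝓡 n) x)]
    [IsContMDiffRiemannianBundle (𝓡 n) ∞ (EuclideanSpace ℝ (Fin n))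
      (fun x : M => TangentSpace (𝓡 n) x)] [IsRiemannianManifold (𝓡 n) M]

theorem IsAdaptedFrame.isFrameSystem (hU : IsOpen U) (hX : IsAdaptedFrame S U X deg) :
    IsFrameSystem U X (frameNorm X) where
  isOpen := hU
  smooth := hX.smooth
  chart _ hp := exists_isFrameChart hU hX.smooth hp (hX.linearIndependent hp)
  norm_add_le x _ v w := frameNorm_add_le x v w
  norm_smul x _ s v := frameNorm_smul x s v
  norm_pos _ hx _ hv := frameNorm_pos (hX.linearIndependent hx) hv

end NormalFrame

theorem IsGoodRadius.exists_isScaledLogLimit {n : ℕ} {M : Type*} [MetricSpace M]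
    [ChartedSpace (EuclideanSpace ℝ (Fin n)) M] [IsManifold (𝓡 n) ∞ M] {U : Set M}
    {X : Fin n → VField n M} {g : M → (Fin n → ℝ) → ℝ} {ρ : M → ℝ} {w : Fin n → ℕ}
    (hρ : IsGoodRadius U X ρ) (h : IsFrameSystem U X g) (hw : ∀ i, 1 ≤ w i)
    (hcomp : ∀ p ∈ U, HasComposition U X w p) : ∃ P, IsScaledLogLimit U X ρ w P := by
  have h1 : ∀ (x : M) (a b : Fin n → ℝ), ∃ c, x ∈ U →
      Tendsto (scaledLog U X ρ w) (𝓝[>] 0 ×ˢ 𝓝 (x, a, b)) (𝓝 c) := by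
    intro x a b
    by_cases hx : x ∈ U
    · obtain ⟨c, hc⟩ := hρ.exists_tendsto_scaledLog h hw hx (hcomp x hx) a b
      exact ⟨c, fun _ => hc⟩
    · exact ⟨0, fun hx' => absurd hx' hx⟩
  choose P hP using h1
  exact ⟨P, fun x hx a b => hP x a b hx⟩

end SubRiem

/-! ### The theorem -/

theorem mainTheorem7 {n m : ℕ} {M : Type*} [MetricSpace M] [ConnectedSpace M]
    [ChartedSpace (EuclideanSpace ℝ (Fin n)) M] [IsManifold (𝓡 n) ∞ M]
    -- the Riemannian metric and its distance
    [Bundle.RiemannianBundle (fun x : M => TangentSpace (𝓡 n) x)]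
    [IsContMDiffRiemannianBundle (𝓡 n) ∞ (EuclideanSpace ℝ (Fin n))
      (fun x : M => TangentSpace (𝓡 n) x)]
    [IsRiemannianManifold (𝓡 n) M]
    -- the regular sub-Riemannian structure, whose metric is extended by the Riemannian one
    (S : SubRiem.SubRiemannianStructure n m M) (hS : SubRiem.IsRegular S)
    (hext : ∀ (x : M) (v w : S.D x),
      inner ℝ (v : TangentSpace (𝓡 n) x) (w : TangentSpace (𝓡 n) x) = S.metric x v w)
    -- the normal frame
    (U : Set M) (hU : IsOpen U) (X : Fin n → SubRiem.VField n M) (deg : Fin n → ℕ)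
    (hX : SubRiem.IsNormalFrame S U X deg) :
    ∃ ρ₀ : M → ℝ, SubRiem.IsAdmissibleRadius U X ρ₀ ∧
      ∀ ρ : M → ℝ, ContinuousOn ρ U → (∀ x ∈ U, 0 < ρ x ∧ ρ x ≤ ρ₀ x) →
        ∃ Q₀ : M → M → M,
          SubRiem.IsCoherentProjection U (SubRiem.riemDilation U X ρ)
            (SubRiem.frameProjection U X ρ deg) Q₀ ∧
          SubRiem.ConditionA U (SubRiem.riemDilation U X ρ)
            (SubRiem.frameProjection U X ρ deg) ∧
          SubRiem.ConditionB U (SubRiem.riemDilation U X ρ)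
            (SubRiem.frameProjection U X ρ deg) Q₀ ∧
          (∃ Sigma : M → M → M → M, SubRiem.UniformLimitNear U
            (SubRiem.approxSum (SubRiem.srDilation U X ρ deg)) Sigma) ∧
          ∀ x ∈ U, ∀ u ∈ (SubRiem.srDilation U X ρ deg).U x,
            Q₀ x u ∈ SubRiem.tangentDistribution (SubRiem.srDilation U X ρ deg) x := by
  have : LocallyCompactSpace M := ChartedSpace.locallyCompactSpace (EuclideanSpace ℝ (Fin n)) M
  have hsys := hX.adapted.isFrameSystem hU
  have hdeg := hX.adapted.deg_pos
  obtain ⟨σ, hσ⟩ := hsys.exists_isGoodRadius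
  have hhalf : ∀ x ∈ U, 0 < σ x / 2 ∧ σ x / 2 ≤ σ x := fun x hx =>
    ⟨half_pos (hσ.pos x hx), half_le_self (hσ.pos x hx).le⟩
  -- Halving the good radius makes every admissible `ρ` strictly smaller than `σ`, the room needed
  -- for the extension in (A1).
  refine ⟨fun x => σ x / 2,
    (hσ.mono (hσ.continuousOn.div_const 2) hhalf).isAdmissibleRadius, fun ρ hρc hρ₀ => ?_⟩
  have hρσ : ∀ x ∈ U, ρ x < σ x := fun x hx =>
    (hρ₀ x hx).2.trans_lt (half_lt_self (hσ.pos x hx))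
  have hρ := hσ.mono hρc fun x hx => ⟨(hρ₀ x hx).1, (hρσ x hx).le⟩
  obtain ⟨P, hP⟩ := hρ.exists_isScaledLogLimit hsys hdeg fun p hp => hX.hasComposition hU hp
  refine ⟨SubRiem.limitProjection U X ρ deg, hP.isCoherentProjection hρ hsys hdeg hσ hρσ,
    hρ.conditionA hsys hdeg, hρ.conditionB hsys hdeg,
    ⟨_, hP.uniformLimitNear_approxSum hρ hsys hdeg⟩, fun x hx u hu => ?_⟩
  obtain ⟨a, ha, rfl⟩ := SubRiem.mem_frameMaps_U.1 hu
  rw [hρ.limitProjection_frameExp hx ha]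
  -- The coordinates of `Q^x u` have only degree one entries, so `δ_s` multiplies them by `s`, and
  -- `s ↦ δ_s^x Q^x u` is a one-parameter group.
  exact hρ.mem_tangentDistribution hsys hx ((SubRiem.norm_scale_le _ le_rfl zero_le_one a).trans_lt ha)
    fun s => SubRiem.scale_scale_pred_zero hdeg s a
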